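/- Let $L>0$, $\gamma<0$, $1<p<3$ and $m>0$. Let $\mathbb S_L=\mathbb R\times[0,L]$ with coordinates $(x,y)$, and let $H^1(\mathbb S_L)$ be the Sobolev space of complex-valued functions on $\mathbb S_L$. For $u\in H^1(\mathbb S_L)$ let $u(0,y)$, $y\in(0,L)$, denote the trace of $u$ on the line $x=0$, and put \[ E_\gamma(u)=\frac12\|\nabla u\|_{L^2(\mathbb S_L)}^2+\frac{\gamma}{2}\int_0^L|u(0,y)|^2\,dy-\frac1{p+1}\|u\|_{L^{p+1}(\mathbb S_L)}^{p+1},\qquad M(u)=\|u\|_{L^2(\mathbb S_L)}^2 . \] Then there exists a real-valued and (almost everywhere) positive $u\in H^1(\mathbb S_L)$ with $M(u)=m$ and \[ E_\gamma(u)=\min\{E_\gamma(v):v\in H^1(\mathbb S_L),\ M(v)=m\}. \] Moreover, there exists $\omega>\gamma^2/4$ such that this $u$ solves \[ -\partial_{xx}u-\partial_{yy}u+\omega u+\gamma\delta_0(x)u-|u|^{p-1}u=0\ \text{ in }\mathbb S_L,\qquad \partial_\nu u=0\ \text{ on }\partial\mathbb S_L=\mathbb R\times\{0,L\}, \] in the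 weak sense, that is, for every $v\in H^1(\mathbb S_L)$, \[ \mathrm{Re}\int_{\mathbb S_L}\nabla u\cdot\overline{\nabla v}\,dx\,dy+\omega\,\mathrm{Re}\int_{\mathbb S_L}u\overline v\,dx\,dy+\gamma\,\mathrm{Re}\int_0^Lu(0,y)\overline{v(0,y)}\,dy-\mathrm{Re}\int_{\mathbb S_L}|u|^{p-1}u\overline v\,dx\,dy=0 . \] -/

import Mathlib

open MeasureTheory Set Filter Topology

namespace DeltaStrip

noncomputable section

/-- The strip `ℝ × [0, L]`; the first coordinate is `x`, the second one is `y`. -/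
def strip (L : ℝ) : Set (ℝ × ℝ) := univ ×ˢ Icc 0 L

/-- Lebesgue measure on the strip. -/
def stripMeasure (L : ℝ) : Measure (ℝ × ℝ) := volume.restrict (strip L)

/-- Smooth functions with compact support in the open strip `ℝ × (0, L)`. -/
def IsTestFunction (L : ℝ) (φ : ℝ × ℝ → ℝ) : Prop :=
  ContDiff ℝ (⊤ : ℕ∞) φ ∧ HasCompactSupport φ ∧ tsupport φ ⊆ univ ×ˢ Ioo 0 L

/-- `g` is the derivative of `u` in the direction `e`, in the sense of distributions on the
open strip. -/
def IsWeakDeriv (L : ℝ) (e : ℝ × ℝ) (u g : ℝ × ℝ → ℂ) : Prop :=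
  ∀ φ : ℝ × ℝ → ℝ, IsTestFunction L φ →
    ∫ z, (fderiv ℝ φ z e) • u z ∂(stripMeasure L) = -∫ z, φ z • g z ∂(stripMeasure L)

/-- The complex Sobolev space `H¹` of the strip. An element is given by a square integrable
function `toFun` together with (representatives of) its weak partial derivatives `dx` and `dy`,
which are square integrable and are determined by `toFun` up to null sets. -/
structure H1 (L : ℝ) where
  /-- the function -/
  toFun : ℝ × ℝ → ℂ
  /-- the weak partial derivative in `x` -/
  dx : ℝ × ℝ → ℂ
  /-- the weak partial derivative in `y` -/
  dy : ℝ × ℝ → ℂ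
  memLp_toFun : MemLp toFun 2 (stripMeasure L)
  memLp_dx : MemLp dx 2 (stripMeasure L)
  memLp_dy : MemLp dy 2 (stripMeasure L)
  isWeakDeriv_dx : IsWeakDeriv L (1, 0) toFun dx
  isWeakDeriv_dy : IsWeakDeriv L (0, 1) toFun dy

instance (L : ℝ) : CoeFun (H1 L) (fun _ => ℝ × ℝ → ℂ) := ⟨H1.toFun⟩

open Classical in
/-- The trace `u(0, y)` on the line `x = 0`: the value at `x = 0` of the precise representative
of `u(·, y)`, i.e. the limit of the means of `u(·, y)` over the intervals `(-r, r)` as `r → 0+`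
(and `0` if there is no limit). For `u` in `H¹` of the strip, `u(·, y)` agrees almost everywhere
with an absolutely continuous function for almost every `y` in `(0, L)`, and the limit is its
value at `0`. -/
def trace (u : ℝ × ℝ → ℂ) (y : ℝ) : ℂ :=
  if h : ∃ l : ℂ, Tendsto (fun r : ℝ => (2 * r)⁻¹ • ∫ x in (-r)..r, u (x, y)) (𝓝[>] 0) (𝓝 l)
  then h.choose else 0

/-- The trace of a continuous function is its restriction to the line `x = 0`. -/
theorem trace_of_continuous (u : ℝ × ℝ → ℂ) (y : ℝ) (hu : Continuous (fun x => u (x, y))) :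
    trace u y = u (0, y) := by
  have key : Tendsto (fun r : ℝ => (2 * r)⁻¹ • ∫ x in (-r)..r, u (x, y)) (𝓝[>] 0)
      (𝓝 (u (0, y))) := by
    have h1 : HasDerivAt (fun r => ∫ x in (0 : ℝ)..r, u (x, y)) (u (0, y)) 0 :=
      intervalIntegral.integral_hasDerivAt_right (hu.intervalIntegrable 0 0)
        (hu.stronglyMeasurableAtFilter _ _) hu.continuousAt
    have h2 : HasDerivAt (fun r => ∫ x in (0 : ℝ)..(-r), u (x, y)) (-u (0, y)) 0 := by
      have h1' : HasDerivAt (fun r => ∫ x in (0 : ℝ)..r, u (x, y)) (u (0, y)) (-0) := by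
        simpa using h1
      simpa [Function.comp_def] using h1'.scomp (0 : ℝ) (hasDerivAt_neg (0 : ℝ))
    have h3 := ((h1.sub h2).tendsto_slope_zero_right).const_smul (2⁻¹ : ℝ)
    have e : (2⁻¹ : ℝ) • (u (0, y) - -u (0, y)) = u (0, y) := by
      rw [sub_neg_eq_add, ← two_smul ℝ, smul_smul]
      norm_num
    rw [e] at h3
    refine h3.congr fun r => ?_
    rw [smul_smul, mul_inv]
    congr 1
    simp only [Pi.sub_apply, zero_add, neg_zero, intervalIntegral.integral_same, sub_zero]
    rw [intervalIntegral.integral_interval_sub_left (hu.intervalIntegrable _ _)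
      (hu.intervalIntegrable _ _)]
  have h : ∃ l : ℂ, Tendsto (fun r : ℝ => (2 * r)⁻¹ • ∫ x in (-r)..r, u (x, y)) (𝓝[>] 0)
      (𝓝 l) := ⟨_, key⟩
  rw [trace, dif_pos h]
  exact tendsto_nhds_unique h.choose_spec key

/-- The mass `M(u) = ‖u‖²` in `L²` of the strip. -/
def mass {L : ℝ} (u : H1 L) : ℝ := ∫ z, ‖u z‖ ^ 2 ∂(stripMeasure L)

/-- The energy
`E(u) = 1/2 ‖∇u‖² + γ/2 ∫₀ᴸ |u(0, y)|² dy - 1/(p + 1) ∫ |u|^(p + 1)`. -/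
def energy {L : ℝ} (γ p : ℝ) (u : H1 L) : ℝ :=
  1 / 2 * (∫ z, (‖u.dx z‖ ^ 2 + ‖u.dy z‖ ^ 2) ∂(stripMeasure L))
    + γ / 2 * (∫ y in Icc 0 L, ‖trace u y‖ ^ 2)
    - 1 / (p + 1) * (∫ z, ‖u z‖ ^ (p + 1) ∂(stripMeasure L))

/-- `u` is an energy ground state of mass `m`: it has mass `m` and its energy is the minimum of
the energy over all functions in `H¹` of the strip of mass `m`. -/
def IsEnergyGroundState {L : ℝ} (γ p m : ℝ) (u : H1 L) : Prop :=
  mass u = m ∧ IsLeast {e : ℝ | ∃ v : H1 L, mass v = m ∧ energy γ p v = e} (energy γ p u)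

/-- `u` is a real-valued and positive function (as an element of `H¹`, i.e. up to null sets). -/
def IsRealPositive {L : ℝ} (u : H1 L) : Prop :=
  ∀ᵐ z ∂(stripMeasure L), (u z).im = 0 ∧ 0 < (u z).re

/-- `u` solves `-∂ₓₓu - ∂ᵧᵧu + ωu + γ δ₀(x) u - |u|^(p - 1) u = 0` in the strip with
`∂ᵥu = 0` on its boundary. The equation is read in the dual of `H¹`; the Neumann condition is
expressed by the test functions `v` being free on the boundary. -/
def IsSolution {L : ℝ} (γ p ω : ℝ) (u : H1 L) : Prop :=
  ∀ v : H1 L,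
    (∫ z, (u.dx z * star (v.dx z) + u.dy z * star (v.dy z)).re ∂(stripMeasure L))
      + ω * (∫ z, (u z * star (v z)).re ∂(stripMeasure L))
      + γ * (∫ y in Icc 0 L, (trace u y * star (trace v y)).re)
      - (∫ z, ‖u z‖ ^ (p - 1) * (u z * star (v z)).re ∂(stripMeasure L)) = 0

end

end DeltaStrip

/-! Existence. Three inequalities carry the variational part. The trace satisfies ∫|u(0,y)|² ≤
‖u‖‖∂ₓu‖ with the sharp constant 1 (`H1.traceSq_le`), so the quadratic part of the energy is at
least -(γ²/8) M(u). Ladyzhenskaya's inequality bounds ‖u‖₄⁴ by the supremum over x of ∫|u(x,y)|² dy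
times an H¹ quantity (`H1.integral_pow_four_le`). Since p + 1 < 4, interpolation between L² and L⁴
then makes the energy coercive on each mass sphere.

The trial function exp(γ|x|/2) attains the bound -(γ²/8) M in the quadratic part and has a nonzero
nonlinear term, so the infimum I lies strictly below -(γ²/8) m (`exists_energy_lt`). Hence the
nonlinear term of a minimizing sequence stays away from 0. By Ladyzhenskaya's inequality, some cross
section then carries a fixed amount of L² mass. Translating that cross section to x = 0, where it is
not there already, does not raise the energy because γ < 0. The traces may therefore be assumed
bounded below (`exists_le_traceSq`), and since the trace is compact by Rellich's theorem, the weak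
limit v is not zero.

With wₙ = uₙ - v, mass and gradient split by weak convergence, the trace converges, and the
nonlinear term splits up to a small error. So E(v) + E(wₙ) ≤ I + o(1). Scaling gives E(w) ≥ (M(w)/m)
I for M(w) ≤ m, strictly if 0 < M(w) < m (`mul_le_energy_of_mass_le`). Thus E(v) ≤ (M(v)/m) I, and
strictness forces M(v) = m, so v is a minimizer; strong convergence is never needed.

Equation and sign. The modulus |v| has no larger energy, so it is a minimizer too. Rescaling |v| +
tφ to mass m and differentiating at t = 0 yields the equation. Testing it with exp(γ|x|/2) cancels
the trace terms and leaves (ω - γ²/4) ∫ uψ = ∫ uᵖψ > 0. For positivity, the test function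
exp(-|x|)/(u + ε) bounds a weighted L² norm of ∇ log(u + ε) independently of ε. Poincaré's
inequality on a box then shows that u cannot vanish on one set of positive measure and exceed δ > 0
on another (`measure_mul_measure_eq_zero`).

Foundation. A function is in H¹ exactly when it and its partial derivatives are square integrable
and it agrees on almost every coordinate line with an indefinite integral of the partial derivative.
Traces, translates, moduli and products are all treated line by line through this criterion. -/

namespace DeltaStrip

/-! ### Absolutely continuous functions of one variable -/

section AbsoluteContinuity

variable {X Y E : Type*} [PseudoMetricSpace X] [PseudoMetricSpace Y]
  [NormedAddCommGroup E] [NormedSpace ℝ E]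

/-- The sums defining absolute continuity of `f` are at most K times those of `h`, hence vanish
along the same filter. This serves for primitives, compared with the primitive of ‖g‖, and for
Lipschitz compositions. -/
theorem absolutelyContinuousOnInterval_of_dist_le {f : ℝ → X} {h : ℝ → Y} {a b K : ℝ}
    (hh : AbsolutelyContinuousOnInterval h a b)
    (H : ∀ x ∈ uIcc a b, ∀ y ∈ uIcc a b, dist (f x) (f y) ≤ K * dist (h x) (h y)) :
    AbsolutelyContinuousOnInterval f a b := by
  have h2 := Tendsto.const_mul K hh
  rw [mul_zero] at h2
  refine squeeze_zero' (Eventually.of_forall fun E => Finset.sum_nonneg fun _ _ => dist_nonneg)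
    ?_ h2
  have : ∀ᶠ E : ℕ × (ℕ → ℝ × ℝ) in AbsolutelyContinuousOnInterval.totalLengthFilter ⊓
      𝓟 (AbsolutelyContinuousOnInterval.disjWithin a b),
      E ∈ AbsolutelyContinuousOnInterval.disjWithin a b :=
    eventually_inf_principal.mpr (by simp)
  filter_upwards [this] with E hE
  rw [Finset.mul_sum]
  exact Finset.sum_le_sum fun i hi => H _ (hE.1 i hi).1 _ (hE.1 i hi).2

theorem absolutelyContinuousOnInterval_of_integral_eq {g F : ℝ → E} {a b : ℝ}
    (hg : IntervalIntegrable g volume a b)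
    (hF : ∀ x ∈ uIcc a b, ∀ y ∈ uIcc a b, F y - F x = ∫ t in x..y, g t) :
    AbsolutelyContinuousOnInterval F a b := by
  have h1 := hg.norm.absolutelyContinuousOnInterval_intervalIntegral (c := a) left_mem_uIcc
  refine absolutelyContinuousOnInterval_of_dist_le (K := 1) h1 fun x hx y hy => ?_
  have hi : ∀ x ∈ uIcc a b, ∀ y ∈ uIcc a b, IntervalIntegrable (fun t => ‖g t‖) volume x y :=
    fun x hx y hy => hg.norm.mono_set (uIcc_subset_uIcc hx hy)
  rw [dist_comm, dist_eq_norm, hF x hx y hy, one_mul, dist_comm, Real.dist_eq,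
    intervalIntegral.integral_interval_sub_left (hi _ left_mem_uIcc _ hy)
      (hi _ left_mem_uIcc _ hx)]
  exact intervalIntegral.norm_integral_le_abs_integral_norm

variable [CompleteSpace E]

theorem ae_hasDerivAt_of_integral_eq {g F : ℝ → E} {a b : ℝ}
    (hg : IntervalIntegrable g volume a b)
    (hF : ∀ x ∈ uIcc a b, ∀ y ∈ uIcc a b, F y - F x = ∫ t in x..y, g t) :
    ∀ᵐ x, x ∈ uIcc a b → HasDerivAt F (g x) x := by
  -- `F` is known only on the interval, so the two end points are discarded in order that the
  -- remaining points have a neighbourhood inside it.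
  have hne : ∀ c : ℝ, ∀ᵐ x : ℝ, x ≠ c := fun c => by simp [ae_iff]
  filter_upwards [hg.ae_hasDerivAt_integral, hne a, hne b] with x hx hxa hxb hxI
  have h1 : HasDerivAt (fun x => F a + ∫ t in a..x, g t) (g x) x :=
    (hx hxI a left_mem_uIcc).const_add _
  refine h1.congr_of_eventuallyEq ?_
  have : uIcc a b ∈ 𝓝 x := by
    rw [uIcc] at hxI ⊢
    refine Icc_mem_nhds (lt_of_le_of_ne hxI.1 ?_) (lt_of_le_of_ne hxI.2 ?_)
    · rcases min_choice a b with h | h <;> rw [h] <;> tauto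
    · rcases max_choice a b with h | h <;> rw [h] <;> tauto
  filter_upwards [this] with y hy
  rw [← hF a left_mem_uIcc y hy]; abel

/-- The difference of F and the primitive of g is absolutely continuous with derivative zero almost
everywhere, hence constant. -/
theorem integral_eq_sub_of_absolutelyContinuousOnInterval {g F : ℝ → E} {a b : ℝ}
    (hF : AbsolutelyContinuousOnInterval F a b) (hg : IntervalIntegrable g volume a b)
    (hd : ∀ᵐ x, x ∈ uIcc a b → HasDerivAt F (g x) x) :
    F b - F a = ∫ t in a..b, g t := by
  have hP : ∀ x ∈ uIcc a b, ∀ y ∈ uIcc a b,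
      (∫ t in a..y, g t) - (∫ t in a..x, g t) = ∫ t in x..y, g t := fun x hx y hy =>
    intervalIntegral.integral_interval_sub_left
      (hg.mono_set (uIcc_subset_uIcc left_mem_uIcc hy))
      (hg.mono_set (uIcc_subset_uIcc left_mem_uIcc hx))
  have h1 := absolutelyContinuousOnInterval_of_integral_eq hg hP
  have h2 := ae_hasDerivAt_of_integral_eq hg hP
  obtain ⟨C, hC⟩ := (hF.sub h1).const_of_ae_hasDerivAt_zero (by
    filter_upwards [hd, h2] with x hx hx' hxI
    simpa using (hx hxI).sub (hx' hxI))
  have ha := hC a left_mem_uIcc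
  have hb := hC b right_mem_uIcc
  simp only [Pi.sub_apply, intervalIntegral.integral_same, sub_zero] at ha hb
  rw [ha, ← hb]; abel

end AbsoluteContinuity

/-! ### Calculus of indefinite integrals -/

section Primitive

variable {E : Type*} [NormedAddCommGroup E] [NormedSpace ℝ E] {I : Set ℝ}

/-- `F` is an indefinite integral of `g` on `I`. -/
def PrimitiveOn (I : Set ℝ) (F g : ℝ → E) : Prop :=
  ∀ a ∈ I, ∀ b ∈ I, IntervalIntegrable g volume a b ∧ F b - F a = ∫ x in a..b, g x

namespace PrimitiveOn

theorem mono {J : Set ℝ} {F g : ℝ → E} (h : PrimitiveOn I F g) (hJ : J ⊆ I) :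
    PrimitiveOn J F g := fun a ha b hb => h a (hJ ha) b (hJ hb)

theorem congr_deriv {F g g' : ℝ → E} (hI : I.OrdConnected) (h : PrimitiveOn I F g)
    (hg : ∀ᵐ x, x ∈ I → g x = g' x) : PrimitiveOn I F g' := by
  intro a ha b hb
  have h2 : ∀ᵐ x, x ∈ uIoc a b → g x = g' x := by
    filter_upwards [hg] with x hx hxI
    exact hx (hI.uIcc_subset ha hb (uIoc_subset_uIcc hxI))
  refine ⟨(h a ha b hb).1.congr_ae ?_, ?_⟩
  · exact (ae_restrict_iff' measurableSet_uIoc).2 h2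
  · rw [(h a ha b hb).2]; exact intervalIntegral.integral_congr_ae h2

theorem add {F g F' g' : ℝ → E} (h : PrimitiveOn I F g) (h' : PrimitiveOn I F' g') :
    PrimitiveOn I (fun x => F x + F' x) (fun x => g x + g' x) := fun a ha b hb => by
  refine ⟨(h a ha b hb).1.add (h' a ha b hb).1, ?_⟩
  rw [intervalIntegral.integral_add (h a ha b hb).1 (h' a ha b hb).1, ← (h a ha b hb).2,
    ← (h' a ha b hb).2]
  exact add_sub_add_comm _ _ _ _

theorem const_smul {𝕜 : Type*} [RCLike 𝕜] [NormedSpace 𝕜 E] [SMulCommClass ℝ 𝕜 E]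
    {F g : ℝ → E} (c : 𝕜) (h : PrimitiveOn I F g) :
    PrimitiveOn I (fun x => c • F x) (fun x => c • g x) := fun a ha b hb => by
  refine ⟨(h a ha b hb).1.smul c, ?_⟩
  rw [intervalIntegral.integral_smul, ← (h a ha b hb).2, smul_sub]

theorem absolutelyContinuousOnInterval {F g : ℝ → E} (hI : I.OrdConnected)
    (h : PrimitiveOn I F g) {a b : ℝ} (ha : a ∈ I) (hb : b ∈ I) :
    AbsolutelyContinuousOnInterval F a b :=
  absolutelyContinuousOnInterval_of_integral_eq (h a ha b hb).1 fun x hx y hy =>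
    (h x (hI.uIcc_subset ha hb hx) y (hI.uIcc_subset ha hb hy)).2

theorem ae_hasDerivAt [CompleteSpace E] {F g : ℝ → E} (hI : I.OrdConnected)
    (h : PrimitiveOn I F g) {a b : ℝ} (ha : a ∈ I) (hb : b ∈ I) :
    ∀ᵐ x, x ∈ uIcc a b → HasDerivAt F (g x) x :=
  ae_hasDerivAt_of_integral_eq (h a ha b hb).1 fun x hx y hy =>
    (h x (hI.uIcc_subset ha hb hx) y (hI.uIcc_subset ha hb hy)).2

theorem continuousOn_uIcc {F g : ℝ → E} (hI : I.OrdConnected)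
    (h : PrimitiveOn I F g) {a b : ℝ} (ha : a ∈ I) (hb : b ∈ I) : ContinuousOn F (uIcc a b) :=
  (h.absolutelyContinuousOnInterval hI ha hb).continuousOn

theorem continuous {F g : ℝ → E} (h : PrimitiveOn univ F g) : Continuous F := by
  rw [continuous_iff_continuousAt]
  intro x
  refine (h.continuousOn_uIcc ordConnected_univ (a := x - 1) (b := x + 1) (mem_univ _)
    (mem_univ _)).continuousAt ?_
  rw [uIcc_of_le (by linarith)]
  exact Icc_mem_nhds (by linarith) (by linarith)

variable [CompleteSpace E]

theorem of_absolutelyContinuousOnInterval {F g : ℝ → E}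
    (h : ∀ a ∈ I, ∀ b ∈ I, AbsolutelyContinuousOnInterval F a b ∧
      IntervalIntegrable g volume a b ∧ ∀ᵐ x, x ∈ uIcc a b → HasDerivAt F (g x) x) :
    PrimitiveOn I F g := fun a ha b hb =>
  ⟨(h a ha b hb).2.1, integral_eq_sub_of_absolutelyContinuousOnInterval (h a ha b hb).1
    (h a ha b hb).2.1 (h a ha b hb).2.2⟩

/-- For real values the integrability of the derivative need not be assumed: it follows from
absolute continuity. -/
theorem of_absolutelyContinuousOnInterval_real {F g : ℝ → ℝ}
    (h : ∀ a ∈ I, ∀ b ∈ I, AbsolutelyContinuousOnInterval F a b ∧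
      ∀ᵐ x, x ∈ uIcc a b → HasDerivAt F (g x) x) :
    PrimitiveOn I F g := by
  refine of_absolutelyContinuousOnInterval fun a ha b hb => ⟨(h a ha b hb).1, ?_, (h a ha b hb).2⟩
  refine (h a ha b hb).1.intervalIntegrable_deriv.congr_ae ?_
  refine (ae_restrict_iff' measurableSet_uIoc).2 ?_
  filter_upwards [(h a ha b hb).2] with x hx hxI
  exact (hx (uIoc_subset_uIcc hxI)).deriv

/-- An absolutely continuous function composed with a map which is Lipschitz on its range. -/
theorem comp_of_dist_le {F g : ℝ → E} (hI : I.OrdConnected) (h : PrimitiveOn I F g)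
    {G : E → ℝ} {g' : ℝ → ℝ} {K : ℝ} {s : Set E} (hs : ∀ x ∈ I, F x ∈ s)
    (hG : ∀ u ∈ s, ∀ v ∈ s, |G u - G v| ≤ K * ‖u - v‖)
    (hd : ∀ x ∈ I, HasDerivAt F (g x) x → DifferentiableAt ℝ (fun x => G (F x)) x →
      HasDerivAt (fun x => G (F x)) (g' x) x) :
    PrimitiveOn I (fun x => G (F x)) g' := by
  refine of_absolutelyContinuousOnInterval_real fun a ha b hb => ?_
  have hac : AbsolutelyContinuousOnInterval (fun x => G (F x)) a b :=
    absolutelyContinuousOnInterval_of_dist_le (h.absolutelyContinuousOnInterval hI ha hb)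
      fun x hx y hy => by
        rw [Real.dist_eq, dist_eq_norm]
        exact hG _ (hs x (hI.uIcc_subset ha hb hx)) _ (hs y (hI.uIcc_subset ha hb hy))
  refine ⟨hac, ?_⟩
  -- Differentiability of the composition almost everywhere comes from its absolute continuity; `hd`
  -- only has to identify the value of the derivative.
  filter_upwards [h.ae_hasDerivAt hI ha hb, hac.ae_differentiableAt] with x h1 h2 hx
  exact hd x (hI.uIcc_subset ha hb hx) (h1 hx) (h2 hx)

theorem smul {F g : ℝ → E} (hI : I.OrdConnected) (h : PrimitiveOn I F g) {c c' : ℝ → ℝ}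
    (hc : PrimitiveOn I c c') :
    PrimitiveOn I (fun x => c x • F x) (fun x => c x • g x + c' x • F x) := by
  refine of_absolutelyContinuousOnInterval fun a ha b hb =>
    ⟨(hc.absolutelyContinuousOnInterval hI ha hb).smul
      (h.absolutelyContinuousOnInterval hI ha hb), ?_, ?_⟩
  · exact ((h a ha b hb).1.continuousOn_smul (hc.continuousOn_uIcc hI ha hb)).add
      ((hc a ha b hb).1.smul_continuousOn (h.continuousOn_uIcc hI ha hb))
  · filter_upwards [h.ae_hasDerivAt hI ha hb, hc.ae_hasDerivAt hI ha hb] with x h1 h2 hx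
    exact (h2 hx).smul (h1 hx)

theorem norm_sq {F g : ℝ → ℂ} (hI : I.OrdConnected) (h : PrimitiveOn I F g) :
    PrimitiveOn I (fun x => ‖F x‖ ^ 2) (fun x => 2 * inner ℝ (F x) (g x)) := by
  refine of_absolutelyContinuousOnInterval_real fun a ha b hb => ?_
  have hac := h.absolutelyContinuousOnInterval hI ha hb
  obtain ⟨M, hM⟩ := hac.exists_bound
  refine ⟨absolutelyContinuousOnInterval_of_dist_le (K := 2 * M) hac fun x hx y hy => ?_, ?_⟩
  · have h1 := hM x hx
    have h2 := hM y hy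
    have h3 := abs_norm_sub_norm_le (F x) (F y)
    rw [Real.dist_eq, dist_eq_norm, sq_sub_sq, abs_mul, abs_of_nonneg (by positivity)]
    exact mul_le_mul (by linarith) h3 (abs_nonneg _) (by linarith [norm_nonneg (F x)])
  · filter_upwards [h.ae_hasDerivAt hI ha hb] with x h1 hx
    exact (h1 hx).norm_sq

/-- The derivative of the norm of `F` at a point with value `z` and derivative `w`. -/
noncomputable def normDeriv (z w : ℂ) : ℝ := inner ℝ z w / ‖z‖

theorem abs_normDeriv_le (z w : ℂ) : |normDeriv z w| ≤ ‖w‖ := by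
  rw [normDeriv, abs_div, abs_norm]
  by_cases hz : z = 0
  · simp [hz]
  · rw [div_le_iff₀ (norm_pos_iff.2 hz), mul_comm]
    exact abs_real_inner_le_norm z w

theorem norm {F g : ℝ → ℂ} (hI : I.OrdConnected) (h : PrimitiveOn I F g) :
    PrimitiveOn I (fun x => ‖F x‖) (fun x => normDeriv (F x) (g x)) := by
  refine h.comp_of_dist_le hI (s := univ) (K := 1) (G := fun z => ‖z‖) (fun _ _ => mem_univ _)
    (fun u _ v _ => by simpa using abs_norm_sub_norm_le u v) fun x _ h1 h2 => ?_
  -- At a zero of F the norm has a minimum, so its derivative vanishes where it exists. This matches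
  -- `normDeriv`, which is 0 there by division by zero.
  by_cases h0 : F x = 0
  · have hmin : IsLocalMin (fun x => ‖F x‖) x := by
      refine Eventually.of_forall fun y => ?_
      simp [h0]
    have := hmin.hasDerivAt_eq_zero h2.hasDerivAt
    rw [normDeriv, h0]
    simpa [this] using h2.hasDerivAt
  · have h3 := (h1.norm_sq).sqrt (by simpa using h0)
    simp only [Real.sqrt_sq (norm_nonneg _)] at h3
    convert! h3 using 1
    rw [normDeriv]; field_simp

theorem ofReal {F g : ℝ → ℝ} (h : PrimitiveOn I F g) :
    PrimitiveOn I (fun x => (F x : ℂ)) (fun x => (g x : ℂ)) := fun a ha b hb => by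
  refine ⟨⟨(h a ha b hb).1.1.ofReal, (h a ha b hb).1.2.ofReal⟩, ?_⟩
  rw [intervalIntegral.integral_ofReal, ← (h a ha b hb).2]; push_cast; rfl

theorem of_hasDerivAt {F g : ℝ → E} (hF : ∀ x, HasDerivAt F (g x) x) (hg : Continuous g) :
    PrimitiveOn univ F g := fun a _ b _ =>
  ⟨hg.intervalIntegrable a b, (intervalIntegral.integral_eq_sub_of_hasDerivAt (fun x _ => hF x)
    (hg.intervalIntegrable a b)).symm⟩

theorem integral_by_parts {F g : ℝ → E} {a b : ℝ} (h : PrimitiveOn (Icc a b) F g) (hab : a ≤ b)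
    {c c' : ℝ → ℝ} (hc : PrimitiveOn (Icc a b) c c') (hca : c a = 0) (hcb : c b = 0) :
    ∫ x in a..b, c' x • F x = -∫ x in a..b, c x • g x := by
  have ha : a ∈ Icc a b := left_mem_Icc.2 hab
  have hb : b ∈ Icc a b := right_mem_Icc.2 hab
  have h1 := (h.smul ordConnected_Icc hc a ha b hb).2
  rw [intervalIntegral.integral_add
    ((h a ha b hb).1.continuousOn_smul (hc.continuousOn_uIcc ordConnected_Icc ha hb))
    ((hc a ha b hb).1.smul_continuousOn (h.continuousOn_uIcc ordConnected_Icc ha hb))] at h1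
  simp only [hca, hcb, zero_smul, sub_zero] at h1
  exact eq_neg_of_add_eq_zero_right h1.symm

/-- Integrate the derivative 2⟨F, g⟩ of |F|² from y to x and enlarge the domain to the whole
interval. The integral term is then free of x and y and can be averaged over y. -/
theorem norm_sq_le {F g : ℝ → ℂ} {a b : ℝ} (h : PrimitiveOn (Icc a b) F g) {x y : ℝ}
    (hx : x ∈ Icc a b) (hy : y ∈ Icc a b) :
    ‖F x‖ ^ 2 ≤ ‖F y‖ ^ 2 + 2 * ∫ t in a..b, ‖F t‖ * ‖g t‖ := by
  have hab : a ≤ b := hx.1.trans hx.2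
  have ha : a ∈ Icc a b := left_mem_Icc.2 hab
  have hb : b ∈ Icc a b := right_mem_Icc.2 hab
  have hi : IntervalIntegrable (fun t => ‖F t‖ * ‖g t‖) volume a b :=
    (h a ha b hb).1.norm.continuousOn_mul (h.continuousOn_uIcc ordConnected_Icc ha hb).norm
  have h1 := (h.norm_sq ordConnected_Icc y hy x hx).2
  have h2 : |∫ t in y..x, 2 * inner ℝ (F t) (g t)| ≤ 2 * ∫ t in a..b, ‖F t‖ * ‖g t‖ := by
    have h3 : |∫ t in y..x, 2 * inner ℝ (F t) (g t)| ≤ |∫ t in y..x, 2 * (‖F t‖ * ‖g t‖)| := by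
      rw [← Real.norm_eq_abs]
      refine intervalIntegral.norm_integral_le_abs_of_norm_le (ae_of_all _ fun t => ?_)
        ((hi.mono_set ?_).const_mul 2)
      · rw [norm_mul, Real.norm_ofNat]
        gcongr
        exact abs_real_inner_le_norm _ _
      · rw [uIcc_of_le hab]
        exact ordConnected_Icc.uIcc_subset hy hx
    refine h3.trans ?_
    rw [intervalIntegral.integral_const_mul, abs_mul, abs_two]
    gcongr
    rw [intervalIntegral.abs_intervalIntegral_eq,
      abs_of_nonneg (setIntegral_nonneg measurableSet_uIoc fun t _ => by positivity),
      intervalIntegral.integral_of_le hab]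
    refine setIntegral_mono_set ((intervalIntegrable_iff_integrableOn_Ioc_of_le hab).1 hi)
      (ae_of_all _ fun t => by positivity) (LE.le.eventuallyLE ?_)
    rcases le_total y x with hyx | hyx
    · rw [uIoc_of_le hyx]; exact Ioc_subset_Ioc hy.1 hx.2
    · rw [uIoc_of_ge hyx]; exact Ioc_subset_Ioc hx.1 hy.2
  linarith [le_abs_self (∫ t in y..x, 2 * inner ℝ (F t) (g t))]

/-- The average over y of the previous estimate: a one-dimensional Sobolev bound, multiplied by the
length of the interval. -/
theorem mul_norm_sq_le {F g : ℝ → ℂ} {a b : ℝ} (h : PrimitiveOn (Icc a b) F g) {x : ℝ}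
    (hx : x ∈ Icc a b) :
    (b - a) * ‖F x‖ ^ 2 ≤
      (∫ t in a..b, ‖F t‖ ^ 2) + 2 * (b - a) * ∫ t in a..b, ‖F t‖ * ‖g t‖ := by
  have hab : a ≤ b := hx.1.trans hx.2
  have hi : IntervalIntegrable (fun t => ‖F t‖ ^ 2) volume a b :=
    ContinuousOn.intervalIntegrable
      ((h.continuousOn_uIcc ordConnected_Icc (left_mem_Icc.2 hab) (right_mem_Icc.2 hab)).norm.pow 2)
  have := intervalIntegral.integral_mono_on (μ := volume) hab
    (intervalIntegrable_const (c := ‖F x‖ ^ 2))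
    (hi.add (intervalIntegrable_const
      (c := 2 * ∫ t in a..b, ‖F t‖ * ‖g t‖))) fun t ht => h.norm_sq_le hx ht
  rw [intervalIntegral.integral_add hi intervalIntegrable_const] at this
  simp only [intervalIntegral.integral_const, smul_eq_mul] at this
  linarith

/-- Doubling a one-sided estimate: the value in the middle of an interval. -/
theorem norm_sq_zero_le {F g : ℝ → ℂ} (h : PrimitiveOn univ F g) {l : ℝ} (hl : 0 < l) :
    2 * l * ‖F 0‖ ^ 2 ≤
      (∫ t in (-l)..l, ‖F t‖ ^ 2) + 2 * l * ∫ t in (-l)..l, ‖F t‖ * ‖g t‖ := by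
  -- Each side of 0 contributes only its own integral. After division by 2l the factor of ∫|F||g| is
  -- therefore 1 and not 2, which is what makes the later spectral bound sharp.
  have h1 := (h.mono (subset_univ (Icc 0 l))).mul_norm_sq_le (left_mem_Icc.2 hl.le)
  have h2 := (h.mono (subset_univ (Icc (-l) 0))).mul_norm_sq_le
    (right_mem_Icc.2 (by linarith : -l ≤ 0))
  have hc := h.continuous
  have hi1 : ∀ a b, IntervalIntegrable (fun t => ‖F t‖ ^ 2) volume a b := fun a b =>
    (hc.norm.pow 2).intervalIntegrable a b
  have hi2 : ∀ a b, IntervalIntegrable (fun t => ‖F t‖ * ‖g t‖) volume a b := fun a b =>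
    (h a (mem_univ _) b (mem_univ _)).1.norm.continuousOn_mul hc.norm.continuousOn
  rw [← intervalIntegral.integral_add_adjacent_intervals (hi1 (-l) 0) (hi1 0 l),
    ← intervalIntegral.integral_add_adjacent_intervals (hi2 (-l) 0) (hi2 0 l)]
  nlinarith

theorem norm_sub_le_integral {F g : ℝ → ℂ} {a b : ℝ} (h : PrimitiveOn (Icc a b) F g) {x y : ℝ}
    (hx : x ∈ Icc a b) (hy : y ∈ Icc a b) :
    ‖F x - F y‖ ≤ ∫ t in a..b, ‖g t‖ := by
  have hab : a ≤ b := hx.1.trans hx.2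
  have hi := (h a (left_mem_Icc.2 hab) b (right_mem_Icc.2 hab)).1.norm
  rw [(h y hy x hx).2]
  refine intervalIntegral.norm_integral_le_abs_integral_norm.trans ?_
  rw [intervalIntegral.abs_intervalIntegral_eq,
    abs_of_nonneg (setIntegral_nonneg measurableSet_uIoc fun t _ => by positivity),
    intervalIntegral.integral_of_le hab]
  refine setIntegral_mono_set ((intervalIntegrable_iff_integrableOn_Ioc_of_le hab).1 hi)
    (ae_of_all _ fun t => by positivity) (LE.le.eventuallyLE ?_)
  rcases le_total y x with hyx | hyx
  · rw [uIoc_of_le hyx]; exact Ioc_subset_Ioc hy.1 hx.2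
  · rw [uIoc_of_ge hyx]; exact Ioc_subset_Ioc hx.1 hy.2

end PrimitiveOn

end Primitive

/-! ### Functions of one variable with vanishing weak derivative -/

section DuBoisReymond

variable {a b c d : ℝ}

/-- The primitive is continuous and vanishes at the rationals, hence everywhere; differentiate it.
Restricting to rational end points keeps the number of conditions countable, so that exceptional
null sets of a parameter can be united. -/
theorem ae_eq_zero_of_forall_rat_integral_eq_zero {f : ℝ → ℂ} (hf : IntegrableOn f (Ioo a b))
    (h : ∀ q : ℚ, (q : ℝ) ∈ Ioo a b → ∫ x in Ioo a (q : ℝ), f x = 0) :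
    ∀ᵐ x, x ∈ Ioo a b → f x = 0 := by
  rcases le_or_gt b a with hab | hab
  · simp [Ioo_eq_empty (not_lt.2 hab)]
  have hI : IntervalIntegrable f volume a b := by
    rw [intervalIntegrable_iff_integrableOn_Ioo_of_le hab.le]; exact hf
  have hcont : ContinuousOn (fun x => ∫ t in a..x, f t) (Icc a b) := by
    have := intervalIntegral.continuousOn_primitive_interval' hI left_mem_uIcc
    rwa [uIcc_of_le hab.le] at this
  have hzero : ∀ x ∈ Ioo a b, ∫ t in a..x, f t = 0 := by
    intro x hx
    by_contra hne
    have hopen : IsOpen (Ioo a b ∩ (fun x => ∫ t in a..x, f t) ⁻¹' {0}ᶜ) :=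
      (hcont.mono Ioo_subset_Icc_self).isOpen_inter_preimage isOpen_Ioo isOpen_compl_singleton
    obtain ⟨q, hq⟩ := Rat.denseRange_cast.exists_mem_open hopen ⟨x, hx, hne⟩
    refine hq.2 ?_
    have := h q hq.1
    simp only [mem_singleton_iff]
    rw [intervalIntegral.integral_of_le hq.1.1.le, integral_Ioc_eq_integral_Ioo, this]
  filter_upwards [hI.ae_hasDerivAt_integral] with x hx hxI
  have h1 := hx (by rw [uIcc_of_le hab.le]; exact Ioo_subset_Icc_self hxI) a left_mem_uIcc
  have h2 : HasDerivAt (fun x => ∫ t in a..x, f t) 0 x := by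
    refine (hasDerivAt_const x (0 : ℂ)).congr_of_eventuallyEq ?_
    filter_upwards [isOpen_Ioo.mem_nhds hxI] with y hy using hzero y hy
  exact h1.unique h2

/-- Smooth functions with compact support in an interval. -/
def IsBump (a b : ℝ) (α : ℝ → ℝ) : Prop :=
  ContDiff ℝ (⊤ : ℕ∞) α ∧ HasCompactSupport α ∧ tsupport α ⊆ Ioo a b

theorem IsBump.eq_zero {α : ℝ → ℝ} (h : IsBump a b α) {x : ℝ} (hx : x ∉ Ioo a b) : α x = 0 :=
  image_eq_zero_of_notMem_tsupport fun h' => hx (h.2.2 h')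

theorem IsBump.primitiveOn {α : ℝ → ℝ} (h : IsBump a b α) : PrimitiveOn univ α (deriv α) :=
  PrimitiveOn.of_hasDerivAt
    (fun x => ((h.1.differentiable (by simp)) x).hasDerivAt) (h.1.continuous_deriv (by simp))

theorem exists_isBump_integral_eq_one (hab : a < b) :
    ∃ η : ℝ → ℝ, IsBump a b η ∧ ∫ x, η x = 1 := by
  have hr : 0 < (b - a) / 2 := by linarith
  let f : ContDiffBump ((a + b) / 2) :=
    { rIn := (b - a) / 8, rOut := (b - a) / 4, rIn_pos := by linarith, rIn_lt_rOut := by linarith }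
  refine ⟨f.normed volume, ⟨f.contDiff_normed, f.hasCompactSupport_normed, ?_⟩, f.integral_normed⟩
  rw [f.tsupport_normed_eq, Real.closedBall_eq_Icc]
  exact fun x hx => ⟨by have := hx.1; simp only [f] at this; linarith,
    by have := hx.2; simp only [f] at this; linarith⟩

/-- A bump function with vanishing integral is the derivative of a bump function. -/
theorem IsBump.exists_primitive {ψ : ℝ → ℝ} (h : IsBump a b ψ) (h0 : ∫ x, ψ x = 0) :
    ∃ α, IsBump a b α ∧ ∀ x, deriv α x = ψ x := by
  have hc : Continuous ψ := h.1.continuous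
  have hd : ∀ x, HasDerivAt (fun x => ∫ t in a..x, ψ t) (ψ x) x := fun x =>
    intervalIntegral.integral_hasDerivAt_right (hc.intervalIntegrable _ _)
      (hc.stronglyMeasurableAtFilter _ _) hc.continuousAt
  have hderiv : deriv (fun x => ∫ t in a..x, ψ t) = ψ := funext fun x => (hd x).deriv
  rcases le_or_gt b a with hab | hab
  · have : ψ = 0 := funext fun x => h.eq_zero (by simp [Ioo_eq_empty (not_lt.2 hab)])
    exact ⟨0, ⟨contDiff_const, HasCompactSupport.zero, by simp [tsupport]⟩, by simp [this]⟩
  have hsub : ∃ p q, tsupport ψ ⊆ Icc p q ∧ Icc p q ⊆ Ioo a b ∧ p ≤ q := by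
    rcases (tsupport ψ).eq_empty_or_nonempty with he | hne
    · exact ⟨(a + b) / 2, (a + b) / 2, by simp [he],
        fun x hx => ⟨by linarith [hx.1], by linarith [hx.2]⟩, le_rfl⟩
    · have hK : IsCompact (tsupport ψ) := h.2.1
      refine ⟨sInf (tsupport ψ), sSup (tsupport ψ), subset_Icc_csInf_csSup hK.bddBelow hK.bddAbove,
        fun x hx => ⟨(h.2.2 (hK.sInf_mem hne)).1.trans_le hx.1,
          hx.2.trans_lt (h.2.2 (hK.sSup_mem hne)).2⟩, ?_⟩
      exact csInf_le hK.bddBelow (hK.sSup_mem hne)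
  obtain ⟨p, q, h1, h2, hpq⟩ := hsub
  have hψ : ∀ x, x ∉ Icc p q → ψ x = 0 := fun x hx =>
    image_eq_zero_of_notMem_tsupport fun h' => hx (h1 h')
  -- To the left of the support the primitive is trivially zero; to the right it equals the total
  -- integral, which is zero by hypothesis.
  have hout : ∀ x, x ∉ Icc p q → ∫ t in a..x, ψ t = 0 := by
    intro x hx
    have hpa := (h2 (left_mem_Icc.2 hpq)).1
    rcases lt_or_ge x p with hxp | hxp
    · rw [intervalIntegral.integral_congr (g := fun _ => 0), intervalIntegral.integral_zero]
      intro t ht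
      exact hψ t fun h' => by
        have := ht.2
        have := max_lt hpa hxp
        linarith [h'.1]
    · have hxq : q < x := by
        by_contra hcon
        exact hx ⟨hxp, not_lt.1 hcon⟩
      rw [intervalIntegral.integral_of_le (by linarith), setIntegral_eq_integral_of_forall_compl_eq_zero, h0]
      intro t ht
      exact hψ t fun h' => ht ⟨hpa.trans_le h'.1, h'.2.trans hxq.le⟩
  have hsupp : tsupport (fun x => ∫ t in a..x, ψ t) ⊆ Icc p q :=
    closure_minimal (fun x hx => by
      by_contra hcon
      exact hx (hout x hcon)) isClosed_Icc
  refine ⟨fun x => ∫ t in a..x, ψ t, ⟨?_, ?_, hsupp.trans h2⟩, fun x => (hd x).deriv⟩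
  · have : ContDiff ℝ ((⊤ : ℕ∞) : WithTop ℕ∞) (fun x => ∫ t in a..x, ψ t) := by
      rw [contDiff_infty_iff_deriv]
      refine ⟨fun x => (hd x).differentiableAt, ?_⟩
      rw [hderiv]; exact h.1
    exact this
  · exact HasCompactSupport.of_support_subset_isCompact isCompact_Icc
      ((subset_tsupport _).trans hsupp)

theorem IsBump.sub_const_mul {ψ η : ℝ → ℝ} (h : IsBump a b ψ) (h' : IsBump a b η) (r : ℝ) :
    IsBump a b (fun x => ψ x - r * η x) := by
  refine ⟨h.1.sub (contDiff_const.mul h'.1), ?_, ?_⟩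
  · exact h.2.1.sub (h'.2.1.mul_left (f := fun _ => r))
  · refine (tsupport_sub ψ (fun x => r * η x)).trans (union_subset h.2.2 ?_)
    exact (tsupport_mul_subset_right (f := fun _ => r)).trans h'.2.2

theorem IsBump.integrable_smul {α : ℝ → ℝ} (h : IsBump a b α) {V : ℝ → ℂ} {μ : Measure ℝ}
    (hV : Integrable V μ) : Integrable (fun x => α x • V x) μ := by
  obtain ⟨C, hC⟩ := h.2.1.exists_bound_of_continuous h.1.continuous
  exact hV.bdd_smul C h.1.continuous.aestronglyMeasurable (ae_of_all _ hC)

/-- The lemma of du Bois-Reymond: a function with vanishing weak derivative is constant. -/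
theorem ae_eq_integral_of_integral_deriv_eq_zero {V : ℝ → ℂ} (hV : IntegrableOn V (Ioo a b))
    (h : ∀ α, IsBump a b α → ∫ x in Ioo a b, deriv α x • V x = 0)
    {η : ℝ → ℝ} (hη : IsBump a b η) (h1 : ∫ x, η x = 1) :
    ∀ᵐ x, x ∈ Ioo a b → V x = ∫ t in Ioo a b, η t • V t := by
  set C := ∫ t in Ioo a b, η t • V t with hC
  have hVC : IntegrableOn (fun x => V x - C) (Ioo a b) :=
    hV.sub (integrableOn_const (by simp))
  suffices ∀ᵐ x, x ∈ Ioo a b → V x - C = 0 by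
    filter_upwards [this] with x hx hxI using sub_eq_zero.1 (hx hxI)
  refine isOpen_Ioo.ae_eq_zero_of_integral_contDiff_smul_eq_zero hVC.locallyIntegrableOn
    fun ψ hψ1 hψ2 hψ3 => ?_
  have hψ : IsBump a b ψ := ⟨hψ1, hψ2, hψ3⟩
  have hint : ∀ {f : ℝ → ℝ}, IsBump a b f → Integrable f := fun {f} hf =>
    hf.1.continuous.integrable_of_hasCompactSupport hf.2.1
  have hres : ∀ {f : ℝ → ℝ}, IsBump a b f → ∫ x in Ioo a b, f x = ∫ x, f x := fun {f} hf =>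
    setIntegral_eq_integral_of_forall_compl_eq_zero fun x hx => hf.eq_zero hx
  -- Subtracting (∫ψ) η leaves a bump of integral zero, hence the derivative of a bump, to which `h`
  -- applies.
  obtain ⟨α, hα, hα'⟩ := (hψ.sub_const_mul hη (∫ x, ψ x)).exists_primitive (by
    rw [integral_sub (hint hψ) ((hint hη).const_mul _), integral_const_mul, h1]; ring)
  have h2 := h α hα
  simp only [hα', sub_smul, mul_smul] at h2
  rw [integral_sub (hψ.integrable_smul hV) (show Integrable (fun x => (∫ x, ψ x) • η x • V x) _ from
    (hη.integrable_smul hV).smul (∫ x, ψ x)), integral_smul,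
    ← hC] at h2
  rw [← setIntegral_eq_integral_of_forall_compl_eq_zero (s := Ioo a b)
    fun x hx => by rw [hψ.eq_zero hx, zero_smul]]
  simp only [smul_sub]
  rw [integral_sub (hψ.integrable_smul hV)
    (hψ.integrable_smul (integrableOn_const (by simp))), integral_smul_const, hres hψ, h2]

end DuBoisReymond

/-! ### Weak derivatives on a box and absolute continuity on lines -/

section Box

variable {a b c d : ℝ}

/-- The primitive is dominated by ∫ ‖g(s, τ)‖ dτ over the whole interval, a function of s alone.
Writing it as the integral of an indicator of {τ ≤ t} makes it jointly measurable. -/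
theorem integrable_iterated_primitive {g : ℝ × ℝ → ℂ} {μ : Measure ℝ} [IsFiniteMeasure μ]
    (hg : Integrable g (μ.prod (volume.restrict (Ioo a b)))) :
    Integrable (fun z : ℝ × ℝ => ∫ τ in a..z.2, g (z.1, τ))
      (μ.prod (volume.restrict (Ioo a b))) := by
  set ν := volume.restrict (Ioo a b) with hν
  have hmeas : AEStronglyMeasurable (fun w : (ℝ × ℝ) × ℝ =>
      {w : (ℝ × ℝ) × ℝ | w.2 ≤ w.1.2}.indicator (fun w => g (w.1.1, w.2)) w)
      ((μ.prod ν).prod ν) := by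
    refine AEStronglyMeasurable.indicator ?_
      (measurableSet_le measurable_snd measurable_fst.snd)
    exact hg.1.comp_quasiMeasurePreserving
      (QuasiMeasurePreserving.prodMap Measure.quasiMeasurePreserving_fst
        (Measure.QuasiMeasurePreserving.id ν))
  have h1 : Integrable (fun z : ℝ × ℝ => ∫ τ, {w : (ℝ × ℝ) × ℝ | w.2 ≤ w.1.2}.indicator
      (fun w => g (w.1.1, w.2)) (z, τ) ∂ν) (μ.prod ν) := by
    have h2 : Integrable (fun z : ℝ × ℝ => ∫ τ, ‖g (z.1, τ)‖ ∂ν) (μ.prod ν) :=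
      hg.norm.integral_prod_left.comp_fst ν
    refine h2.mono hmeas.integral_prod_right' ?_
    have h3 := hg.norm.prod_right_ae
    have h4 : ∀ᵐ z ∂(μ.prod ν), Integrable (fun τ => ‖g (z.1, τ)‖) ν :=
      Measure.quasiMeasurePreserving_fst.ae h3
    filter_upwards [h4] with z hz
    refine (norm_integral_le_integral_norm _).trans ?_
    rw [Real.norm_of_nonneg (integral_nonneg fun _ => norm_nonneg _)]
    refine integral_mono_of_nonneg (ae_of_all _ fun _ => norm_nonneg _) hz
      (ae_of_all _ fun τ => ?_)
    exact norm_indicator_le_norm_self _ _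
  refine h1.congr ?_
  have h5 : ∀ᵐ z ∂(μ.prod ν), z.2 ∈ Ioo a b :=
    Measure.quasiMeasurePreserving_snd.ae (ae_restrict_mem measurableSet_Ioo)
  filter_upwards [h5] with z hz
  rw [intervalIntegral.integral_of_le hz.1.le]
  have h6 : (fun τ => {w : (ℝ × ℝ) × ℝ | w.2 ≤ w.1.2}.indicator (fun w => g (w.1.1, w.2)) (z, τ))
      = (Iic z.2).indicator (fun τ => g (z.1, τ)) := by
    ext τ; simp [indicator]
  rw [h6, integral_indicator measurableSet_Iic, hν, Measure.restrict_restrict measurableSet_Iic]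
  congr 2
  ext t
  simp only [mem_inter_iff, mem_Iic, mem_Ioo, mem_Ioc]
  constructor
  · rintro ⟨h, h', -⟩; exact ⟨h', h⟩
  · rintro ⟨h, h'⟩; exact ⟨h', h, h'.trans_lt hz.2⟩

theorem Integrable.bump_mul_smul {α β : ℝ → ℝ} {f : ℝ × ℝ → ℂ} {μ : Measure (ℝ × ℝ)}
    (hf : Integrable f μ) (hα : Continuous α) (hα' : HasCompactSupport α) (hβ : Continuous β)
    (hβ' : HasCompactSupport β) :
    Integrable (fun z : ℝ × ℝ => (β z.1 * α z.2) • f z) μ := by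
  obtain ⟨A, hA⟩ := hα'.exists_bound_of_continuous hα
  obtain ⟨B, hB⟩ := hβ'.exists_bound_of_continuous hβ
  refine hf.bdd_smul (φ := fun z : ℝ × ℝ => β z.1 * α z.2) (B * A) ?_ (ae_of_all _ fun z => ?_)
  · exact ((hβ.comp continuous_fst).mul (hα.comp continuous_snd)).aestronglyMeasurable
  · rw [norm_mul]
    exact mul_le_mul (hB _) (hA _) (norm_nonneg _) ((norm_nonneg _).trans (hB 0))

theorem integral_deriv_smul_primitive {α : ℝ → ℝ} (hα : IsBump a b α) {g : ℝ → ℂ}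
    (hg : IntegrableOn g (Ioo a b)) (hab : a ≤ b) :
    ∫ t in Ioo a b, deriv α t • ∫ τ in a..t, g τ = -∫ t in Ioo a b, α t • g t := by
  have hI : IntervalIntegrable g volume a b := by
    rwa [intervalIntegrable_iff_integrableOn_Ioo_of_le hab]
  have hP : PrimitiveOn (Icc a b) (fun t => ∫ τ in a..t, g τ) g := by
    intro x hx y hy
    have h : ∀ {x y}, x ∈ Icc a b → y ∈ Icc a b → IntervalIntegrable g volume x y :=
      fun {x y} hx hy => hI.mono_set (by
        rw [uIcc_of_le hab]; exact ordConnected_Icc.uIcc_subset hx hy)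
    have ha := left_mem_Icc.2 hab
    exact ⟨h hx hy, intervalIntegral.integral_interval_sub_left (h ha hy) (h ha hx)⟩
  have := hP.integral_by_parts hab (hα.primitiveOn.mono (subset_univ _))
    (hα.eq_zero (by simp)) (hα.eq_zero (by simp))
  rw [intervalIntegral.integral_of_le hab, intervalIntegral.integral_of_le hab,
    integral_Ioc_eq_integral_Ioo, integral_Ioc_eq_integral_Ioo] at this
  exact this

/-- A function with an integrable weak derivative in the second variable on a box is, on almost
every line, an indefinite integral of that derivative. -/
theorem ae_exists_eq_add_integral_of_weak_deriv (hab : a < b)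
    {u g : ℝ × ℝ → ℂ}
    (hu : Integrable u ((volume.restrict (Ioo c d)).prod (volume.restrict (Ioo a b))))
    (hg : Integrable g ((volume.restrict (Ioo c d)).prod (volume.restrict (Ioo a b))))
    (h : ∀ α β, IsBump a b α → IsBump c d β →
      ∫ z, (β z.1 * deriv α z.2) • u z
        ∂((volume.restrict (Ioo c d)).prod (volume.restrict (Ioo a b))) =
      -∫ z, (β z.1 * α z.2) • g z
        ∂((volume.restrict (Ioo c d)).prod (volume.restrict (Ioo a b)))) :
    ∀ᵐ s ∂(volume.restrict (Ioo c d)), ∃ C, ∀ᵐ t ∂(volume.restrict (Ioo a b)),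
      u (s, t) = C + ∫ τ in a..t, g (s, τ) := by
  set μ := volume.restrict (Ioo c d) with hμ
  set ν := volume.restrict (Ioo a b) with hν
  -- Subtracting the line-by-line primitive of g reduces the claim to a function v whose weak
  -- derivative in t vanishes.
  set G : ℝ × ℝ → ℂ := fun z => ∫ τ in a..z.2, g (z.1, τ) with hG
  have hGi : Integrable G (μ.prod ν) := integrable_iterated_primitive hg
  set v : ℝ × ℝ → ℂ := fun z => u z - G z with hv
  have hvi : Integrable v (μ.prod ν) := hu.sub hGi
  have hbd : ∀ {α β : ℝ → ℝ} {f : ℝ × ℝ → ℂ}, Integrable f (μ.prod ν) → IsBump a b α →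
      IsBump c d β → Integrable (fun z : ℝ × ℝ => (β z.1 * α z.2) • f z) (μ.prod ν) :=
    fun hf hα hβ => Integrable.bump_mul_smul hf hα.1.continuous hα.2.1 hβ.1.continuous hβ.2.1
  have hbd' : ∀ {α β : ℝ → ℝ} {f : ℝ × ℝ → ℂ}, Integrable f (μ.prod ν) → IsBump a b α →
      IsBump c d β → Integrable (fun z : ℝ × ℝ => (β z.1 * deriv α z.2) • f z) (μ.prod ν) :=
    fun hf hα hβ => Integrable.bump_mul_smul hf (hα.1.continuous_deriv (by simp)) hα.2.1.deriv
      hβ.1.continuous hβ.2.1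
  have hGd : ∀ α β, IsBump a b α → IsBump c d β →
      ∫ z, (β z.1 * deriv α z.2) • G z ∂(μ.prod ν) =
        -∫ z, (β z.1 * α z.2) • g z ∂(μ.prod ν) := by
    intro α β hα hβ
    rw [integral_prod _ (hbd' hGi hα hβ), integral_prod _ (hbd hg hα hβ), ← integral_neg]
    refine integral_congr_ae ?_
    filter_upwards [hg.prod_right_ae] with s hs
    simp only [mul_smul]
    rw [integral_smul, integral_smul, ← smul_neg]
    congr 1
    exact integral_deriv_smul_primitive hα hs hab.le
  have hv0 : ∀ α β, IsBump a b α → IsBump c d β →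
      ∫ z, (β z.1 * deriv α z.2) • v z ∂(μ.prod ν) = 0 := by
    intro α β hα hβ
    simp only [hv, smul_sub]
    rw [integral_sub (hbd' hu hα hβ) (hbd' hGi hα hβ), h α β hα hβ, hGd α β hα hβ, sub_self]
  obtain ⟨η, hη, hη1⟩ := exists_isBump_integral_eq_one hab
  have hβv : ∀ {β}, IsBump c d β → Integrable (fun z : ℝ × ℝ => β z.1 • v z) (μ.prod ν) := by
    intro β hβ
    obtain ⟨B, hB⟩ := hβ.2.1.exists_bound_of_continuous hβ.1.continuous
    exact hvi.bdd_smul B (hβ.1.continuous.comp continuous_fst).aestronglyMeasurable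
      (ae_of_all _ fun z => hB _)
  have hηv : Integrable (fun z : ℝ × ℝ => η z.2 • v z) (μ.prod ν) := by
    obtain ⟨B, hB⟩ := hη.2.1.exists_bound_of_continuous hη.1.continuous
    exact hvi.bdd_smul B (hη.1.continuous.comp continuous_snd).aestronglyMeasurable
      (ae_of_all _ fun z => hB _)
  -- The mean of v against η is the candidate for the constant on the line s.
  set e : ℝ → ℂ := fun s => ∫ t, η t • v (s, t) ∂ν with he
  have hei : Integrable e μ := hηv.integral_prod_left
  -- One rational q at a time: the null set of exceptional s may depend on q.
  have hq : ∀ q : ℚ, (q : ℝ) ∈ Ioo a b →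
      ∀ᵐ s ∂μ, ∫ t in Ioo a (q : ℝ), (v (s, t) - e s) = 0 := by
    intro q hqI
    have hsub : Ioo a (q : ℝ) ⊆ Ioo a b := Ioo_subset_Ioo_right hqI.2.le
    have hind : Integrable (fun z : ℝ × ℝ => (Ioo a (q : ℝ)).indicator (1 : ℝ → ℝ) z.2 • v z)
        (μ.prod ν) := by
      refine hvi.bdd_smul (φ := fun z : ℝ × ℝ => (Ioo a (q : ℝ)).indicator (1 : ℝ → ℝ) z.2) 1 ?_
        (ae_of_all _ fun z => ?_)
      · exact ((measurable_one.indicator measurableSet_Ioo).comp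
          measurable_snd).aestronglyMeasurable
      · rw [indicator]; split_ifs <;> simp
    -- Chosen so that the integral of w over the line s is the integral of v - e over (a, q).
    set w : ℝ × ℝ → ℂ := fun z =>
      ((Ioo a (q : ℝ)).indicator (1 : ℝ → ℝ) z.2) • v z - (q - a) • η z.2 • v z with hw
    have hwi : Integrable w (μ.prod ν) := hind.sub (hηv.smul ((q : ℝ) - a))
    have hindint : ∀ f : ℝ → ℂ, ∫ t, (Ioo a (q : ℝ)).indicator (1 : ℝ → ℝ) t • f t ∂ν =
        ∫ t in Ioo a (q : ℝ), f t := by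
      intro f
      have : (fun t => (Ioo a (q : ℝ)).indicator (1 : ℝ → ℝ) t • f t) =
          (Ioo a (q : ℝ)).indicator f := by
        ext t; by_cases ht : t ∈ Ioo a (q : ℝ) <;> simp [ht]
      rw [this, integral_indicator measurableSet_Ioo, hν,
        Measure.restrict_restrict measurableSet_Ioo, inter_eq_self_of_subset_left hsub]
    have hslice : ∀ᵐ s ∂μ, ∫ t, w (s, t) ∂ν = ∫ t in Ioo a (q : ℝ), (v (s, t) - e s) := by
      filter_upwards [hvi.prod_right_ae, hind.prod_right_ae, hηv.prod_right_ae]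
        with s h1 h2 h3
      simp only [hw]
      rw [integral_sub h2 (h3.fun_smul ((q : ℝ) - a)), hindint, integral_smul,
        integral_sub (h1.mono_measure (Measure.restrict_mono hsub le_rfl))
          (integrable_const _)]
      simp [he, hqI.1.le]
    suffices ∀ᵐ s, s ∈ Ioo c d → ∫ t, w (s, t) ∂ν = 0 by
      filter_upwards [(ae_restrict_iff' measurableSet_Ioo).2 this, hslice] with s h1 h2
      rw [← h2, h1]
    have hwl : Integrable (fun s => ∫ t, w (s, t) ∂ν) μ := hwi.integral_prod_left
    refine isOpen_Ioo.ae_eq_zero_of_integral_contDiff_smul_eq_zero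
      (IntegrableOn.locallyIntegrableOn hwl) fun β hβ1 hβ2 hβ3 => ?_
    have hβ : IsBump c d β := ⟨hβ1, hβ2, hβ3⟩
    rw [← setIntegral_eq_integral_of_forall_compl_eq_zero (s := Ioo c d)
      fun x hx => by rw [hβ.eq_zero hx, zero_smul]]
    have hβw : Integrable (fun z : ℝ × ℝ => β z.1 • w z) (μ.prod ν) := by
      obtain ⟨B, hB⟩ := hβ.2.1.exists_bound_of_continuous hβ.1.continuous
      exact hwi.bdd_smul B (hβ.1.continuous.comp continuous_fst).aestronglyMeasurable
        (ae_of_all _ fun z => hB _)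
    have h1 : ∫ s in Ioo c d, β s • ∫ t, w (s, t) ∂ν = ∫ z, β z.1 • w z ∂(μ.prod ν) := by
      rw [integral_prod _ hβw]
      simp only [integral_smul]; rfl
    rw [h1, integral_prod_symm _ hβw]
    -- Integrating against β in s first leaves a function of t with zero weak derivative. By du
    -- Bois-Reymond it is constant, and the two terms of w then contribute the same multiple (q - a)
    -- of that constant.
    set V : ℝ → ℂ := fun t => ∫ s, β s • v (s, t) ∂μ with hV
    have hVi : Integrable V ν := (hβv hβ).integral_prod_right
    have hVd : ∀ α, IsBump a b α → ∫ t in Ioo a b, deriv α t • V t = 0 := by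
      intro α hα
      rw [← hv0 α β hα hβ, integral_prod_symm _ (hbd' hvi hα hβ)]
      refine integral_congr_ae (ae_of_all _ fun t => ?_)
      simp only [hV, ← integral_smul, smul_smul, mul_comm]
    have hVc := ae_eq_integral_of_integral_deriv_eq_zero hVi hVd hη hη1
    have h2 : ∀ᵐ t ∂ν, ∫ s, β s • w (s, t) ∂μ =
        (Ioo a (q : ℝ)).indicator (1 : ℝ → ℝ) t • V t - ((q : ℝ) - a) • η t • V t := by
      filter_upwards [(hβv hβ).prod_left_ae] with t ht
      have h3 : ∀ s, β s • w (s, t) =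
          ((Ioo a (q : ℝ)).indicator (1 : ℝ → ℝ) t - ((q : ℝ) - a) * η t) • β s • v (s, t) := by
        intro s
        simp only [hw, Complex.real_smul]
        push_cast
        ring
      simp only [h3]
      rw [integral_smul, sub_smul, mul_smul]
    rw [integral_congr_ae h2]
    have hVη : Integrable (fun t => η t • V t) ν := hη.integrable_smul hVi
    rw [integral_sub _ (hVη.fun_smul ((q : ℝ) - a)), hindint, integral_smul,
      setIntegral_congr_ae measurableSet_Ioo (hVc.mono fun t ht hts => ht (hsub hts))]
    · simp [hqI.1.le, hν]
    · refine hVi.bdd_smul (φ := fun t => (Ioo a (q : ℝ)).indicator (1 : ℝ → ℝ) t) 1 ?_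
        (ae_of_all _ fun z => ?_)
      · exact (measurable_one.indicator measurableSet_Ioo).aestronglyMeasurable
      · rw [indicator]; split_ifs <;> simp
  have hq' : ∀ᵐ s ∂μ, ∀ q : ℚ, (q : ℝ) ∈ Ioo a b → ∫ t in Ioo a (q : ℝ), (v (s, t) - e s) = 0 :=
    ae_all_iff.2 fun q => by
      by_cases hqI : (q : ℝ) ∈ Ioo a b
      · filter_upwards [hq q hqI] with s hs _ using hs
      · exact ae_of_all _ fun s h => absurd h hqI
  filter_upwards [hq', hvi.prod_right_ae] with s hs hsi
  refine ⟨e s, (ae_restrict_iff' measurableSet_Ioo).2 ?_⟩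
  filter_upwards [ae_eq_zero_of_forall_rat_integral_eq_zero
    (Integrable.sub hsi (integrable_const (e s))) hs] with t ht htI
  have := ht htI
  simp only [hv, hG, Pi.sub_apply] at this
  linear_combination this

end Box

/-! ### Sobolev functions on the strip through their restrictions to lines -/

section Slices

variable {L : ℝ}

/-- Lebesgue measure on the cross section of the strip. -/
noncomputable def sectionMeasure (L : ℝ) : Measure ℝ := volume.restrict (Icc 0 L)

instance (L : ℝ) : IsFiniteMeasure (sectionMeasure L) := by
  unfold sectionMeasure; infer_instance

theorem stripMeasure_eq_prod (L : ℝ) : stripMeasure L = volume.prod (sectionMeasure L) := by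
  rw [stripMeasure, strip, sectionMeasure, Measure.volume_eq_prod, ← Measure.prod_restrict,
    Measure.restrict_univ]

theorem integral_stripMeasure_eq_of_box {a b c d : ℝ} {f : ℝ × ℝ → ℂ}
    (hcd : Ioo c d ⊆ Icc 0 L) (hf : ∀ z, z ∉ Ioo a b ×ˢ Ioo c d → f z = 0) :
    ∫ z, f z ∂(stripMeasure L) =
      ∫ z, f z ∂((volume.restrict (Ioo a b)).prod (volume.restrict (Ioo c d))) := by
  rw [Measure.prod_restrict, ← Measure.volume_eq_prod, stripMeasure,
    setIntegral_eq_integral_of_forall_compl_eq_zero hf,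
    setIntegral_eq_integral_of_forall_compl_eq_zero]
  intro z hz
  refine hf z fun h => hz ⟨mem_univ _, hcd h.2⟩

theorem integrable_box_of_memLp {a b c d : ℝ} {f : ℝ × ℝ → ℂ} (hcd : Ioo c d ⊆ Icc 0 L)
    (hf : MemLp f 2 (stripMeasure L)) :
    Integrable f ((volume.restrict (Ioo a b)).prod (volume.restrict (Ioo c d))) := by
  have h1 : MemLp f 2 ((volume.restrict (Ioo a b)).prod (volume.restrict (Ioo c d))) := by
    refine hf.mono_measure ?_
    rw [Measure.prod_restrict, ← Measure.volume_eq_prod, stripMeasure]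
    exact Measure.restrict_mono (prod_mono (subset_univ _) hcd) le_rfl
  exact h1.integrable one_le_two

theorem isTestFunction_mul {a b c d : ℝ} {α β : ℝ → ℝ} (hα : IsBump a b α) (hβ : IsBump c d β)
    (hcd : Ioo c d ⊆ Ioo 0 L) : IsTestFunction L (fun z => α z.1 * β z.2) := by
  have hsub : tsupport (fun z : ℝ × ℝ => α z.1 * β z.2) ⊆ tsupport α ×ˢ tsupport β := by
    refine closure_minimal (fun z hz => ?_)
      ((isClosed_tsupport α).prod (isClosed_tsupport β))
    have hz' : α z.1 * β z.2 ≠ 0 := hz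
    exact ⟨subset_tsupport _ (left_ne_zero_of_mul hz'),
      subset_tsupport _ (right_ne_zero_of_mul hz')⟩
  refine ⟨(hα.1.comp contDiff_fst).mul (hβ.1.comp contDiff_snd), ?_, ?_⟩
  · exact (hα.2.1.prod hβ.2.1).of_isClosed_subset (isClosed_tsupport _) hsub
  · exact hsub.trans (prod_mono (subset_univ _) (hβ.2.2.trans hcd))

theorem fderiv_mul_apply {a b c d : ℝ} {α β : ℝ → ℝ} (hα : IsBump a b α) (hβ : IsBump c d β)
    (z e : ℝ × ℝ) : fderiv ℝ (fun z : ℝ × ℝ => α z.1 * β z.2) z e =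
      α z.1 * (deriv β z.2 * e.2) + β z.2 * (deriv α z.1 * e.1) := by
  have h1 : HasFDerivAt (fun z : ℝ × ℝ => α z.1) _ z :=
    ((hα.1.differentiable (by simp)) z.1).hasDerivAt.hasFDerivAt.comp z hasFDerivAt_fst
  have h2 : HasFDerivAt (fun z : ℝ × ℝ => β z.2) _ z :=
    ((hβ.1.differentiable (by simp)) z.2).hasDerivAt.hasFDerivAt.comp z hasFDerivAt_snd
  rw [(h1.fun_mul h2).fderiv]
  simp
  ring

/-- `f` agrees almost everywhere on `I` with an indefinite integral of `g`. -/
def AEPrimitiveOn (I : Set ℝ) (f g : ℝ → ℂ) : Prop :=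
  ∃ F, PrimitiveOn I F g ∧ ∀ᵐ x ∂(volume.restrict I), f x = F x

theorem IsBump.mul_deriv_eq_zero {a b c d : ℝ} {α β : ℝ → ℝ} (hα : IsBump a b α)
    (hβ : IsBump c d β) {z : ℝ × ℝ} (hz : z ∉ Ioo a b ×ˢ Ioo c d) :
    α z.1 * β z.2 = 0 ∧ deriv α z.1 * β z.2 = 0 ∧ α z.1 * deriv β z.2 = 0 := by
  have hα' : z.1 ∉ Ioo a b → α z.1 = 0 ∧ deriv α z.1 = 0 := fun h =>
    ⟨hα.eq_zero h, image_eq_zero_of_notMem_tsupport fun h' =>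
      h (hα.2.2 (closure_minimal (support_deriv_subset) isClosed_closure h'))⟩
  have hβ' : z.2 ∉ Ioo c d → β z.2 = 0 ∧ deriv β z.2 = 0 := fun h =>
    ⟨hβ.eq_zero h, image_eq_zero_of_notMem_tsupport fun h' =>
      h (hβ.2.2 (closure_minimal (support_deriv_subset) isClosed_closure h'))⟩
  by_cases h1 : z.1 ∈ Ioo a b
  · have h2 : z.2 ∉ Ioo c d := fun h2 => hz ⟨h1, h2⟩
    simp [hβ' h2]
  · simp [hα' h1]

theorem aePrimitiveOn_Icc_of_ae_eq {f g : ℝ → ℂ} {a b : ℝ} (hab : a ≤ b) {C : ℂ}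
    (hg : IntegrableOn g (Ioo a b))
    (h : ∀ᵐ t ∂(volume.restrict (Ioo a b)), f t = C + ∫ τ in a..t, g τ) :
    AEPrimitiveOn (Icc a b) f g := by
  have hI : IntervalIntegrable g volume a b := by
    rwa [intervalIntegrable_iff_integrableOn_Ioo_of_le hab]
  refine ⟨fun t => C + ∫ τ in a..t, g τ, fun x hx y hy => ?_, ?_⟩
  · have h : ∀ {x y}, x ∈ Icc a b → y ∈ Icc a b → IntervalIntegrable g volume x y :=
      fun {x y} hx hy => hI.mono_set (by
        rw [uIcc_of_le hab]; exact ordConnected_Icc.uIcc_subset hx hy)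
    have ha := left_mem_Icc.2 hab
    refine ⟨h hx hy, ?_⟩
    rw [add_sub_add_left_eq_sub, intervalIntegral.integral_interval_sub_left (h ha hy) (h ha hx)]
  · rwa [← Measure.restrict_congr_set Ioo_ae_eq_Icc]

/-- The box result applies on (-n, n) × (0, L), with products of bumps as test functions; the
exceptional sets of x for the countably many n are united. -/
theorem ae_aePrimitiveOn_snd {u g : ℝ × ℝ → ℂ} (hL : 0 < L) (hu : MemLp u 2 (stripMeasure L))
    (hg : MemLp g 2 (stripMeasure L)) (h : IsWeakDeriv L (0, 1) u g) :
    ∀ᵐ x, AEPrimitiveOn (Icc 0 L) (fun y => u (x, y)) (fun y => g (x, y)) := by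
  have hsub : Ioo 0 L ⊆ Icc 0 L := Ioo_subset_Icc_self
  have hn : ∀ n : ℕ, ∀ᵐ x, x ∈ Ioo (-(n : ℝ)) n →
      AEPrimitiveOn (Icc 0 L) (fun y => u (x, y)) (fun y => g (x, y)) := by
    intro n
    have h1 := ae_exists_eq_add_integral_of_weak_deriv (c := -n) (d := n) hL
      (integrable_box_of_memLp hsub hu) (integrable_box_of_memLp hsub hg) (fun α β hα hβ => by
        have h2 := h _ (isTestFunction_mul hβ hα le_rfl)
        simp only [fderiv_mul_apply hβ hα, mul_one, mul_zero, add_zero] at h2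
        rw [integral_stripMeasure_eq_of_box hsub, integral_stripMeasure_eq_of_box hsub] at h2
        · exact h2
        · intro z hz; rw [(hβ.mul_deriv_eq_zero hα hz).1, zero_smul]
        · intro z hz; rw [(hβ.mul_deriv_eq_zero hα hz).2.2, zero_smul])
    rw [← ae_restrict_iff' measurableSet_Ioo]
    filter_upwards [h1, (integrable_box_of_memLp (a := -n) (b := n) hsub hg).prod_right_ae]
      with x hx hgx
    obtain ⟨C, hC⟩ := hx
    exact aePrimitiveOn_Icc_of_ae_eq hL.le hgx hC
  filter_upwards [ae_all_iff.2 hn] with x hx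
  obtain ⟨n, hnx⟩ := exists_nat_gt |x|
  exact hx n ⟨by linarith [neg_abs_le x], (le_abs_self x).trans_lt hnx⟩

theorem aePrimitiveOn_univ_of_forall {f g : ℝ → ℂ}
    (hg : ∀ n : ℕ, IntegrableOn g (Ioo (-(n + 1 : ℝ)) (n + 1)))
    (h : ∀ n : ℕ, ∃ C, ∀ᵐ t ∂(volume.restrict (Ioo (-(n + 1 : ℝ)) (n + 1))),
      f t = C + ∫ τ in (-(n + 1 : ℝ))..t, g τ) :
    AEPrimitiveOn univ f g := by
  have hI : ∀ x y, IntervalIntegrable g volume x y := by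
    intro x y
    obtain ⟨n, hn⟩ := exists_nat_gt (max |x| |y|)
    have hx := (le_max_left _ _).trans_lt hn
    have hy := (le_max_right _ _).trans_lt hn
    obtain ⟨hx1, hx2⟩ := abs_lt.1 hx
    obtain ⟨hy1, hy2⟩ := abs_lt.1 hy
    have h0 : IntervalIntegrable g volume (-(n + 1 : ℝ)) (n + 1) := by
      rw [intervalIntegrable_iff_integrableOn_Ioo_of_le (by linarith)]; exact hg n
    refine h0.mono_set ?_
    rw [uIcc_of_le (by linarith : -(n + 1 : ℝ) ≤ n + 1)]
    exact ordConnected_Icc.uIcc_subset ⟨by linarith, by linarith⟩ ⟨by linarith, by linarith⟩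
  -- The base point is moved to 0 so that the constants for different n become comparable. All
  -- intervals contain (-1, 1), which has positive measure, so the constants agree; this is why the
  -- end points are n + 1 and not n.
  have h' : ∀ n : ℕ, ∃ C, ∀ᵐ t ∂(volume.restrict (Ioo (-(n + 1 : ℝ)) (n + 1))),
      f t = C + ∫ τ in (0 : ℝ)..t, g τ := by
    intro n
    obtain ⟨C, hC⟩ := h n
    refine ⟨C + ∫ τ in (-(n + 1 : ℝ))..0, g τ, ?_⟩
    filter_upwards [hC] with t ht
    rw [ht, add_assoc, intervalIntegral.integral_add_adjacent_intervals (hI _ _) (hI _ _)]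
  choose C hC using h'
  have hCn : ∀ n, C n = C 0 := by
    intro n
    have h1 : ∀ᵐ t ∂(volume.restrict (Ioo (-1 : ℝ) 1)), C n = C 0 := by
      have e0 := hC 0
      simp only [Nat.cast_zero, zero_add] at e0
      have en := ae_restrict_of_ae_restrict_of_subset (s := Ioo (-1 : ℝ) 1)
        (Ioo_subset_Ioo (by linarith [n.cast_nonneg (α := ℝ)])
          (by linarith [n.cast_nonneg (α := ℝ)])) (hC n)
      filter_upwards [e0, en] with t h1 h2
      rw [h1] at h2
      exact (add_right_cancel h2).symm
    have : NeZero (volume.restrict (Ioo (-1 : ℝ) 1)) := ⟨by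
      rw [Ne, Measure.restrict_eq_zero, Real.volume_Ioo]; norm_num⟩
    exact h1.exists.choose_spec
  refine ⟨fun t => C 0 + ∫ τ in (0 : ℝ)..t, g τ, fun x _ y _ => ⟨hI x y, ?_⟩, ?_⟩
  · rw [add_sub_add_left_eq_sub, intervalIntegral.integral_interval_sub_left (hI _ _) (hI _ _)]
  · rw [Measure.restrict_univ]
    filter_upwards [ae_all_iff.2 fun n => (ae_restrict_iff' measurableSet_Ioo).1 (hC n)] with t ht
    obtain ⟨n, hn⟩ := exists_nat_gt |t|
    have := ht n ⟨by linarith [neg_abs_le t], by linarith [le_abs_self t]⟩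
    rwa [hCn n] at this

theorem ae_aePrimitiveOn_fst {u g : ℝ × ℝ → ℂ} (hu : MemLp u 2 (stripMeasure L))
    (hg : MemLp g 2 (stripMeasure L)) (h : IsWeakDeriv L (1, 0) u g) :
    ∀ᵐ y ∂(sectionMeasure L), AEPrimitiveOn univ (fun x => u (x, y)) (fun x => g (x, y)) := by
  have hsub : Ioo 0 L ⊆ Icc 0 L := Ioo_subset_Icc_self
  have hn : ∀ n : ℕ, ∀ᵐ y ∂(volume.restrict (Ioo 0 L)),
      IntegrableOn (fun x => g (x, y)) (Ioo (-(n + 1 : ℝ)) (n + 1)) ∧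
      ∃ C, ∀ᵐ t ∂(volume.restrict (Ioo (-(n + 1 : ℝ)) (n + 1))),
      u (t, y) = C + ∫ τ in (-(n + 1 : ℝ))..t, g (τ, y) := by
    intro n
    have hn0 : -(n + 1 : ℝ) < n + 1 := by linarith [n.cast_nonneg (α := ℝ)]
    have hgi := integrable_box_of_memLp (a := -(n + 1 : ℝ)) (b := n + 1) hsub hg
    -- The box result concerns the second variable, hence the exchange of coordinates.
    have h1 := ae_exists_eq_add_integral_of_weak_deriv (u := u ∘ Prod.swap) (g := g ∘ Prod.swap)
      (c := 0) (d := L) hn0 (integrable_box_of_memLp hsub hu).swap hgi.swap (fun α β hα hβ => by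
        have h2 := h _ (isTestFunction_mul hα hβ le_rfl)
        simp only [fderiv_mul_apply hα hβ, mul_one, mul_zero, zero_add] at h2
        rw [integral_stripMeasure_eq_of_box hsub, integral_stripMeasure_eq_of_box hsub] at h2
        · rw [← integral_prod_swap, ← integral_prod_swap
            (μ := volume.restrict (Ioo (-(n + 1 : ℝ)) (n + 1)))] at h2
          simpa only [Prod.fst_swap, Prod.snd_swap, mul_comm, Function.comp_apply] using h2
        · intro z hz; rw [(hα.mul_deriv_eq_zero hβ hz).1, zero_smul]
        · intro z hz; rw [mul_comm, (hα.mul_deriv_eq_zero hβ hz).2.1, zero_smul])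
    filter_upwards [h1, hgi.prod_left_ae] with y hy hgy using ⟨hgy, hy⟩
  rw [sectionMeasure, ← Measure.restrict_congr_set Ioo_ae_eq_Icc]
  filter_upwards [ae_all_iff.2 hn] with y hy
  exact aePrimitiveOn_univ_of_forall (fun n => (hy n).1) fun n => (hy n).2

theorem IsTestFunction.hasDerivAt_fst {φ : ℝ × ℝ → ℝ} (h : IsTestFunction L φ) (x y : ℝ) :
    HasDerivAt (fun x => φ (x, y)) (fderiv ℝ φ (x, y) (1, 0)) x := by
  have h1 := ((h.1.differentiable (by simp)) (x, y)).hasFDerivAt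
  exact h1.comp_hasDerivAt x ((hasDerivAt_id x).prodMk (hasDerivAt_const x y))

theorem IsTestFunction.hasDerivAt_snd {φ : ℝ × ℝ → ℝ} (h : IsTestFunction L φ) (x y : ℝ) :
    HasDerivAt (fun y => φ (x, y)) (fderiv ℝ φ (x, y) (0, 1)) y := by
  have h1 := ((h.1.differentiable (by simp)) (x, y)).hasFDerivAt
  exact h1.comp_hasDerivAt y ((hasDerivAt_const y x).prodMk (hasDerivAt_id y))

theorem IsTestFunction.continuous_fderiv {φ : ℝ × ℝ → ℝ} (h : IsTestFunction L φ) (e : ℝ × ℝ) :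
    Continuous (fun z => fderiv ℝ φ z e) :=
  (h.1.continuous_fderiv (by simp)).clm_apply continuous_const

theorem IsTestFunction.hasCompactSupport_fderiv {φ : ℝ × ℝ → ℝ} (h : IsTestFunction L φ)
    (e : ℝ × ℝ) : HasCompactSupport (fun z => fderiv ℝ φ z e) := h.2.1.fderiv_apply ℝ e

theorem integrable_smul_of_hasCompactSupport {f : ℝ × ℝ → ℝ} (hf : Continuous f)
    (hf' : HasCompactSupport f) {u : ℝ × ℝ → ℂ} (hu : MemLp u 2 (stripMeasure L)) :
    Integrable (fun z => f z • u z) (stripMeasure L) := by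
  have h1 : MemLp f 2 (stripMeasure L) := by
    rw [stripMeasure]
    exact (hf.memLp_of_hasCompactSupport hf').restrict _
  rw [← memLp_one_iff_integrable]
  exact hu.smul h1

/-- Fubini and integration by parts on each line. This converse of `ae_aePrimitiveOn_fst` allows
membership in H¹ of translates, moduli and products to be checked on one line at a time. -/
theorem isWeakDeriv_fst_of_slices {u g : ℝ × ℝ → ℂ} (hu : MemLp u 2 (stripMeasure L))
    (hg : MemLp g 2 (stripMeasure L))
    (h : ∀ᵐ y ∂(sectionMeasure L), AEPrimitiveOn univ (fun x => u (x, y)) (fun x => g (x, y))) :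
    IsWeakDeriv L (1, 0) u g := by
  intro φ hφ
  have h1 := integrable_smul_of_hasCompactSupport (hφ.continuous_fderiv (1, 0))
    (hφ.hasCompactSupport_fderiv (1, 0)) hu
  have h2 := integrable_smul_of_hasCompactSupport hφ.1.continuous hφ.2.1 hg
  rw [stripMeasure_eq_prod] at h1 h2 ⊢
  rw [integral_prod_symm _ h1, integral_prod_symm _ h2, ← integral_neg]
  refine integral_congr_ae ?_
  obtain ⟨R, hR⟩ := hφ.2.1.isBounded.exists_pos_norm_lt
  filter_upwards [h] with y hy
  obtain ⟨F, hF, hFe⟩ := hy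
  rw [Measure.restrict_univ] at hFe
  have hz : ∀ x, x ∉ Ioo (-R) R → φ (x, y) = 0 ∧ fderiv ℝ φ (x, y) (1, 0) = 0 := by
    intro x hx
    have hn : (x, y) ∉ tsupport φ := fun hmem => hx (by
      have h3 := (norm_fst_le (x, y)).trans_lt (hR.2 _ hmem)
      exact abs_lt.1 h3)
    refine ⟨image_eq_zero_of_notMem_tsupport hn, ?_⟩
    have : fderiv ℝ φ (x, y) = 0 := image_eq_zero_of_notMem_tsupport
      (f := fderiv ℝ φ) fun h' => hn (tsupport_fderiv_subset ℝ h')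
    rw [this]; rfl
  have hR0 : -R ≤ R := by linarith [hR.1]
  have hc : PrimitiveOn univ (fun x => φ (x, y)) (fun x => fderiv ℝ φ (x, y) (1, 0)) :=
    PrimitiveOn.of_hasDerivAt (fun x => hφ.hasDerivAt_fst x y)
      ((hφ.continuous_fderiv (1, 0)).comp (by fun_prop))
  have h3 := (hF.mono (subset_univ _)).integral_by_parts hR0 (hc.mono (subset_univ _))
    (hz _ (by simp)).1 (hz _ (by simp)).1
  have e1 : ∫ x, fderiv ℝ φ (x, y) (1, 0) • u (x, y) =
      ∫ x in (-R)..R, fderiv ℝ φ (x, y) (1, 0) • F x := by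
    rw [intervalIntegral.integral_of_le hR0, setIntegral_eq_integral_of_forall_compl_eq_zero]
    · exact integral_congr_ae (hFe.mono fun x hx => by simp only [hx])
    · intro x hx
      rw [(hz x fun h' => hx (Ioo_subset_Ioc_self h')).2, zero_smul]
  have e2 : ∫ x, φ (x, y) • g (x, y) = ∫ x in (-R)..R, φ (x, y) • g (x, y) := by
    rw [intervalIntegral.integral_of_le hR0, setIntegral_eq_integral_of_forall_compl_eq_zero]
    intro x hx
    rw [(hz x fun h' => hx (Ioo_subset_Ioc_self h')).1, zero_smul]
  rw [e1, e2, h3]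

theorem isWeakDeriv_snd_of_slices {u g : ℝ × ℝ → ℂ} (hL : 0 < L)
    (hu : MemLp u 2 (stripMeasure L)) (hg : MemLp g 2 (stripMeasure L))
    (h : ∀ᵐ x, AEPrimitiveOn (Icc 0 L) (fun y => u (x, y)) (fun y => g (x, y))) :
    IsWeakDeriv L (0, 1) u g := by
  intro φ hφ
  have h1 := integrable_smul_of_hasCompactSupport (hφ.continuous_fderiv (0, 1))
    (hφ.hasCompactSupport_fderiv (0, 1)) hu
  have h2 := integrable_smul_of_hasCompactSupport hφ.1.continuous hφ.2.1 hg
  rw [stripMeasure_eq_prod] at h1 h2 ⊢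
  rw [integral_prod _ h1, integral_prod _ h2, ← integral_neg]
  refine integral_congr_ae ?_
  filter_upwards [h] with x hx
  obtain ⟨F, hF, hFe⟩ := hx
  have hz : ∀ y, y ∉ Ioo 0 L → φ (x, y) = 0 := fun y hy =>
    image_eq_zero_of_notMem_tsupport fun h' => hy (hφ.2.2 h').2
  have hc : PrimitiveOn univ (fun y => φ (x, y)) (fun y => fderiv ℝ φ (x, y) (0, 1)) :=
    PrimitiveOn.of_hasDerivAt (fun y => hφ.hasDerivAt_snd x y)
      ((hφ.continuous_fderiv (0, 1)).comp (by fun_prop))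
  have h3 := hF.integral_by_parts hL.le (hc.mono (subset_univ _))
    (hz _ (by simp)) (hz _ (by simp))
  rw [intervalIntegral.integral_of_le hL.le, intervalIntegral.integral_of_le hL.le,
    ← integral_Icc_eq_integral_Ioc, ← integral_Icc_eq_integral_Ioc] at h3
  rw [sectionMeasure]
  refine Eq.trans (integral_congr_ae ?_) h3
  exact hFe.mono fun y hy => by simp only [hy]

end Slices

/-! ### Linear combinations and translates in H¹ -/

section Operations

variable {L : ℝ}

theorem IsWeakDeriv.add_smul {e : ℝ × ℝ} {u g v h : ℝ × ℝ → ℂ}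
    (hu : MemLp u 2 (stripMeasure L)) (hg : MemLp g 2 (stripMeasure L))
    (hv : MemLp v 2 (stripMeasure L)) (hh : MemLp h 2 (stripMeasure L))
    (h1 : IsWeakDeriv L e u g) (h2 : IsWeakDeriv L e v h) (t : ℝ) :
    IsWeakDeriv L e (fun z => u z + t • v z) (fun z => g z + t • h z) := by
  intro φ hφ
  have i1 := integrable_smul_of_hasCompactSupport (hφ.continuous_fderiv e)
    (hφ.hasCompactSupport_fderiv e) hu
  have i2 := integrable_smul_of_hasCompactSupport (hφ.continuous_fderiv e)
    (hφ.hasCompactSupport_fderiv e) hv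
  have i3 := integrable_smul_of_hasCompactSupport hφ.1.continuous hφ.2.1 hg
  have i4 := integrable_smul_of_hasCompactSupport hφ.1.continuous hφ.2.1 hh
  simp only [smul_add, smul_comm _ t]
  rw [integral_add i1 (i2.fun_smul t), integral_add i3 (i4.fun_smul t), integral_smul,
    integral_smul, h1 φ hφ, h2 φ hφ]
  module

/-- The function `u + t v`. -/
noncomputable def H1.addSMul (u : H1 L) (t : ℝ) (v : H1 L) : H1 L where
  toFun z := u z + t • v z
  dx z := u.dx z + t • v.dx z
  dy z := u.dy z + t • v.dy z
  memLp_toFun := u.memLp_toFun.add (v.memLp_toFun.const_smul t)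
  memLp_dx := u.memLp_dx.add (v.memLp_dx.const_smul t)
  memLp_dy := u.memLp_dy.add (v.memLp_dy.const_smul t)
  isWeakDeriv_dx := u.isWeakDeriv_dx.add_smul u.memLp_toFun u.memLp_dx v.memLp_toFun v.memLp_dx
    v.isWeakDeriv_dx t
  isWeakDeriv_dy := u.isWeakDeriv_dy.add_smul u.memLp_toFun u.memLp_dy v.memLp_toFun v.memLp_dy
    v.isWeakDeriv_dy t

/-- The zero function. -/
noncomputable def H1.zero (L : ℝ) : H1 L where
  toFun _ := 0
  dx _ := 0
  dy _ := 0
  memLp_toFun := MemLp.zero'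
  memLp_dx := MemLp.zero'
  memLp_dy := MemLp.zero'
  isWeakDeriv_dx := fun φ _ => by simp
  isWeakDeriv_dy := fun φ _ => by simp

theorem H1.slice_fst (u : H1 L) :
    ∀ᵐ y ∂(sectionMeasure L), AEPrimitiveOn univ (fun x => u (x, y)) (fun x => u.dx (x, y)) :=
  ae_aePrimitiveOn_fst u.memLp_toFun u.memLp_dx u.isWeakDeriv_dx

theorem H1.slice_snd (u : H1 L) (hL : 0 < L) :
    ∀ᵐ x, AEPrimitiveOn (Icc 0 L) (fun y => u (x, y)) (fun y => u.dy (x, y)) :=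
  ae_aePrimitiveOn_snd hL u.memLp_toFun u.memLp_dy u.isWeakDeriv_dy

theorem PrimitiveOn.comp_add_right {F g : ℝ → ℂ} (h : PrimitiveOn univ F g) (a : ℝ) :
    PrimitiveOn univ (fun x => F (x + a)) (fun x => g (x + a)) := fun x _ y _ => by
  refine ⟨?_, ?_⟩
  · have := (h (x + a) (mem_univ _) (y + a) (mem_univ _)).1.comp_add_right a
    simpa using this
  · rw [intervalIntegral.integral_comp_add_right, (h _ (mem_univ _) _ (mem_univ _)).2]

theorem AEPrimitiveOn.comp_add_right {f g : ℝ → ℂ} (h : AEPrimitiveOn univ f g) (a : ℝ) :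
    AEPrimitiveOn univ (fun x => f (x + a)) (fun x => g (x + a)) := by
  obtain ⟨F, hF, hFe⟩ := h
  refine ⟨_, hF.comp_add_right a, ?_⟩
  rw [Measure.restrict_univ] at hFe ⊢
  exact (measurePreserving_add_right volume a).quasiMeasurePreserving.ae hFe

theorem measurePreserving_translate (L a : ℝ) :
    MeasurePreserving (fun z : ℝ × ℝ => (z.1 + a, z.2)) (stripMeasure L) (stripMeasure L) := by
  rw [stripMeasure_eq_prod]
  exact (measurePreserving_add_right volume a).prod (MeasurePreserving.id _)

/-- The translate of `u` by `a` in the direction `x`. -/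
noncomputable def H1.translate (u : H1 L) (hL : 0 < L) (a : ℝ) : H1 L where
  toFun z := u (z.1 + a, z.2)
  dx z := u.dx (z.1 + a, z.2)
  dy z := u.dy (z.1 + a, z.2)
  memLp_toFun := u.memLp_toFun.comp_measurePreserving (measurePreserving_translate L a)
  memLp_dx := u.memLp_dx.comp_measurePreserving (measurePreserving_translate L a)
  memLp_dy := u.memLp_dy.comp_measurePreserving (measurePreserving_translate L a)
  isWeakDeriv_dx := isWeakDeriv_fst_of_slices
    (u.memLp_toFun.comp_measurePreserving (measurePreserving_translate L a))
    (u.memLp_dx.comp_measurePreserving (measurePreserving_translate L a))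
    (u.slice_fst.mono fun _ hy => hy.comp_add_right a)
  isWeakDeriv_dy := isWeakDeriv_snd_of_slices hL
    (u.memLp_toFun.comp_measurePreserving (measurePreserving_translate L a))
    (u.memLp_dy.comp_measurePreserving (measurePreserving_translate L a))
    ((measurePreserving_add_right volume a).quasiMeasurePreserving.ae (u.slice_snd hL))

end Operations

/-! ### The trace as the value of the absolutely continuous representative -/

section Trace

variable {L : ℝ}

theorem trace_congr {u v : ℝ × ℝ → ℂ} {y : ℝ} (h : ∀ᵐ x, u (x, y) = v (x, y)) :
    trace u y = trace v y := by
  have : (fun r : ℝ => (2 * r)⁻¹ • ∫ x in (-r)..r, u (x, y)) =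
      fun r : ℝ => (2 * r)⁻¹ • ∫ x in (-r)..r, v (x, y) := by
    ext1 r
    rw [intervalIntegral.integral_congr_ae (h.mono fun x hx _ => hx)]
  unfold trace
  rw [this]

theorem tendsto_integral_div {F : ℝ → ℂ} (hF : Continuous F) :
    Tendsto (fun r : ℝ => (2 * r)⁻¹ • ∫ x in (-r)..r, F x) (𝓝[>] 0) (𝓝 (F 0)) := by
  have hd : ∀ x, HasDerivAt (fun r => ∫ x in (0 : ℝ)..r, F x) (F x) x := fun x =>
    intervalIntegral.integral_hasDerivAt_right (hF.intervalIntegrable 0 x)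
      (hF.stronglyMeasurableAtFilter _ _) hF.continuousAt
  have h2 : HasDerivAt (fun r => ∫ x in (0 : ℝ)..(-r), F x) (-F 0) 0 := by
    have h1 : HasDerivAt (fun r => ∫ x in (0 : ℝ)..r, F x) (F 0) (-0) := by simpa using hd 0
    simpa [Function.comp_def] using h1.scomp (0 : ℝ) (hasDerivAt_neg (0 : ℝ))
  have h3 := (((hd 0).sub h2).tendsto_slope_zero_right).const_smul (2⁻¹ : ℝ)
  have e : (2⁻¹ : ℝ) • (F 0 - -F 0) = F 0 := by
    rw [sub_neg_eq_add, ← two_smul ℝ, smul_smul]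
    norm_num
  rw [e] at h3
  refine h3.congr fun r => ?_
  rw [smul_smul, mul_inv]
  congr 1
  simp only [Pi.sub_apply, zero_add, neg_zero, intervalIntegral.integral_same, sub_zero]
  rw [intervalIntegral.integral_interval_sub_left (hF.intervalIntegrable _ _)
    (hF.intervalIntegrable _ _)]

theorem trace_eq_of_primitiveOn {u : ℝ × ℝ → ℂ} {F g : ℝ → ℂ} {y : ℝ} (hF : PrimitiveOn univ F g)
    (h : ∀ᵐ x ∂(volume.restrict univ), u (x, y) = F x) : trace u y = F 0 := by
  rw [Measure.restrict_univ] at h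
  rw [trace_congr (v := fun z => F z.1) h, trace_of_continuous _ _ hF.continuous]

theorem tendsto_trace {u : ℝ × ℝ → ℂ} {g : ℝ → ℂ} {y : ℝ}
    (h : AEPrimitiveOn univ (fun x => u (x, y)) g) :
    Tendsto (fun r : ℝ => (2 * r)⁻¹ • ∫ x in (-r)..r, u (x, y)) (𝓝[>] 0) (𝓝 (trace u y)) := by
  obtain ⟨F, hF, hFe⟩ := h
  rw [trace_eq_of_primitiveOn hF hFe]
  rw [Measure.restrict_univ] at hFe
  refine (tendsto_integral_div hF.continuous).congr fun r => ?_
  rw [intervalIntegral.integral_congr_ae (hFe.mono fun x hx _ => hx)]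

theorem trace_translate_eq_of_primitiveOn {u : H1 L} (hL : 0 < L) {F g : ℝ → ℂ} {y : ℝ}
    (hF : PrimitiveOn univ F g)
    (h : ∀ᵐ x ∂(volume.restrict univ), u (x, y) = F x) (a : ℝ) :
    trace (u.translate hL a) y = F a := by
  have h' : ∀ᵐ x ∂(volume.restrict univ), (u.translate hL a) (x, y) = F (x + a) := by
    rw [Measure.restrict_univ] at h ⊢
    exact (measurePreserving_add_right volume a).quasiMeasurePreserving.ae h
  rw [trace_eq_of_primitiveOn (hF.comp_add_right a) h', zero_add]

theorem H1.trace_addSMul (u v : H1 L) (t : ℝ) : ∀ᵐ y ∂(sectionMeasure L),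
    trace (u.addSMul t v) y = trace u y + t • trace v y := by
  filter_upwards [u.slice_fst, v.slice_fst] with y hu hv
  obtain ⟨F, hF, hFe⟩ := hu
  obtain ⟨G, hG, hGe⟩ := hv
  rw [trace_eq_of_primitiveOn hF hFe, trace_eq_of_primitiveOn hG hGe]
  refine trace_eq_of_primitiveOn (hF.add (hG.const_smul t)) ?_
  filter_upwards [hFe, hGe] with x h1 h2
  simp only [H1.addSMul, h1, h2]

theorem H1.trace_zero (y : ℝ) : trace (H1.zero L) y = 0 :=
  trace_of_continuous _ _ continuous_const

/-- The traces on all the lines parallel to the `y`-axis form a measurable function. -/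
theorem H1.aestronglyMeasurable_trace_translate (u : H1 L) (hL : 0 < L) :
    AEStronglyMeasurable (fun z : ℝ × ℝ => trace (u.translate hL z.1) z.2)
      (volume.prod (sectionMeasure L)) := by
  have hr : Tendsto (fun n : ℕ => (1 / ((n : ℝ) + 1))) atTop (𝓝[>] 0) :=
    tendsto_nhdsWithin_iff.2 ⟨tendsto_one_div_add_atTop_nhds_zero_nat,
      Eventually.of_forall fun n => by simp only [mem_Ioi]; positivity⟩
  -- The traces are almost everywhere limits of means over (-r, r), and each mean is measurable in
  -- both variables by Fubini.
  refine aestronglyMeasurable_of_tendsto_ae atTop (f := fun (n : ℕ) (z : ℝ × ℝ) =>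
    (2 * (1 / ((n : ℝ) + 1)))⁻¹ • ∫ x in (-(1 / ((n : ℝ) + 1)))..(1 / ((n : ℝ) + 1)),
      (u.translate hL z.1) (x, z.2)) (fun n => ?_) ?_
  · refine AEStronglyMeasurable.fun_const_smul ?_ (2 * (1 / ((n : ℝ) + 1)))⁻¹
    set r := 1 / ((n : ℝ) + 1) with hr
    have hr0 : 0 < r := by positivity
    simp only [intervalIntegral.integral_of_le (show -r ≤ r by linarith)]
    -- For each fixed value of the last variable this map is a translation of the strip, so
    -- preimages of null sets are null.
    have hq : Measure.QuasiMeasurePreserving (fun w : (ℝ × ℝ) × ℝ => (w.2 + w.1.1, w.1.2))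
        ((volume.prod (sectionMeasure L)).prod (volume.restrict (Ioc (-r) r)))
        (volume.prod (sectionMeasure L)) := by
      refine QuasiMeasurePreserving.prod_of_left (by fun_prop) (ae_of_all _ fun t => ?_)
      have := (measurePreserving_translate L t).quasiMeasurePreserving
      rw [stripMeasure_eq_prod] at this
      simpa only [add_comm t] using this
    have h1 := u.memLp_toFun.1
    rw [stripMeasure_eq_prod] at h1
    exact (h1.comp_quasiMeasurePreserving hq).integral_prod_right'
  · have h2 : ∀ᵐ z : ℝ × ℝ ∂((volume : Measure ℝ).prod (sectionMeasure L)),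
        AEPrimitiveOn univ (fun x => u (x, z.2)) (fun x => u.dx (x, z.2)) :=
      Measure.quasiMeasurePreserving_snd.ae u.slice_fst
    filter_upwards [h2] with z hz
    exact (tendsto_trace (u := u.translate hL z.1) (hz.comp_add_right z.1)).comp hr

theorem H1.aestronglyMeasurable_trace (u : H1 L) :
    AEStronglyMeasurable (fun y => trace u y) (sectionMeasure L) := by
  have hr : Tendsto (fun n : ℕ => (1 / ((n : ℝ) + 1))) atTop (𝓝[>] 0) :=
    tendsto_nhdsWithin_iff.2 ⟨tendsto_one_div_add_atTop_nhds_zero_nat,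
      Eventually.of_forall fun n => by simp only [mem_Ioi]; positivity⟩
  refine aestronglyMeasurable_of_tendsto_ae atTop (f := fun (n : ℕ) (y : ℝ) =>
    (2 * (1 / ((n : ℝ) + 1)))⁻¹ • ∫ x in (-(1 / ((n : ℝ) + 1)))..(1 / ((n : ℝ) + 1)),
      u (x, y)) (fun n => ?_) ?_
  · refine AEStronglyMeasurable.fun_const_smul ?_ (2 * (1 / ((n : ℝ) + 1)))⁻¹
    set r := 1 / ((n : ℝ) + 1) with hr
    have hr0 : 0 < r := by positivity
    simp only [intervalIntegral.integral_of_le (show -r ≤ r by linarith)]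
    have h1 := u.memLp_toFun.1
    rw [stripMeasure_eq_prod] at h1
    have h2 : AEStronglyMeasurable u ((volume.restrict (Ioc (-r) r)).prod (sectionMeasure L)) := by
      refine h1.mono_ac (Measure.AbsolutelyContinuous.prod ?_ Measure.AbsolutelyContinuous.rfl)
      exact Measure.restrict_le_self.absolutelyContinuous
    exact h2.prod_swap.integral_prod_right'
  · filter_upwards [u.slice_fst] with y hy
    exact (tendsto_trace hy).comp hr

theorem ae_prod_eq_of_ae_ae_eq {μ ν : Measure ℝ} [SFinite μ] [SFinite ν] {f g : ℝ × ℝ → ℂ}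
    (hf : AEStronglyMeasurable f (μ.prod ν)) (hg : AEStronglyMeasurable g (μ.prod ν))
    (h : ∀ᵐ y ∂ν, ∀ᵐ x ∂μ, f (x, y) = g (x, y)) : f =ᵐ[μ.prod ν] g := by
  have hm : AEMeasurable (fun z => ‖f z - g z‖ₑ) (μ.prod ν) := (hf.sub hg).enorm
  have h1 : ∫⁻ z, ‖f z - g z‖ₑ ∂(μ.prod ν) = 0 := by
    rw [lintegral_prod_symm _ hm, lintegral_eq_zero_iff' ?_]
    · filter_upwards [h] with y hy
      simp only [Pi.zero_apply]
      rw [lintegral_congr_ae (hy.mono fun x hx => by rw [hx, sub_self, enorm_zero]),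
        lintegral_zero]
    · exact hm.prod_swap.lintegral_prod_right'
  rw [lintegral_eq_zero_iff' hm] at h1
  filter_upwards [h1] with z hz
  exact sub_eq_zero.1 (enorm_eq_zero.1 hz)

/-- On almost every line y = const both sides equal the absolutely continuous representative for
almost every x; joint measurability and Fubini exchange the quantifiers. Bounds for the traces of
all translates thus become bounds for almost all cross sections. -/
theorem H1.ae_eq_trace_translate (u : H1 L) (hL : 0 < L) :
    ∀ᵐ x, ∀ᵐ y ∂(sectionMeasure L), u (x, y) = trace (u.translate hL x) y := by
  refine Measure.ae_ae_of_ae_prod (p := fun z : ℝ × ℝ => u z = trace (u.translate hL z.1) z.2) ?_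
  refine ae_prod_eq_of_ae_ae_eq ?_ (u.aestronglyMeasurable_trace_translate hL) ?_
  · rw [← stripMeasure_eq_prod]; exact u.memLp_toFun.1
  · filter_upwards [u.slice_fst] with y hy
    obtain ⟨F, hF, hFe⟩ := hy
    have hFe' := hFe
    rw [Measure.restrict_univ] at hFe
    filter_upwards [hFe] with x hx
    rw [trace_translate_eq_of_primitiveOn hL hF hFe', hx]

end Trace

/-! ### Trace inequality, spectral bound and Ladyzhenskaya's inequality -/

section Inequalities

variable {L : ℝ}

theorem integrable_norm_sq {μ : Measure (ℝ × ℝ)} {f : ℝ × ℝ → ℂ} (hf : MemLp f 2 μ) :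
    Integrable (fun z => ‖f z‖ ^ 2) μ := by
  simpa using hf.integrable_norm_pow two_ne_zero

theorem integrable_norm_mul_norm {μ : Measure (ℝ × ℝ)} {f g : ℝ × ℝ → ℂ} (hf : MemLp f 2 μ)
    (hg : MemLp g 2 μ) : Integrable (fun z => ‖f z‖ * ‖g z‖) μ :=
  hf.norm.integrable_mul hg.norm

/-- The squared `L²` norm of the gradient. -/
noncomputable def H1.gradSq (u : H1 L) : ℝ :=
  ∫ z, (‖u.dx z‖ ^ 2 + ‖u.dy z‖ ^ 2) ∂(stripMeasure L)

/-- The squared `L²` norm of the trace. -/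
noncomputable def H1.traceSq (u : H1 L) : ℝ := ∫ y in Icc 0 L, ‖trace u y‖ ^ 2

/-- The part of the strip with `|x| ≤ l`, as a set. -/
def window (l : ℝ) : Set (ℝ × ℝ) := Ioc (-l) l ×ˢ univ

theorem measurableSet_window (l : ℝ) : MeasurableSet (window l) :=
  measurableSet_Ioc.prod MeasurableSet.univ

theorem restrict_window (L l : ℝ) : (stripMeasure L).restrict (window l) =
    (volume.restrict (Ioc (-l) l)).prod (sectionMeasure L) := by
  rw [stripMeasure_eq_prod, window, ← Measure.prod_restrict, Measure.restrict_univ]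

theorem H1.traceSq_nonneg (u : H1 L) : 0 ≤ u.traceSq := integral_nonneg fun _ => by positivity

theorem H1.gradSq_nonneg (u : H1 L) : 0 ≤ u.gradSq := integral_nonneg fun _ => by positivity

theorem mass_nonneg (u : H1 L) : 0 ≤ mass u := integral_nonneg fun _ => by positivity

/-- The midpoint estimate integrated over y. The bound sees u only for |x| ≤ l, which later gives
compactness of the trace from local compactness in L². -/
theorem H1.traceSq_window (u : H1 L) {l : ℝ} (hl : 0 < l) :
    Integrable (fun y => ‖trace u y‖ ^ 2) (sectionMeasure L) ∧
    2 * l * u.traceSq ≤ (∫ z in window l, ‖u z‖ ^ 2 ∂(stripMeasure L)) +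
      2 * l * ∫ z in window l, ‖u z‖ * ‖u.dx z‖ ∂(stripMeasure L) := by
  have i1 : Integrable (fun z => ‖u z‖ ^ 2) ((stripMeasure L).restrict (window l)) :=
    (integrable_norm_sq u.memLp_toFun).integrableOn
  have i2 : Integrable (fun z => ‖u z‖ * ‖u.dx z‖) ((stripMeasure L).restrict (window l)) :=
    (integrable_norm_mul_norm u.memLp_toFun u.memLp_dx).integrableOn
  rw [restrict_window] at i1 i2 ⊢
  rw [integral_prod_symm _ i1, integral_prod_symm _ i2, ← integral_const_mul,
    ← integral_add i1.integral_prod_right (i2.integral_prod_right.const_mul _)]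
  have hB := i1.integral_prod_right.add (i2.integral_prod_right.const_mul (2 * l))
  have hle : ∀ᵐ y ∂(sectionMeasure L), 2 * l * ‖trace u y‖ ^ 2 ≤
      (∫ x in Ioc (-l) l, ‖u (x, y)‖ ^ 2) +
        2 * l * ∫ x in Ioc (-l) l, ‖u (x, y)‖ * ‖u.dx (x, y)‖ := by
    filter_upwards [u.slice_fst] with y hy
    obtain ⟨F, hF, hFe⟩ := hy
    rw [trace_eq_of_primitiveOn hF hFe]
    rw [Measure.restrict_univ] at hFe
    have h1 := hF.norm_sq_zero_le hl
    rw [intervalIntegral.integral_of_le (by linarith),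
      intervalIntegral.integral_of_le (by linarith)] at h1
    have e1 : ∫ x in Ioc (-l) l, ‖u (x, y)‖ ^ 2 = ∫ x in Ioc (-l) l, ‖F x‖ ^ 2 :=
      integral_congr_ae (ae_restrict_of_ae (hFe.mono fun x hx => by simp only [hx]))
    have e2 : ∫ x in Ioc (-l) l, ‖u (x, y)‖ * ‖u.dx (x, y)‖ =
        ∫ x in Ioc (-l) l, ‖F x‖ * ‖u.dx (x, y)‖ :=
      integral_congr_ae (ae_restrict_of_ae (hFe.mono fun x hx => by simp only [hx]))
    rwa [e1, e2]
  have hi : Integrable (fun y => 2 * l * ‖trace u y‖ ^ 2) (sectionMeasure L) :=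
    hB.mono' ((u.aestronglyMeasurable_trace.norm.pow 2).const_mul _) (by
      filter_upwards [hle] with y hy
      rwa [Real.norm_of_nonneg (by positivity)])
  constructor
  · refine (hi.const_mul (2 * l)⁻¹).congr (ae_of_all _ fun y => ?_)
    simp only
    field_simp
  · rw [H1.traceSq, ← integral_const_mul]
    exact integral_mono_ae hi hB hle

theorem H1.memLp_trace (u : H1 L) : MemLp (fun y => trace u y) 2 (sectionMeasure L) := by
  rw [memLp_two_iff_integrable_sq_norm u.aestronglyMeasurable_trace]
  exact (u.traceSq_window one_pos).1

/-- Let the window grow: the term mass/(2l) disappears. The constant 1 is attained by exp(-k|x|). -/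
theorem H1.traceSq_le (u : H1 L) : u.traceSq ≤ ∫ z, ‖u z‖ * ‖u.dx z‖ ∂(stripMeasure L) := by
  refine le_of_forall_pos_le_add fun ε hε => ?_
  have hM := mass_nonneg u
  set l := (mass u + 1) / (2 * ε) with hl
  have hl0 : 0 < l := by positivity
  have h1 := (u.traceSq_window hl0).2
  have h2 : ∫ z in window l, ‖u z‖ ^ 2 ∂(stripMeasure L) ≤ mass u :=
    setIntegral_le_integral (integrable_norm_sq u.memLp_toFun) (ae_of_all _ fun z => by positivity)
  have h3 : ∫ z in window l, ‖u z‖ * ‖u.dx z‖ ∂(stripMeasure L) ≤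
      ∫ z, ‖u z‖ * ‖u.dx z‖ ∂(stripMeasure L) :=
    setIntegral_le_integral (integrable_norm_mul_norm u.memLp_toFun u.memLp_dx)
      (ae_of_all _ fun z => by positivity)
  have h4 : mass u ≤ 2 * l * ε := by
    rw [hl]; field_simp; linarith
  have h5 : 2 * l * u.traceSq ≤
      2 * l * (∫ z, ‖u z‖ * ‖u.dx z‖ ∂(stripMeasure L) + ε) := by
    nlinarith [mul_le_mul_of_nonneg_left h3 hl0.le]
  exact le_of_mul_le_mul_left h5 (by positivity)

theorem integral_translate (L a : ℝ) (f : ℝ × ℝ → ℝ) :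
    ∫ z, f (z.1 + a, z.2) ∂(stripMeasure L) = ∫ z, f z ∂(stripMeasure L) :=
  (measurePreserving_translate L a).integral_comp
    ((MeasurableEquiv.addRight a).prodCongr (MeasurableEquiv.refl ℝ)).measurableEmbedding f

theorem H1.traceSq_translate_le (u : H1 L) (hL : 0 < L) (a : ℝ) :
    (u.translate hL a).traceSq ≤ ∫ z, ‖u z‖ * ‖u.dx z‖ ∂(stripMeasure L) := by
  refine (u.translate hL a).traceSq_le.trans_eq ?_
  exact integral_translate L a (fun z => ‖u z‖ * ‖u.dx z‖)

theorem H1.integral_dx_sq_le (u : H1 L) :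
    ∫ z, ‖u.dx z‖ ^ 2 ∂(stripMeasure L) ≤ u.gradSq :=
  integral_mono (integrable_norm_sq u.memLp_dx)
    ((integrable_norm_sq u.memLp_dx).add (integrable_norm_sq u.memLp_dy))
    fun z => le_add_of_nonneg_right (by positivity)

theorem H1.integral_dy_sq_le (u : H1 L) :
    ∫ z, ‖u.dy z‖ ^ 2 ∂(stripMeasure L) ≤ u.gradSq :=
  integral_mono (integrable_norm_sq u.memLp_dy)
    ((integrable_norm_sq u.memLp_dx).add (integrable_norm_sq u.memLp_dy))
    fun z => le_add_of_nonneg_left (by positivity)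

theorem two_mul_integral_norm_mul_le {f g : ℝ × ℝ → ℂ} {μ : Measure (ℝ × ℝ)} (hf : MemLp f 2 μ)
    (hg : MemLp g 2 μ) {c : ℝ} (hc : 0 < c) :
    2 * ∫ z, ‖f z‖ * ‖g z‖ ∂μ ≤ c * (∫ z, ‖f z‖ ^ 2 ∂μ) + c⁻¹ * ∫ z, ‖g z‖ ^ 2 ∂μ := by
  rw [← integral_const_mul, ← integral_const_mul, ← integral_const_mul, ← integral_add
    ((integrable_norm_sq hf).const_mul _) ((integrable_norm_sq hg).const_mul _)]
  refine integral_mono ((integrable_norm_mul_norm hf hg).const_mul _)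
    (((integrable_norm_sq hf).const_mul _).add ((integrable_norm_sq hg).const_mul _)) fun z => ?_
  have : 0 ≤ c⁻¹ * (c * ‖f z‖ - ‖g z‖) ^ 2 := by positivity
  have e : c⁻¹ * (c * ‖f z‖ - ‖g z‖) ^ 2 =
      c * ‖f z‖ ^ 2 + c⁻¹ * ‖g z‖ ^ 2 - 2 * (‖f z‖ * ‖g z‖) := by field_simp; ring
  simp only
  linarith

/-- The bottom of the spectrum of `-∂ₓₓ + γ δ₀` on the strip is at least `-γ² / 4`. -/
theorem H1.neg_mass_le (u : H1 L) {γ : ℝ} (hγ : γ < 0) :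
    -(γ ^ 2 / 8) * mass u ≤ 1 / 2 * u.gradSq + γ / 2 * u.traceSq := by
  have h1 := u.traceSq_le
  -- After multiplication by -γ/4 this weight gives the gradient the factor exactly 1/2 and the mass
  -- the factor γ²/8.
  have h2 := two_mul_integral_norm_mul_le u.memLp_toFun u.memLp_dx (c := -γ / 2) (by linarith)
  have h3 := u.integral_dx_sq_le
  have e : (-γ / 2)⁻¹ * (-γ / 2) = 1 := inv_mul_cancel₀ (by linarith)
  have h4 := mul_le_mul_of_nonneg_left h2 (by linarith : 0 ≤ -γ / 4)
  have e2 : -γ / 4 * ((-γ / 2)⁻¹ * ∫ z, ‖u.dx z‖ ^ 2 ∂(stripMeasure L)) =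
      1 / 2 * ∫ z, ‖u.dx z‖ ^ 2 ∂(stripMeasure L) := by
    linear_combination (1 / 2 * ∫ z, ‖u.dx z‖ ^ 2 ∂(stripMeasure L)) * e
  rw [mul_add, e2] at h4
  have h5 := mul_le_mul_of_nonneg_left h1 (by linarith : 0 ≤ -γ / 2)
  have e3 : mass u = ∫ z, ‖u z‖ ^ 2 ∂(stripMeasure L) := rfl
  rw [e3]
  nlinarith

/-- Ladyzhenskaya's inequality on the strip, in terms of a bound for the cross sections. -/
theorem H1.integral_pow_four_le (u : H1 L) (hL : 0 < L) {s : ℝ}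
    (hs : ∀ a, (u.translate hL a).traceSq ≤ s) :
    Integrable (fun z => ‖u z‖ ^ 4) (stripMeasure L) ∧
    ∫ z, ‖u z‖ ^ 4 ∂(stripMeasure L) ≤
      s * (L⁻¹ * mass u + 2 * ∫ z, ‖u z‖ * ‖u.dy z‖ ∂(stripMeasure L)) := by
  have i1 := integrable_norm_sq u.memLp_toFun
  have i2 := integrable_norm_mul_norm u.memLp_toFun u.memLp_dy
  have hm := u.memLp_toFun.1
  have hs0 : 0 ≤ s := (H1.traceSq_nonneg _).trans (hs 0)
  rw [stripMeasure_eq_prod] at i1 i2 hm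
  -- B(x) bounds |u(x, ·)|² uniformly in y. Hence ∫|u|⁴ ≤ ∫ B(x) (∫|u(x,y)|² dy) dx ≤ s ∫ B.
  set B : ℝ → ℝ := fun x => L⁻¹ * (∫ y, ‖u (x, y)‖ ^ 2 ∂(sectionMeasure L)) +
    2 * ∫ y, ‖u (x, y)‖ * ‖u.dy (x, y)‖ ∂(sectionMeasure L) with hB
  have hBi : Integrable B := (i1.integral_prod_left.const_mul _).add
    (i2.integral_prod_left.const_mul _)
  have hBint : ∫ x, B x = L⁻¹ * mass u + 2 * ∫ z, ‖u z‖ * ‖u.dy z‖ ∂(stripMeasure L) := by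
    rw [hB, integral_add (i1.integral_prod_left.const_mul _) (i2.integral_prod_left.const_mul _),
      integral_const_mul, integral_const_mul, mass, stripMeasure_eq_prod, integral_prod _ i1,
      integral_prod _ i2]
  have hB0 : ∀ x, 0 ≤ B x := fun x => add_nonneg
    (mul_nonneg (inv_nonneg.2 hL.le) (integral_nonneg fun _ => by positivity))
    (mul_nonneg zero_le_two (integral_nonneg fun _ => by positivity))
  have hpt : ∀ᵐ x, ∀ᵐ y ∂(sectionMeasure L), ‖u (x, y)‖ ^ 2 ≤ B x := by
    filter_upwards [u.slice_snd hL] with x hx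
    obtain ⟨F, hF, hFe⟩ := hx
    have hFe' := hFe
    filter_upwards [hFe, ae_restrict_mem measurableSet_Icc] with y hy hyI
    have h1 := hF.mul_norm_sq_le hyI
    rw [intervalIntegral.integral_of_le hL.le, intervalIntegral.integral_of_le hL.le,
      ← integral_Icc_eq_integral_Ioc, ← integral_Icc_eq_integral_Ioc, sub_zero] at h1
    have e1 : ∫ y, ‖u (x, y)‖ ^ 2 ∂(sectionMeasure L) = ∫ y in Icc 0 L, ‖F y‖ ^ 2 :=
      integral_congr_ae (hFe'.mono fun y hy => by simp only [hy])
    have e2 : ∫ y, ‖u (x, y)‖ * ‖u.dy (x, y)‖ ∂(sectionMeasure L) =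
        ∫ y in Icc 0 L, ‖F y‖ * ‖u.dy (x, y)‖ :=
      integral_congr_ae (hFe'.mono fun y hy => by simp only [hy])
    rw [hB]
    simp only [e1, e2, hy]
    have h2 := mul_le_mul_of_nonneg_left h1 (inv_nonneg.2 hL.le)
    have h3 : L⁻¹ * L = 1 := inv_mul_cancel₀ hL.ne'
    calc ‖F y‖ ^ 2 = L⁻¹ * (L * ‖F y‖ ^ 2) := by rw [← mul_assoc, h3, one_mul]
      _ ≤ _ := h2
      _ = L⁻¹ * (∫ t in Icc 0 L, ‖F t‖ ^ 2) +
          2 * (L⁻¹ * L) * ∫ t in Icc 0 L, ‖F t‖ * ‖u.dy (x, t)‖ := by ring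
      _ = _ := by rw [h3, mul_one]
  have hslice : ∀ᵐ x, ∫ y, ‖u (x, y)‖ ^ 2 ∂(sectionMeasure L) ≤ s := by
    filter_upwards [u.ae_eq_trace_translate hL] with x hx
    refine le_trans (le_of_eq ?_) (hs x)
    exact integral_congr_ae (hx.mono fun y hy => by simp only [hy])
  -- The lower integral is used because integrability of |u|⁴ is part of the conclusion.
  have hlin : ∫⁻ z, ENNReal.ofReal (‖u z‖ ^ 4) ∂(volume.prod (sectionMeasure L)) ≤
      ENNReal.ofReal (∫ x, s * B x) := by
    have hm4 : AEMeasurable (fun z => ENNReal.ofReal (‖u z‖ ^ 4))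
      (volume.prod (sectionMeasure L)) := (hm.norm.pow 4).aemeasurable.ennreal_ofReal
    rw [lintegral_prod _ hm4,
      ofReal_integral_eq_lintegral_ofReal (hBi.const_mul s)
        (ae_of_all _ fun x => mul_nonneg hs0 (hB0 x))]
    refine lintegral_mono_ae ?_
    filter_upwards [hpt, hslice, i1.prod_right_ae] with x h1 h2 h3
    calc ∫⁻ y, ENNReal.ofReal (‖u (x, y)‖ ^ 4) ∂(sectionMeasure L)
        ≤ ∫⁻ y, ENNReal.ofReal (B x * ‖u (x, y)‖ ^ 2) ∂(sectionMeasure L) := by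
          refine lintegral_mono_ae (h1.mono fun y hy => ENNReal.ofReal_le_ofReal ?_)
          nlinarith [sq_nonneg ‖u (x, y)‖]
      _ = ENNReal.ofReal (∫ y, B x * ‖u (x, y)‖ ^ 2 ∂(sectionMeasure L)) :=
          (ofReal_integral_eq_lintegral_ofReal (h3.const_mul _)
            (ae_of_all _ fun y => mul_nonneg (hB0 x) (by positivity))).symm
      _ ≤ ENNReal.ofReal (s * B x) := by
          refine ENNReal.ofReal_le_ofReal ?_
          rw [integral_const_mul, mul_comm s]
          exact mul_le_mul_of_nonneg_left h2 (hB0 x)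
  rw [← stripMeasure_eq_prod] at hlin hm
  have hint : Integrable (fun z => ‖u z‖ ^ 4) (stripMeasure L) := by
    refine ⟨hm.norm.pow 4, ?_⟩
    rw [hasFiniteIntegral_iff_ofReal (ae_of_all _ fun z => by positivity)]
    exact hlin.trans_lt ENNReal.ofReal_lt_top
  refine ⟨hint, ?_⟩
  rw [← ofReal_integral_eq_lintegral_ofReal hint (ae_of_all _ fun z => by positivity),
    ENNReal.ofReal_le_ofReal_iff (integral_nonneg fun x => mul_nonneg hs0 (hB0 x)),
    integral_const_mul, hBint] at hlin
  exact hlin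

end Inequalities

/-! ### Poincaré's inequality on boxes -/

section Poincare

variable {L : ℝ}

open scoped ENNReal

theorem enorm_add_sq_le (z w : ℂ) : ‖z + w‖ₑ ^ 2 ≤ 2 * ‖z‖ₑ ^ 2 + 2 * ‖w‖ₑ ^ 2 := by
  have h : ‖z + w‖₊ ^ 2 ≤ 2 * ‖z‖₊ ^ 2 + 2 * ‖w‖₊ ^ 2 := by
    rw [← NNReal.coe_le_coe]
    push_cast
    have := norm_add_le z w
    nlinarith [sq_nonneg (‖z‖ - ‖w‖), norm_nonneg (z + w), norm_nonneg z, norm_nonneg w]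
  simp only [enorm_eq_nnnorm]
  exact_mod_cast h

theorem lintegral_sq_le {α : Type*} [MeasurableSpace α] {μ : Measure α} {f : α → ℝ≥0∞} (hf : AEMeasurable f μ) :
    (∫⁻ x, f x ∂μ) ^ 2 ≤ μ univ * ∫⁻ x, f x ^ 2 ∂μ := by
  have h := ENNReal.lintegral_mul_le_Lp_mul_Lq μ Real.HolderConjugate.two_two hf
    (aemeasurable_const (b := (1 : ℝ≥0∞)))
  simp only [Pi.mul_apply, mul_one, lintegral_const, ENNReal.rpow_two, one_pow, one_mul] at h
  calc (∫⁻ x, f x ∂μ) ^ 2 ≤ ((∫⁻ x, f x ^ 2 ∂μ) ^ (1 / 2 : ℝ) * μ univ ^ (1 / 2 : ℝ)) ^ 2 := by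
        gcongr
    _ = μ univ * ∫⁻ x, f x ^ 2 ∂μ := by
        rw [mul_pow, ← ENNReal.rpow_natCast, ← ENNReal.rpow_natCast, ← ENNReal.rpow_mul,
          ← ENNReal.rpow_mul]
        norm_num
        rw [mul_comm]

/-- Pass from (x, y) to (x', y') through the corner (x', y): each of the two legs is parallel to an
axis and is controlled by `P` or `R`. -/
theorem lintegral_lintegral_enorm_sub_sq_le_of_measurable {μ ν : Measure ℝ} [IsFiniteMeasure μ]
    [IsFiniteMeasure ν] {f : ℝ × ℝ → ℂ} (hf : Measurable f) {P R : ℝ → ℝ≥0∞}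
    (hP : ∀ᵐ y ∂ν, ∀ᵐ x ∂μ, ∀ᵐ x' ∂μ, ‖f (x, y) - f (x', y)‖ₑ ^ 2 ≤ P y)
    (hR : ∀ᵐ x ∂μ, ∀ᵐ y ∂ν, ∀ᵐ y' ∂ν, ‖f (x, y) - f (x, y')‖ₑ ^ 2 ≤ R x) :
    ∫⁻ z, ∫⁻ z', ‖f z - f z'‖ₑ ^ 2 ∂(μ.prod ν) ∂(μ.prod ν) ≤
      2 * (μ univ) ^ 2 * ν univ * (∫⁻ y, P y ∂ν) + 2 * μ univ * (ν univ) ^ 2 * ∫⁻ x, R x ∂μ := by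
  have hA : ∫⁻ z, ∫⁻ z', ‖f z - f (z'.1, z.2)‖ₑ ^ 2 ∂(μ.prod ν) ∂(μ.prod ν) ≤
      (μ univ) ^ 2 * ν univ * (∫⁻ y, P y ∂ν) := by
    have h1 : ∀ z : ℝ × ℝ, ∫⁻ z', ‖f z - f (z'.1, z.2)‖ₑ ^ 2 ∂(μ.prod ν) =
        ν univ * ∫⁻ x', ‖f z - f (x', z.2)‖ₑ ^ 2 ∂μ := by
      intro z
      rw [lintegral_prod _ (by fun_prop)]
      simp only [lintegral_const]
      rw [lintegral_mul_const' _ _ (measure_ne_top _ _), mul_comm]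
    have hm : Measurable (fun z : ℝ × ℝ => ∫⁻ x', ‖f z - f (x', z.2)‖ₑ ^ 2 ∂μ) := by
      refine Measurable.lintegral_prod_right' (f := fun w : (ℝ × ℝ) × ℝ =>
        ‖f w.1 - f (w.2, w.1.2)‖ₑ ^ 2) (by fun_prop)
    simp only [h1]
    rw [lintegral_const_mul' _ _ (measure_ne_top _ _), lintegral_prod_symm _ hm.aemeasurable]
    calc ν univ * ∫⁻ y, ∫⁻ x, ∫⁻ x', ‖f (x, y) - f (x', y)‖ₑ ^ 2 ∂μ ∂μ ∂ν
        ≤ ν univ * ∫⁻ y, ∫⁻ x, ∫⁻ x', P y ∂μ ∂μ ∂ν := by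
          gcongr ν univ * ?_
          refine lintegral_mono_ae (hP.mono fun y hy => lintegral_mono_ae (hy.mono fun x hx =>
            lintegral_mono_ae hx))
      _ = _ := by
          simp only [lintegral_const]
          rw [lintegral_mul_const' _ _ (measure_ne_top _ _),
            lintegral_mul_const' _ _ (measure_ne_top _ _)]
          ring
  have hB : ∫⁻ z, ∫⁻ z', ‖f (z'.1, z.2) - f z'‖ₑ ^ 2 ∂(μ.prod ν) ∂(μ.prod ν) ≤
      μ univ * (ν univ) ^ 2 * ∫⁻ x, R x ∂μ := by
    have h1 : ∫⁻ z, ∫⁻ z', ‖f (z'.1, z.2) - f z'‖ₑ ^ 2 ∂(μ.prod ν) ∂(μ.prod ν) =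
        μ univ * ∫⁻ y, ∫⁻ z', ‖f (z'.1, y) - f z'‖ₑ ^ 2 ∂(μ.prod ν) ∂ν := by
      have hm : Measurable (fun y : ℝ => ∫⁻ z', ‖f (z'.1, y) - f z'‖ₑ ^ 2 ∂(μ.prod ν)) :=
        Measurable.lintegral_prod_right' (f := fun w : ℝ × (ℝ × ℝ) =>
          ‖f (w.2.1, w.1) - f w.2‖ₑ ^ 2) (by fun_prop)
      have hm' : Measurable (fun z : ℝ × ℝ =>
        ∫⁻ z', ‖f (z'.1, z.2) - f z'‖ₑ ^ 2 ∂(μ.prod ν)) := hm.comp measurable_snd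
      rw [lintegral_prod_symm _ hm'.aemeasurable]
      simp only [lintegral_const]
      rw [lintegral_mul_const' _ _ (measure_ne_top _ _), mul_comm]
    have h2 : ∀ y, ∫⁻ z', ‖f (z'.1, y) - f z'‖ₑ ^ 2 ∂(μ.prod ν) =
        ∫⁻ x, ∫⁻ y', ‖f (x, y) - f (x, y')‖ₑ ^ 2 ∂ν ∂μ := fun y => by
      rw [lintegral_prod _ (by fun_prop)]
    rw [h1]
    simp only [h2]
    have hm2 : Measurable (fun w : ℝ × ℝ => ∫⁻ y', ‖f (w.2, w.1) - f (w.2, y')‖ₑ ^ 2 ∂ν) :=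
      Measurable.lintegral_prod_right' (f := fun w : (ℝ × ℝ) × ℝ =>
        ‖f (w.1.2, w.1.1) - f (w.1.2, w.2)‖ₑ ^ 2) (by fun_prop)
    rw [lintegral_lintegral_swap hm2.aemeasurable]
    calc μ univ * ∫⁻ x, ∫⁻ y, ∫⁻ y', ‖f (x, y) - f (x, y')‖ₑ ^ 2 ∂ν ∂ν ∂μ
        ≤ μ univ * ∫⁻ x, ∫⁻ y, ∫⁻ y', R x ∂ν ∂ν ∂μ := by
          gcongr μ univ * ?_
          refine lintegral_mono_ae (hR.mono fun y hy => lintegral_mono_ae (hy.mono fun x hx =>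
            lintegral_mono_ae hx))
      _ = _ := by
          simp only [lintegral_const]
          rw [lintegral_mul_const' _ _ (measure_ne_top _ _),
            lintegral_mul_const' _ _ (measure_ne_top _ _)]
          ring
  have hmA : ∀ z : ℝ × ℝ, Measurable (fun z' : ℝ × ℝ => 2 * ‖f z - f (z'.1, z.2)‖ₑ ^ 2) :=
    fun z => by fun_prop
  have hmA' : Measurable (fun z : ℝ × ℝ => ∫⁻ z', ‖f z - f (z'.1, z.2)‖ₑ ^ 2 ∂(μ.prod ν)) :=
    Measurable.lintegral_prod_right' (f := fun w : (ℝ × ℝ) × (ℝ × ℝ) =>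
      ‖f w.1 - f (w.2.1, w.1.2)‖ₑ ^ 2) (by fun_prop)
  calc ∫⁻ z, ∫⁻ z', ‖f z - f z'‖ₑ ^ 2 ∂(μ.prod ν) ∂(μ.prod ν)
      ≤ ∫⁻ z, ∫⁻ z', (2 * ‖f z - f (z'.1, z.2)‖ₑ ^ 2 + 2 * ‖f (z'.1, z.2) - f z'‖ₑ ^ 2)
          ∂(μ.prod ν) ∂(μ.prod ν) := by
        refine lintegral_mono fun z => lintegral_mono fun z' => ?_
        refine le_trans (le_of_eq ?_) (enorm_add_sq_le _ _)
        rw [sub_add_sub_cancel]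
    _ = 2 * (∫⁻ z, ∫⁻ z', ‖f z - f (z'.1, z.2)‖ₑ ^ 2 ∂(μ.prod ν) ∂(μ.prod ν)) +
        2 * ∫⁻ z, ∫⁻ z', ‖f (z'.1, z.2) - f z'‖ₑ ^ 2 ∂(μ.prod ν) ∂(μ.prod ν) := by
        simp only [lintegral_add_left (hmA _)]
        simp only [lintegral_const_mul' _ _ ENNReal.ofNat_ne_top]
        rw [lintegral_add_left (hmA'.const_mul 2)]
        simp only [lintegral_const_mul' _ _ ENNReal.ofNat_ne_top]
    _ ≤ 2 * ((μ univ) ^ 2 * ν univ * (∫⁻ y, P y ∂ν)) +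
        2 * (μ univ * (ν univ) ^ 2 * ∫⁻ x, R x ∂μ) := by gcongr
    _ = _ := by ring

theorem lintegral_lintegral_enorm_sub_sq_le {μ ν : Measure ℝ} [IsFiniteMeasure μ]
    [IsFiniteMeasure ν] {f : ℝ × ℝ → ℂ} (hf : AEStronglyMeasurable f (μ.prod ν)) {P R : ℝ → ℝ≥0∞}
    (hP : ∀ᵐ y ∂ν, ∀ᵐ x ∂μ, ∀ᵐ x' ∂μ, ‖f (x, y) - f (x', y)‖ₑ ^ 2 ≤ P y)
    (hR : ∀ᵐ x ∂μ, ∀ᵐ y ∂ν, ∀ᵐ y' ∂ν, ‖f (x, y) - f (x, y')‖ₑ ^ 2 ≤ R x) :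
    ∫⁻ z, ∫⁻ z', ‖f z - f z'‖ₑ ^ 2 ∂(μ.prod ν) ∂(μ.prod ν) ≤
      2 * (μ univ) ^ 2 * ν univ * (∫⁻ y, P y ∂ν) + 2 * μ univ * (ν univ) ^ 2 * ∫⁻ x, R x ∂μ := by
  have he := hf.ae_eq_mk
  have h1 : ∀ᵐ x ∂μ, ∀ᵐ y ∂ν, f (x, y) = hf.mk f (x, y) := Measure.ae_ae_of_ae_prod he
  have h2 : ∀ᵐ y ∂ν, ∀ᵐ x ∂μ, f (x, y) = hf.mk f (x, y) :=
    Measure.ae_ae_of_ae_prod (Measure.measurePreserving_swap.quasiMeasurePreserving.ae he)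
  refine le_trans (le_of_eq ?_) (lintegral_lintegral_enorm_sub_sq_le_of_measurable
    hf.stronglyMeasurable_mk.measurable (P := P) (R := R) ?_ ?_)
  · refine lintegral_congr_ae (he.mono fun z hz => lintegral_congr_ae (he.mono fun z' hz' => ?_))
    simp only [hz, hz']
  · filter_upwards [hP, h2] with y hy hy'
    filter_upwards [hy, hy'] with x hx hx'
    filter_upwards [hx, hy'] with t ht ht'
    rwa [← hx', ← ht']
  · filter_upwards [hR, h1] with y hy hy'
    filter_upwards [hy, hy'] with x hx hx'
    filter_upwards [hx, hy'] with t ht ht'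
    rwa [← hx', ← ht']

theorem AEPrimitiveOn.enorm_sub_sq_le {I : Set ℝ} {f g : ℝ → ℂ} (h : AEPrimitiveOn I f g)
    {a b : ℝ} (hab : a ≤ b) (hI : Icc a b ⊆ I) :
    ∀ᵐ x ∂(volume.restrict (Ioc a b)), ∀ᵐ x' ∂(volume.restrict (Ioc a b)),
      ‖f x - f x'‖ₑ ^ 2 ≤ ENNReal.ofReal (b - a) * ∫⁻ t in Ioc a b, ‖g t‖ₑ ^ 2 := by
  obtain ⟨F, hF, hFe⟩ := h
  have hFe' := ae_restrict_of_ae_restrict_of_subset (Ioc_subset_Icc_self.trans hI) hFe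
  have hgi : IntegrableOn g (Ioc a b) := (hF a (hI (left_mem_Icc.2 hab)) b
    (hI (right_mem_Icc.2 hab))).1.1
  filter_upwards [hFe', ae_restrict_mem measurableSet_Ioc] with x hx hxI
  filter_upwards [hFe', ae_restrict_mem measurableSet_Ioc] with x' hx' hxI'
  have h1 := (hF.mono hI).norm_sub_le_integral (Ioc_subset_Icc_self hxI) (Ioc_subset_Icc_self hxI')
  rw [intervalIntegral.integral_of_le hab] at h1
  have h2 : ‖F x - F x'‖ₑ ≤ ∫⁻ t in Ioc a b, ‖g t‖ₑ := by
    rw [← ofReal_integral_norm_eq_lintegral_enorm hgi, ← ofReal_norm]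
    exact ENNReal.ofReal_le_ofReal h1
  rw [hx, hx']
  calc ‖F x - F x'‖ₑ ^ 2 ≤ (∫⁻ t in Ioc a b, ‖g t‖ₑ) ^ 2 := by gcongr
    _ ≤ _ := lintegral_sq_le hgi.1.enorm
    _ = _ := by simp

/-- A box. -/
def box (a b c d : ℝ) : Set (ℝ × ℝ) := Ioc a b ×ˢ Ioc c d

theorem measurableSet_box (a b c d : ℝ) : MeasurableSet (box a b c d) :=
  measurableSet_Ioc.prod measurableSet_Ioc

theorem restrict_box {a b c d : ℝ} (hc : 0 ≤ c) (hd : d ≤ L) :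
    (stripMeasure L).restrict (box a b c d) =
      (volume.restrict (Ioc a b)).prod (volume.restrict (Ioc c d)) := by
  rw [stripMeasure_eq_prod, box, ← Measure.prod_restrict, sectionMeasure,
    Measure.restrict_restrict_of_subset]
  exact fun y hy => ⟨hc.trans hy.1.le, hy.2.trans hd⟩

/-- The Poincaré inequality on a box, for the differences of the values at two points. -/
theorem H1.lintegral_lintegral_enorm_sub_sq_le (u : H1 L) (hL : 0 < L) {a b c d : ℝ} (hab : a ≤ b)
    (hcd : c ≤ d) (hc : 0 ≤ c) (hd : d ≤ L) :
    ∫⁻ z in box a b c d, ∫⁻ z' in box a b c d, ‖u z - u z'‖ₑ ^ 2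
        ∂(stripMeasure L) ∂(stripMeasure L) ≤
      ENNReal.ofReal (2 * ((b - a) * (d - c)) *
        ((b - a) ^ 2 * (∫ z in box a b c d, ‖u.dx z‖ ^ 2 ∂(stripMeasure L)) +
          (d - c) ^ 2 * ∫ z in box a b c d, ‖u.dy z‖ ^ 2 ∂(stripMeasure L))) := by
  have hm : AEStronglyMeasurable u ((stripMeasure L).restrict (box a b c d)) :=
    u.memLp_toFun.1.restrict
  have i1 : Integrable (fun z => ‖u.dx z‖ ^ 2) ((stripMeasure L).restrict (box a b c d)) :=
    (integrable_norm_sq u.memLp_dx).integrableOn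
  have i2 : Integrable (fun z => ‖u.dy z‖ ^ 2) ((stripMeasure L).restrict (box a b c d)) :=
    (integrable_norm_sq u.memLp_dy).integrableOn
  have m1 : AEMeasurable (fun z => ‖u.dx z‖ₑ ^ 2) ((stripMeasure L).restrict (box a b c d)) :=
    u.memLp_dx.1.restrict.enorm.pow_const 2
  have m2 : AEMeasurable (fun z => ‖u.dy z‖ₑ ^ 2) ((stripMeasure L).restrict (box a b c d)) :=
    u.memLp_dy.1.restrict.enorm.pow_const 2
  have e1 : ∫⁻ z in box a b c d, ‖u.dx z‖ₑ ^ 2 ∂(stripMeasure L) =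
      ENNReal.ofReal (∫ z in box a b c d, ‖u.dx z‖ ^ 2 ∂(stripMeasure L)) := by
    rw [ofReal_integral_eq_lintegral_ofReal i1 (ae_of_all _ fun z => by positivity)]
    simp only [ENNReal.ofReal_pow (norm_nonneg _), ofReal_norm]
  have e2 : ∫⁻ z in box a b c d, ‖u.dy z‖ₑ ^ 2 ∂(stripMeasure L) =
      ENNReal.ofReal (∫ z in box a b c d, ‖u.dy z‖ ^ 2 ∂(stripMeasure L)) := by
    rw [ofReal_integral_eq_lintegral_ofReal i2 (ae_of_all _ fun z => by positivity)]
    simp only [ENNReal.ofReal_pow (norm_nonneg _), ofReal_norm]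
  have hsub : Ioc c d ⊆ Icc 0 L := fun y hy => ⟨hc.trans hy.1.le, hy.2.trans hd⟩
  have hP := ae_restrict_of_ae_restrict_of_subset hsub u.slice_fst
  have hR := ae_restrict_of_ae (s := Ioc a b) (u.slice_snd hL)
  have h1 := DeltaStrip.lintegral_lintegral_enorm_sub_sq_le (restrict_box hc hd ▸ hm)
    (hP.mono fun y hy => hy.enorm_sub_sq_le hab (subset_univ _))
    (hR.mono fun x hx => hx.enorm_sub_sq_le hcd (Icc_subset_Icc hc hd))
  rw [lintegral_const_mul' _ _ ENNReal.ofReal_ne_top,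
    lintegral_const_mul' _ _ ENNReal.ofReal_ne_top] at h1
  rw [restrict_box hc hd] at m1 m2
  rw [restrict_box hc hd, lintegral_prod_symm _ m1] at e1
  rw [restrict_box hc hd, lintegral_prod _ m2] at e2
  rw [e1, e2, ← restrict_box hc hd] at h1
  refine h1.trans_eq ?_
  have hx : 0 ≤ ∫ z in box a b c d, ‖u.dx z‖ ^ 2 ∂(stripMeasure L) :=
    integral_nonneg fun _ => by positivity
  have hy : 0 ≤ ∫ z in box a b c d, ‖u.dy z‖ ^ 2 ∂(stripMeasure L) :=
    integral_nonneg fun _ => by positivity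
  have hba : 0 ≤ b - a := sub_nonneg.2 hab
  have hdc : 0 ≤ d - c := sub_nonneg.2 hcd
  simp only [Measure.restrict_apply_univ, Real.volume_Ioc]
  rw [ENNReal.ofReal_mul (by positivity), ENNReal.ofReal_add (by positivity) (by positivity),
    ENNReal.ofReal_mul zero_le_two, ENNReal.ofReal_mul hba, ENNReal.ofReal_mul (by positivity),
    ENNReal.ofReal_mul (by positivity), ENNReal.ofReal_pow hba, ENNReal.ofReal_pow hdc,
    ENNReal.ofReal_ofNat]
  ring

theorem stripMeasure_box {a b c d : ℝ} (hab : a ≤ b) (hc : 0 ≤ c) (hd : d ≤ L) :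
    (stripMeasure L) (box a b c d) = ENNReal.ofReal ((b - a) * (d - c)) := by
  have := congrArg (fun μ => μ univ) (restrict_box (a := a) (b := b) hc hd)
  simp only [Measure.restrict_apply_univ] at this
  rw [this, ← univ_prod_univ, Measure.prod_prod]
  simp only [Measure.restrict_apply_univ, Real.volume_Ioc]
  rw [← ENNReal.ofReal_mul (sub_nonneg.2 hab)]

/-- With V the area of the box, V u(z) is the integral of u plus the integral of u(z) - u(z') over
z'. The second part is controlled by the two-point Poincaré inequality, whose factors shrink with
the sides of the box. -/
theorem H1.mul_integral_box_norm_sq_le (u : H1 L) (hL : 0 < L) {a b c d : ℝ} (hab : a < b)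
    (hcd : c < d) (hc : 0 ≤ c) (hd : d ≤ L) :
    ∫ z in box a b c d, ‖u z‖ ^ 2 ∂(stripMeasure L) ≤
      2 / ((b - a) * (d - c)) * ‖∫ z in box a b c d, u z ∂(stripMeasure L)‖ ^ 2 +
        4 * ((b - a) ^ 2 * (∫ z in box a b c d, ‖u.dx z‖ ^ 2 ∂(stripMeasure L)) +
          (d - c) ^ 2 * ∫ z in box a b c d, ‖u.dy z‖ ^ 2 ∂(stripMeasure L)) := by
  set κ := (stripMeasure L).restrict (box a b c d) with hκ
  set V := (b - a) * (d - c) with hV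
  have hV0 : 0 < V := mul_pos (sub_pos.2 hab) (sub_pos.2 hcd)
  set D := (b - a) ^ 2 * (∫ z, ‖u.dx z‖ ^ 2 ∂κ) + (d - c) ^ 2 * ∫ z, ‖u.dy z‖ ^ 2 ∂κ with hD
  have hD0 : 0 ≤ D := add_nonneg (mul_nonneg (by positivity) (integral_nonneg fun _ => by positivity))
    (mul_nonneg (by positivity) (integral_nonneg fun _ => by positivity))
  have hκu : κ univ = ENNReal.ofReal V := by
    rw [hκ, Measure.restrict_apply_univ, stripMeasure_box hab.le hc hd]
  have : IsFiniteMeasure κ := ⟨by rw [hκu]; exact ENNReal.ofReal_lt_top⟩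
  have hu2 : MemLp u 2 κ := u.memLp_toFun.restrict _
  have hui : Integrable u κ := hu2.integrable one_le_two
  have hP : ∫⁻ z, ∫⁻ z', ‖u z - u z'‖ₑ ^ 2 ∂κ ∂κ ≤ ENNReal.ofReal (2 * V * D) :=
    u.lintegral_lintegral_enorm_sub_sq_le hL hab.le hcd.le hc hd
  have hpt : ∀ z, ENNReal.ofReal (V ^ 2) * ‖u z‖ₑ ^ 2 ≤
      2 * ‖∫ z', u z' ∂κ‖ₑ ^ 2 + 2 * (ENNReal.ofReal V * ∫⁻ z', ‖u z - u z'‖ₑ ^ 2 ∂κ) := by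
    intro z
    have e : (V : ℂ) * u z = (∫ z', u z' ∂κ) + ∫ z', (u z - u z') ∂κ := by
      rw [integral_sub (integrable_const _) hui, integral_const, measureReal_def, hκu,
        ENNReal.toReal_ofReal hV0.le, Complex.real_smul]
      ring
    have e2 : ENNReal.ofReal (V ^ 2) * ‖u z‖ₑ ^ 2 = ‖(V : ℂ) * u z‖ₑ ^ 2 := by
      rw [enorm_mul, mul_pow ‖(V : ℂ)‖ₑ, ENNReal.ofReal_pow hV0.le, ← ofReal_norm (V : ℂ),
        Complex.norm_of_nonneg hV0.le]
    rw [e2, e]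
    refine (enorm_add_sq_le _ _).trans ?_
    gcongr
    calc ‖∫ z', (u z - u z') ∂κ‖ₑ ^ 2 ≤ (∫⁻ z', ‖u z - u z'‖ₑ ∂κ) ^ 2 := by
          gcongr; exact enorm_integral_le_lintegral_enorm _
      _ ≤ κ univ * ∫⁻ z', ‖u z - u z'‖ₑ ^ 2 ∂κ :=
          lintegral_sq_le ((aestronglyMeasurable_const.sub hui.1).enorm)
      _ = _ := by rw [hκu]
  have hint := lintegral_mono (μ := κ) hpt
  rw [lintegral_const_mul' _ _ ENNReal.ofReal_ne_top, lintegral_add_left measurable_const,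
    lintegral_const, hκu, lintegral_const_mul' _ _ ENNReal.ofNat_ne_top,
    lintegral_const_mul' _ _ ENNReal.ofReal_ne_top] at hint
  have e3 : ∫⁻ z, ‖u z‖ₑ ^ 2 ∂κ = ENNReal.ofReal (∫ z, ‖u z‖ ^ 2 ∂κ) := by
    rw [ofReal_integral_eq_lintegral_ofReal (integrable_norm_sq hu2)
      (ae_of_all _ fun z => by positivity)]
    simp only [ENNReal.ofReal_pow (norm_nonneg _), ofReal_norm]
  rw [e3, ← ofReal_norm, ← ENNReal.ofReal_pow (norm_nonneg _)] at hint
  have h2 : ENNReal.ofReal (V ^ 2 * ∫ z, ‖u z‖ ^ 2 ∂κ) ≤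
      ENNReal.ofReal (2 * ‖∫ z, u z ∂κ‖ ^ 2 * V + 2 * (V * (2 * V * D))) := by
    rw [ENNReal.ofReal_mul (by positivity), ENNReal.ofReal_add (by positivity) (by positivity),
      ENNReal.ofReal_mul (by positivity), ENNReal.ofReal_mul zero_le_two,
      ENNReal.ofReal_mul zero_le_two, ENNReal.ofReal_mul hV0.le, ENNReal.ofReal_ofNat]
    refine hint.trans ?_
    gcongr
  rw [ENNReal.ofReal_le_ofReal_iff (by positivity)] at h2
  have h3 : V ^ 2 * (2 / V * ‖∫ z, u z ∂κ‖ ^ 2 + 4 * D) =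
      2 * ‖∫ z, u z ∂κ‖ ^ 2 * V + 2 * (V * (2 * V * D)) := by
    field_simp; ring
  rw [← h3] at h2
  exact le_of_mul_le_mul_left h2 (by positivity)

end Poincare

/-! ### Weak compactness in L² and H¹ -/

section WeakConvergence

variable {L : ℝ}

/-- A bounded sequence in `L²` has a weak limit along every ultrafilter. -/
theorem exists_weak_limit {μ : Measure (ℝ × ℝ)} (𝒰 : Ultrafilter ℕ) {f : ℕ → ℝ × ℝ → ℂ} {C : ℝ}
    (hf : ∀ n, MemLp (f n) 2 μ) (hC : ∀ n, ∫ z, ‖f n z‖ ^ 2 ∂μ ≤ C) :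
    ∃ g, MemLp g 2 μ ∧ ∀ φ, MemLp φ 2 μ →
      Tendsto (fun n => ∫ z, φ z * f n z ∂μ) 𝒰 (𝓝 (∫ z, φ z * g z ∂μ)) := by
  set F : ℕ → Lp ℂ 2 μ := fun n => (hf n).toLp (f n) with hF
  have hnorm : ∀ n, ‖F n‖ ≤ Real.sqrt C := by
    intro n
    refine Real.le_sqrt_of_sq_le ?_
    rw [← @inner_self_eq_norm_sq ℂ, L2.inner_def]
    refine le_trans (le_of_eq ?_) (hC n)
    have e : ∫ z, inner ℂ (F n z) (F n z) ∂μ = ∫ z, ((‖f n z‖ ^ 2 : ℝ) : ℂ) ∂μ := by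
      refine integral_congr_ae ?_
      filter_upwards [(hf n).coeFn_toLp] with z hz
      simp only [hF, hz, inner_self_eq_norm_sq_to_K]
      norm_cast
    rw [e, integral_complex_ofReal]
    simp
  -- Through the Riesz isomorphism the sequence lies in a closed ball of the dual, which is weak-*
  -- compact by Banach-Alaoglu; an ultrafilter on a compact set converges, so no subsequence is
  -- extracted.
  set T : ℕ → WeakDual ℂ (Lp ℂ 2 μ) := fun n =>
    StrongDual.toWeakDual (InnerProductSpace.toDual ℂ (Lp ℂ 2 μ) (F n)) with hT
  have hK := WeakDual.isCompact_closedBall (𝕜 := ℂ) (E := Lp ℂ 2 μ) 0 (Real.sqrt C)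
  obtain ⟨T0, -, hT0⟩ := isCompact_iff_ultrafilter_le_nhds.1 hK (𝒰.map T) (by
    rw [le_principal_iff, Ultrafilter.mem_coe, Ultrafilter.mem_map]
    refine univ_mem' fun n => ?_
    have : ‖InnerProductSpace.toDual ℂ (Lp ℂ 2 μ) (F n)‖ ≤ Real.sqrt C := by
      rw [LinearIsometryEquiv.norm_map]; exact hnorm n
    exact mem_closedBall_zero_iff.2 this)
  set g := (InnerProductSpace.toDual ℂ (Lp ℂ 2 μ)).symm (WeakDual.toStrongDual T0) with hg
  refine ⟨g, Lp.memLp g, fun φ hφ => ?_⟩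
  have hφ' : MemLp (fun z => star (φ z)) 2 μ := hφ.star
  have hlim : Tendsto (fun n => T n (hφ'.toLp _)) 𝒰 (𝓝 (T0 (hφ'.toLp _))) :=
    ((WeakDual.eval_continuous (hφ'.toLp _)).tendsto T0).comp hT0
  have e1 : ∀ n, T n (hφ'.toLp _) = inner ℂ (F n) (hφ'.toLp _) := fun n => rfl
  have e2 : T0 (hφ'.toLp _) = inner ℂ g (hφ'.toLp _) :=
    (InnerProductSpace.toDual_symm_apply (𝕜 := ℂ) (E := Lp ℂ 2 μ)).symm
  have e3 : ∀ (h : Lp ℂ 2 μ) (h' : ℝ × ℝ → ℂ), h =ᵐ[μ] h' →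
      star (inner ℂ h (hφ'.toLp _)) = ∫ z, φ z * h' z ∂μ := by
    intro h h' hh
    rw [L2.inner_def, ← starRingEnd_apply, ← integral_conj]
    refine integral_congr_ae ?_
    filter_upwards [hh, hφ'.coeFn_toLp] with z h1 h2
    rw [h1, h2, RCLike.inner_apply]
    simp
  simp only [e1, e2] at hlim
  have h4 := hlim.star
  rw [e3 g g (ae_eq_refl _)] at h4
  refine h4.congr fun n => ?_
  exact e3 _ _ (hf n).coeFn_toLp

/-- The identity defining a weak derivative pairs u and its derivative with L² functions only, so it
survives the three weak limits. -/
theorem H1.exists_weak_limit (𝒰 : Ultrafilter ℕ) {u : ℕ → H1 L} {C : ℝ}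
    (hm : ∀ n, mass (u n) ≤ C) (hg : ∀ n, (u n).gradSq ≤ C) :
    ∃ v : H1 L, ∀ φ, MemLp φ 2 (stripMeasure L) →
      Tendsto (fun n => ∫ z, φ z * u n z ∂(stripMeasure L)) 𝒰
        (𝓝 (∫ z, φ z * v z ∂(stripMeasure L))) ∧
      Tendsto (fun n => ∫ z, φ z * (u n).dx z ∂(stripMeasure L)) 𝒰
        (𝓝 (∫ z, φ z * v.dx z ∂(stripMeasure L))) ∧
      Tendsto (fun n => ∫ z, φ z * (u n).dy z ∂(stripMeasure L)) 𝒰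
        (𝓝 (∫ z, φ z * v.dy z ∂(stripMeasure L))) := by
  obtain ⟨v, hv, hv'⟩ := DeltaStrip.exists_weak_limit 𝒰 (fun n => (u n).memLp_toFun) hm
  obtain ⟨g, hgm, hg'⟩ := DeltaStrip.exists_weak_limit 𝒰 (fun n => (u n).memLp_dx)
    fun n => (u n).integral_dx_sq_le.trans (hg n)
  obtain ⟨h, hh, hh'⟩ := DeltaStrip.exists_weak_limit 𝒰 (fun n => (u n).memLp_dy)
    fun n => (u n).integral_dy_sq_le.trans (hg n)
  have key : ∀ (e : ℝ × ℝ) (d : ℕ → ℝ × ℝ → ℂ) (g : ℝ × ℝ → ℂ),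
      (∀ n, IsWeakDeriv L e (u n) (d n)) →
      (∀ φ, MemLp φ 2 (stripMeasure L) → Tendsto (fun n => ∫ z, φ z * d n z ∂(stripMeasure L)) 𝒰
        (𝓝 (∫ z, φ z * g z ∂(stripMeasure L)))) → IsWeakDeriv L e v g := by
    intro e d g hd hlim φ hφ
    have hmem : ∀ {f : ℝ × ℝ → ℝ}, Continuous f → HasCompactSupport f →
        MemLp (fun z => (f z : ℂ)) 2 (stripMeasure L) := fun hf hf' => by
      have : MemLp _ 2 (stripMeasure L) := (hf.memLp_of_hasCompactSupport hf').restrict _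
      exact this.ofReal
    have h1 := hv' _ (hmem (hφ.continuous_fderiv e) (hφ.hasCompactSupport_fderiv e))
    have h2 := hlim _ (hmem hφ.1.continuous hφ.2.1)
    simp only [← Complex.real_smul] at h1 h2
    refine tendsto_nhds_unique h1 ?_
    refine h2.neg.congr fun n => ?_
    rw [hd n φ hφ]
  exact ⟨⟨v, g, h, hv, hgm, hh, key _ _ _ (fun n => (u n).isWeakDeriv_dx) hg',
    key _ _ _ (fun n => (u n).isWeakDeriv_dy) hh'⟩, fun φ hφ => ⟨hv' φ hφ, hg' φ hφ, hh' φ hφ⟩⟩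

end WeakConvergence

/-! ### Rellich's theorem and compactness of the trace -/

section Rellich

variable {L : ℝ}

theorem setIntegral_box_split {f : ℝ × ℝ → ℝ} {μ : Measure (ℝ × ℝ)} (hf : Integrable f μ)
    {a m b c k d : ℝ} (h1 : a ≤ m) (h2 : m ≤ b) (h3 : c ≤ k) (h4 : k ≤ d) :
    ∫ z in box a b c d, f z ∂μ = (∫ z in box a m c k, f z ∂μ) + (∫ z in box a m k d, f z ∂μ) +
      (∫ z in box m b c k, f z ∂μ) + ∫ z in box m b k d, f z ∂μ := by
  have hd : ∀ {s t u : ℝ}, Disjoint (Ioc s t) (Ioc t u) := fun {s t u} =>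
    Set.disjoint_left.2 fun x hx hx' => absurd hx'.1 (not_lt.2 hx.2)
  have e1 : box a b c d = box a m c d ∪ box m b c d := by
    simp only [box]; rw [← union_prod, Ioc_union_Ioc_eq_Ioc h1 h2]
  have e2 : ∀ a b, box a b c d = box a b c k ∪ box a b k d := fun a b => by
    simp only [box]; rw [← prod_union, Ioc_union_Ioc_eq_Ioc h3 h4]
  have d1 : Disjoint (box a m c d) (box m b c d) := Disjoint.set_prod_left hd _ _
  have d2 : ∀ a b, Disjoint (box a b c k) (box a b k d) := fun a b =>
    Disjoint.set_prod_right hd _ _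
  rw [e1, setIntegral_union d1 (measurableSet_box _ _ _ _) hf.integrableOn hf.integrableOn,
    e2 a m, e2 m b,
    setIntegral_union (d2 a m) (measurableSet_box _ _ _ _) hf.integrableOn hf.integrableOn,
    setIntegral_union (d2 m b) (measurableSet_box _ _ _ _) hf.integrableOn hf.integrableOn]
  ring

/-- Induction by cutting the box into four. Each cut halves both sides and so divides the gradient
factor by 4, while the finitely many means over small boxes tend to zero by weak convergence. -/
theorem eventually_integral_box_norm_sq_le (hL : 0 < L) {l : Filter ℕ} {w : ℕ → H1 L}
    (hw : ∀ φ, MemLp φ 2 (stripMeasure L) →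
      Tendsto (fun n => ∫ z, φ z * w n z ∂(stripMeasure L)) l (𝓝 0)) (k : ℕ) :
    ∀ a b c d : ℝ, a < b → c < d → 0 ≤ c → d ≤ L → ∀ ε > 0, ∀ᶠ n in l,
      ∫ z in box a b c d, ‖w n z‖ ^ 2 ∂(stripMeasure L) ≤ ε + 4 / 4 ^ k *
        ((b - a) ^ 2 * (∫ z in box a b c d, ‖(w n).dx z‖ ^ 2 ∂(stripMeasure L)) +
          (d - c) ^ 2 * ∫ z in box a b c d, ‖(w n).dy z‖ ^ 2 ∂(stripMeasure L)) := by
  induction k with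
  | zero =>
    intro a b c d hab hcd hc hd ε hε
    have hV : 0 < (b - a) * (d - c) := mul_pos (sub_pos.2 hab) (sub_pos.2 hcd)
    have h1 : MemLp ((box a b c d).indicator (fun _ => (1 : ℂ))) 2 (stripMeasure L) :=
      memLp_indicator_const _ (measurableSet_box _ _ _ _) _ (Or.inr (by
        rw [stripMeasure_box hab.le hc hd]; exact ENNReal.ofReal_ne_top))
    have h2 := ((hw _ h1).norm.pow 2).const_mul (2 / ((b - a) * (d - c)))
    have e : ∀ n, ∫ z, (box a b c d).indicator (fun _ => (1 : ℂ)) z * w n z ∂(stripMeasure L) =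
        ∫ z in box a b c d, w n z ∂(stripMeasure L) := by
      intro n
      rw [← integral_indicator (measurableSet_box _ _ _ _)]
      congr 1
      ext z
      by_cases hz : z ∈ box a b c d <;> simp [hz]
    simp only [e, norm_zero, ne_eq, OfNat.ofNat_ne_zero, not_false_eq_true, zero_pow,
      mul_zero] at h2
    filter_upwards [h2.eventually_lt_const hε] with n hn
    have := (w n).mul_integral_box_norm_sq_le hL hab hcd hc hd
    rw [pow_zero, div_one]
    linarith
  | succ k ih =>
    intro a b c d hab hcd hc hd ε hε
    have hm1 : a < (a + b) / 2 := by linarith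
    have hm2 : (a + b) / 2 < b := by linarith
    have hk1 : c < (c + d) / 2 := by linarith
    have hk2 : (c + d) / 2 < d := by linarith
    filter_upwards [ih a _ c _ hm1 hk1 hc (by linarith) (ε / 4) (by linarith),
      ih a _ _ d hm1 hk2 (by linarith) hd (ε / 4) (by linarith),
      ih _ b c _ hm2 hk1 hc (by linarith) (ε / 4) (by linarith),
      ih _ b _ d hm2 hk2 (by linarith) hd (ε / 4) (by linarith)] with n h1 h2 h3 h4
    rw [setIntegral_box_split (integrable_norm_sq (w n).memLp_toFun) hm1.le hm2.le hk1.le hk2.le,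
      setIntegral_box_split (integrable_norm_sq (w n).memLp_dx) hm1.le hm2.le hk1.le hk2.le,
      setIntegral_box_split (integrable_norm_sq (w n).memLp_dy) hm1.le hm2.le hk1.le hk2.le]
    refine (add_le_add (add_le_add (add_le_add h1 h2) h3) h4).trans (le_of_eq ?_)
    rw [pow_succ]
    ring

theorem restrict_window_eq_restrict_box (L l : ℝ) :
    (stripMeasure L).restrict (window l) = (stripMeasure L).restrict (box (-l) l 0 L) := by
  rw [restrict_window, restrict_box le_rfl le_rfl, sectionMeasure,
    Measure.restrict_congr_set (Ioc_ae_eq_Icc (a := (0 : ℝ)) (b := L))]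

/-- Rellich's theorem: weak convergence in `H¹` implies convergence in `L²` on bounded sets. -/
theorem tendsto_integral_window_norm_sq (hL : 0 < L) {l : Filter ℕ} {w : ℕ → H1 L} {K : ℝ}
    (hw : ∀ φ, MemLp φ 2 (stripMeasure L) →
      Tendsto (fun n => ∫ z, φ z * w n z ∂(stripMeasure L)) l (𝓝 0))
    (hK : ∀ᶠ n in l, (w n).gradSq ≤ K) {R : ℝ} (hR : 0 < R) :
    Tendsto (fun n => ∫ z in window R, ‖w n z‖ ^ 2 ∂(stripMeasure L)) l (𝓝 0) := by
  rw [Metric.tendsto_nhds]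
  intro ε hε
  set A := 4 * (((2 * R) ^ 2 + L ^ 2) * |K|) with hA
  have hA0 : 0 ≤ A := by positivity
  -- This many subdivisions bring the gradient term below ε/2 for all n at once.
  obtain ⟨k, hk⟩ := exists_pow_lt_of_lt_one (show 0 < ε / (2 * (A + 1)) by positivity)
    (show (1 / 4 : ℝ) < 1 by norm_num)
  filter_upwards [eventually_integral_box_norm_sq_le hL hw k (-R) R 0 L (by linarith) hL le_rfl
    le_rfl (ε / 2) (by linarith), hK] with n hn hKn
  rw [restrict_window_eq_restrict_box, Real.dist_eq, sub_zero,
    abs_of_nonneg (integral_nonneg fun _ => by positivity)]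
  refine hn.trans_lt ?_
  have h1 : ∫ z in box (-R) R 0 L, ‖(w n).dx z‖ ^ 2 ∂(stripMeasure L) ≤ |K| :=
    (setIntegral_le_integral (integrable_norm_sq (w n).memLp_dx)
      (ae_of_all _ fun z => by positivity)).trans
      ((w n).integral_dx_sq_le.trans (hKn.trans (le_abs_self K)))
  have h2 : ∫ z in box (-R) R 0 L, ‖(w n).dy z‖ ^ 2 ∂(stripMeasure L) ≤ |K| :=
    (setIntegral_le_integral (integrable_norm_sq (w n).memLp_dy)
      (ae_of_all _ fun z => by positivity)).trans
      ((w n).integral_dy_sq_le.trans (hKn.trans (le_abs_self K)))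
  have h3 : 4 / 4 ^ k * ((R - -R) ^ 2 *
      (∫ z in box (-R) R 0 L, ‖(w n).dx z‖ ^ 2 ∂(stripMeasure L)) +
      (L - 0) ^ 2 * ∫ z in box (-R) R 0 L, ‖(w n).dy z‖ ^ 2 ∂(stripMeasure L)) ≤
      (1 / 4) ^ k * A := by
    have e : (4 : ℝ) / 4 ^ k = (1 / 4) ^ k * 4 := by rw [one_div, inv_pow]; ring
    rw [e, hA, mul_assoc]
    gcongr
    rw [sub_neg_eq_add, sub_zero, ← two_mul, add_mul]
    gcongr
  have h4 : (1 / 4 : ℝ) ^ k * A ≤ ε / (2 * (A + 1)) * A := by gcongr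
  have h5 : ε / (2 * (A + 1)) * A < ε / 2 := by
    rw [div_mul_eq_mul_div, div_lt_div_iff₀ (by positivity) (by positivity)]
    nlinarith
  linarith

/-- The window estimate with l = 1 bounds the trace by the L² norm on a bounded set, which tends to
zero by Rellich, and a product with ∂ₓw. The weight c in Young's inequality makes the gradient share
of that product at most ε. -/
theorem tendsto_traceSq (hL : 0 < L) {l : Filter ℕ} {w : ℕ → H1 L} {K : ℝ}
    (hw : ∀ φ, MemLp φ 2 (stripMeasure L) →
      Tendsto (fun n => ∫ z, φ z * w n z ∂(stripMeasure L)) l (𝓝 0))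
    (hK : ∀ᶠ n in l, (w n).gradSq ≤ K) :
    Tendsto (fun n => (w n).traceSq) l (𝓝 0) := by
  rw [Metric.tendsto_nhds]
  intro ε hε
  set c := (|K| + 1) / ε with hc
  have hc0 : 0 < c := by positivity
  have h1 := (tendsto_integral_window_norm_sq hL hw hK one_pos).const_mul (1 + c)
  rw [mul_zero] at h1
  filter_upwards [h1.eventually_lt_const hε, hK] with n hn hKn
  rw [Real.dist_eq, sub_zero, abs_of_nonneg (H1.traceSq_nonneg _)]
  have h2 := ((w n).traceSq_window one_pos).2
  have h3 := two_mul_integral_norm_mul_le ((w n).memLp_toFun.restrict (window 1))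
    ((w n).memLp_dx.restrict (window 1)) hc0
  have h4 : ∫ z in window 1, ‖(w n).dx z‖ ^ 2 ∂(stripMeasure L) ≤ |K| :=
    (setIntegral_le_integral (integrable_norm_sq (w n).memLp_dx)
      (ae_of_all _ fun z => by positivity)).trans
      ((w n).integral_dx_sq_le.trans (hKn.trans (le_abs_self K)))
  have h5 : c⁻¹ * ∫ z in window 1, ‖(w n).dx z‖ ^ 2 ∂(stripMeasure L) ≤ ε := by
    calc _ ≤ c⁻¹ * |K| := by gcongr
      _ ≤ ε := by
        rw [hc, inv_div, div_mul_eq_mul_div, div_le_iff₀ (by positivity)]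
        nlinarith [abs_nonneg K]
  linarith

end Rellich

/-! ### Coercivity, the nonlinear term and scaling -/

section Functional

variable {L : ℝ}

/-- Compare with the square below t₀ and with the fourth power above it. As 2 < q < 4, either
coefficient can be made as small as desired by the choice of t₀. -/
theorem rpow_le_sq_add_pow_four {q t t₀ : ℝ} (hq2 : 2 < q) (hq4 : q < 4) (ht : 0 ≤ t)
    (ht₀ : 0 < t₀) : t ^ q ≤ t₀ ^ (q - 2) * t ^ 2 + t₀ ^ (q - 4) * t ^ 4 := by
  rcases ht.eq_or_lt with rfl | ht'
  · rw [Real.zero_rpow (by linarith)]; positivity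
  rcases le_total t t₀ with h | h
  · have e : t ^ q = t ^ (q - 2) * t ^ 2 := by
      rw [← Real.rpow_natCast t 2, ← Real.rpow_add ht']; norm_num
    have h1 : t ^ (q - 2) ≤ t₀ ^ (q - 2) := Real.rpow_le_rpow ht h (by linarith)
    have h2 : 0 ≤ t₀ ^ (q - 4) * t ^ 4 := by positivity
    rw [e]
    nlinarith [mul_le_mul_of_nonneg_right h1 (sq_nonneg t)]
  · have e : t ^ q = t ^ (q - 4) * t ^ 4 := by
      rw [← Real.rpow_natCast t 4, ← Real.rpow_add ht']; norm_num
    have h1 : t ^ (q - 4) ≤ t₀ ^ (q - 4) :=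
      Real.rpow_le_rpow_of_nonpos ht₀ h (by linarith)
    have h2 : 0 ≤ t₀ ^ (q - 2) * t ^ 2 := by positivity
    rw [e]
    nlinarith [mul_le_mul_of_nonneg_right h1 (by positivity : 0 ≤ t ^ 4)]

theorem exists_rpow_sub_two_eq {q δ : ℝ} (hq : 2 < q) (hδ : 0 < δ) :
    ∃ t₀ : ℝ, 0 < t₀ ∧ t₀ ^ (q - 2) = δ :=
  ⟨δ ^ (q - 2)⁻¹, by positivity, by
    rw [← Real.rpow_mul hδ.le, inv_mul_cancel₀ (by linarith), Real.rpow_one]⟩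

theorem exists_rpow_sub_four_eq {q δ : ℝ} (hq : q < 4) (hδ : 0 < δ) :
    ∃ t₀ : ℝ, 0 < t₀ ∧ t₀ ^ (q - 4) = δ :=
  ⟨δ ^ (q - 4)⁻¹, by positivity, by
    rw [← Real.rpow_mul hδ.le, inv_mul_cancel₀ (by linarith), Real.rpow_one]⟩

/-- If |w| ≤ η|z|, the sum is at most (1 + η)|z|; otherwise |z| ≤ |w|/η and a multiple of |w|
suffices. This crude inequality replaces the Brezis-Lieb lemma in the splitting of the nonlinear
term. -/
theorem exists_add_rpow_le {q ε : ℝ} (hq : 0 < q) (hε : 0 < ε) :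
    ∃ C : ℝ, 0 ≤ C ∧ ∀ z w : ℂ, ‖z + w‖ ^ q ≤ (1 + ε) * ‖z‖ ^ q + C * ‖w‖ ^ q := by
  have h1 : Tendsto (fun η : ℝ => (1 + η) ^ q) (𝓝[>] 0) (𝓝 1) := by
    have : ContinuousAt (fun η : ℝ => (1 + η) ^ q) 0 :=
      ContinuousAt.rpow_const (by fun_prop) (Or.inl (by norm_num))
    have h := this.tendsto
    simp only [add_zero, Real.one_rpow] at h
    exact h.mono_left nhdsWithin_le_nhds
  obtain ⟨η, hη, hη0⟩ := ((h1.eventually_lt_const (show (1 : ℝ) < 1 + ε by linarith)).and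
    self_mem_nhdsWithin).exists
  have hη0 : 0 < η := hη0
  refine ⟨(η⁻¹ + 1) ^ q, by positivity, fun z w => ?_⟩
  have hadd := norm_add_le z w
  rcases le_total ‖w‖ (η * ‖z‖) with h | h
  · have h2 : ‖z + w‖ ^ q ≤ ((1 + η) * ‖z‖) ^ q :=
      Real.rpow_le_rpow (norm_nonneg _) (by linarith) hq.le
    rw [Real.mul_rpow (by positivity) (norm_nonneg _)] at h2
    have h3 : (1 + η) ^ q * ‖z‖ ^ q ≤ (1 + ε) * ‖z‖ ^ q := by gcongr
    have h4 : 0 ≤ (η⁻¹ + 1) ^ q * ‖w‖ ^ q := by positivity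
    linarith
  · have h5 : ‖z‖ ≤ η⁻¹ * ‖w‖ := by
      rw [inv_mul_eq_div, le_div_iff₀ hη0]; linarith
    have h2 : ‖z + w‖ ^ q ≤ ((η⁻¹ + 1) * ‖w‖) ^ q :=
      Real.rpow_le_rpow (norm_nonneg _) (by linarith) hq.le
    rw [Real.mul_rpow (by positivity) (norm_nonneg _)] at h2
    have h4 : 0 ≤ (1 + ε) * ‖z‖ ^ q := by positivity
    linarith

/-- The integral of `|u|^q` over the strip. -/
noncomputable def H1.powInt (q : ℝ) (u : H1 L) : ℝ := ∫ z, ‖u z‖ ^ q ∂(stripMeasure L)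

theorem H1.powInt_nonneg (q : ℝ) (u : H1 L) : 0 ≤ u.powInt q :=
  integral_nonneg fun _ => by positivity

theorem energy_eq (γ p : ℝ) (u : H1 L) : energy γ p u =
    1 / 2 * u.gradSq + γ / 2 * u.traceSq - 1 / (p + 1) * u.powInt (p + 1) := rfl

theorem sq_integral_norm_mul_le {f g : ℝ × ℝ → ℂ} {μ : Measure (ℝ × ℝ)} (hf : MemLp f 2 μ)
    (hg : MemLp g 2 μ) :
    (∫ z, ‖f z‖ * ‖g z‖ ∂μ) ^ 2 ≤ (∫ z, ‖f z‖ ^ 2 ∂μ) * ∫ z, ‖g z‖ ^ 2 ∂μ := by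
  have h0 : 0 ≤ ∫ z, ‖f z‖ * ‖g z‖ ∂μ := integral_nonneg fun _ => by positivity
  have hf0 : 0 ≤ ∫ z, ‖f z‖ ^ 2 ∂μ := integral_nonneg fun _ => by positivity
  have hg0 : 0 ≤ ∫ z, ‖g z‖ ^ 2 ∂μ := integral_nonneg fun _ => by positivity
  have key : ∀ c : ℝ, 0 ≤ (∫ z, ‖f z‖ ^ 2 ∂μ) * (c * c) +
      (-(2 * ∫ z, ‖f z‖ * ‖g z‖ ∂μ)) * c + ∫ z, ‖g z‖ ^ 2 ∂μ := by
    intro c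
    rcases le_or_gt c 0 with hc | hc
    · nlinarith [mul_nonneg h0 (neg_nonneg.2 hc), mul_nonneg hf0 (mul_self_nonneg c)]
    · have h1 := mul_le_mul_of_nonneg_left (two_mul_integral_norm_mul_le hf hg hc) hc.le
      rw [mul_add, ← mul_assoc c c⁻¹, mul_inv_cancel₀ hc.ne', one_mul] at h1
      linarith
  have := discrim_le_zero key
  rw [discrim] at this
  nlinarith

theorem H1.integrable_pow_four (u : H1 L) (hL : 0 < L) :
    Integrable (fun z => ‖u z‖ ^ 4) (stripMeasure L) :=
  (u.integral_pow_four_le hL (u.traceSq_translate_le hL)).1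

/-- Cauchy-Schwarz turns the products of u with ∂ₓu and ∂ᵧu into mass times gradient. The bound is
linear in the gradient, so a small quartic coefficient suffices for coercivity. -/
theorem H1.integral_pow_four_le_gradSq (u : H1 L) (hL : 0 < L) :
    ∫ z, ‖u z‖ ^ 4 ∂(stripMeasure L) ≤ 3 * mass u * u.gradSq + mass u ^ 2 / L ^ 2 := by
  have h1 := (u.integral_pow_four_le hL (u.traceSq_translate_le hL)).2
  have h2 := sq_integral_norm_mul_le u.memLp_toFun u.memLp_dx
  have h3 := sq_integral_norm_mul_le u.memLp_toFun u.memLp_dy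
  have h4 := mul_le_mul_of_nonneg_left u.integral_dx_sq_le (mass_nonneg u)
  have h5 := mul_le_mul_of_nonneg_left u.integral_dy_sq_le (mass_nonneg u)
  set s := ∫ z, ‖u z‖ * ‖u.dx z‖ ∂(stripMeasure L)
  set r := ∫ z, ‖u z‖ * ‖u.dy z‖ ∂(stripMeasure L)
  have e : ∫ z, ‖u z‖ ^ 2 ∂(stripMeasure L) = mass u := rfl
  rw [e] at h2 h3
  have e2 : mass u ^ 2 / L ^ 2 = (L⁻¹ * mass u) ^ 2 := by field_simp
  rw [e2]
  have h6 := mul_nonneg (mass_nonneg u) u.gradSq_nonneg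
  nlinarith [sq_nonneg (s - L⁻¹ * mass u), sq_nonneg (s - r), sq_nonneg (L⁻¹ * mass u)]

theorem H1.integrable_rpow (u : H1 L) (hL : 0 < L) {q : ℝ} (hq2 : 2 < q) (hq4 : q < 4) :
    Integrable (fun z => ‖u z‖ ^ q) (stripMeasure L) := by
  refine ((integrable_norm_sq u.memLp_toFun).add (u.integrable_pow_four hL)).mono'
    (u.memLp_toFun.1.norm.aemeasurable.pow_const q).aestronglyMeasurable (ae_of_all _ fun z => ?_)
  rw [Real.norm_of_nonneg (by positivity)]
  simpa using rpow_le_sq_add_pow_four hq2 hq4 (norm_nonneg (u z)) one_pos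

theorem H1.setIntegral_rpow_le (u : H1 L) (hL : 0 < L) {q t₀ : ℝ} (hq2 : 2 < q) (hq4 : q < 4)
    (ht₀ : 0 < t₀) (s : Set (ℝ × ℝ)) :
    ∫ z in s, ‖u z‖ ^ q ∂(stripMeasure L) ≤
      t₀ ^ (q - 2) * (∫ z in s, ‖u z‖ ^ 2 ∂(stripMeasure L)) +
        t₀ ^ (q - 4) * ∫ z in s, ‖u z‖ ^ 4 ∂(stripMeasure L) := by
  have i1 := (integrable_norm_sq u.memLp_toFun).integrableOn (s := s)
  have i2 := (u.integrable_pow_four hL).integrableOn (s := s)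
  rw [← integral_const_mul, ← integral_const_mul,
    ← integral_add (i1.const_mul _) (i2.const_mul _)]
  exact integral_mono (u.integrable_rpow hL hq2 hq4).integrableOn
    ((i1.const_mul _).add (i2.const_mul _))
    fun z => rpow_le_sq_add_pow_four hq2 hq4 (norm_nonneg _) ht₀

theorem H1.powInt_le (u : H1 L) (hL : 0 < L) {q t₀ : ℝ} (hq2 : 2 < q) (hq4 : q < 4)
    (ht₀ : 0 < t₀) :
    u.powInt q ≤ t₀ ^ (q - 2) * mass u +
        t₀ ^ (q - 4) * ∫ z, ‖u z‖ ^ 4 ∂(stripMeasure L) := by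
  have := u.setIntegral_rpow_le hL hq2 hq4 ht₀ univ
  simp only [Measure.restrict_univ] at this
  exact this

/-- The energy is coercive on functions of bounded mass. -/
theorem exists_gradSq_le_energy (hL : 0 < L) {γ p : ℝ} (hγ : γ < 0) (hp : 1 < p) (hp3 : p < 3)
    {m : ℝ} (hm : 0 < m) :
    ∃ C : ℝ, ∀ u : H1 L, mass u = m → 1 / 4 * u.gradSq ≤ energy γ p u + C := by
  -- The coefficient 1/(24m) makes the quartic term cost 1/8 of the gradient. The weight -2γ below
  -- makes the trace cost another 1/8, leaving 1/2 - 1/8 - 1/8 = 1/4.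
  obtain ⟨t₀, ht₀, ht⟩ := exists_rpow_sub_four_eq (q := p + 1) (by linarith)
    (show 0 < 1 / (24 * m) by positivity)
  refine ⟨γ ^ 2 / 2 * m + t₀ ^ (p + 1 - 2) * m + 1 / (24 * m) * (m ^ 2 / L ^ 2),
    fun u hu => ?_⟩
  have h1 := u.powInt_le hL (q := p + 1) (by linarith) (by linarith) ht₀
  have h2 := u.integral_pow_four_le_gradSq hL
  have h3 := u.traceSq_le
  have h4 := two_mul_integral_norm_mul_le u.memLp_toFun u.memLp_dx
    (c := -2 * γ) (by linarith)
  have h5 := u.integral_dx_sq_le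
  have e : ∫ z, ‖u z‖ ^ 2 ∂(stripMeasure L) = m := hu
  rw [e] at h4
  rw [hu] at h1 h2
  rw [ht] at h1
  have h6 := mul_le_mul_of_nonneg_left h4 (by linarith : 0 ≤ -γ / 4)
  have e1 : -γ / 4 * (-2 * γ * m + (-2 * γ)⁻¹ * ∫ z, ‖u.dx z‖ ^ 2 ∂(stripMeasure L)) =
      γ ^ 2 / 2 * m + 1 / 8 * ∫ z, ‖u.dx z‖ ^ 2 ∂(stripMeasure L) := by
    have : γ ≠ 0 := hγ.ne
    field_simp
    ring
  rw [e1] at h6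
  have h7 := mul_le_mul_of_nonneg_left h3 (by linarith : 0 ≤ -γ / 2)
  have h8 := mul_le_mul_of_nonneg_left h2 (by positivity : 0 ≤ 1 / (24 * m))
  have e2 : 1 / (24 * m) * (3 * m * u.gradSq + m ^ 2 / L ^ 2) =
      1 / 8 * u.gradSq + 1 / (24 * m) * (m ^ 2 / L ^ 2) := by
    field_simp
    ring
  rw [e2] at h8
  have h9 : 1 / (p + 1) * u.powInt (p + 1) ≤ u.powInt (p + 1) := by
    have : 1 / (p + 1) ≤ 1 := by rw [div_le_one (by linarith)]; linarith
    nlinarith [u.powInt_nonneg (p + 1)]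
  rw [energy_eq]
  linarith

/-- Functions with small cross sections have a small `L^q` norm. -/
theorem exists_powInt_le_of_traceSq_le (hL : 0 < L) {q : ℝ} (hq2 : 2 < q) (hq4 : q < 4)
    {m K ε : ℝ} (hm : 0 < m) (hK : 0 < K) (hε : 0 < ε) :
    ∃ c : ℝ, 0 < c ∧ ∀ u : H1 L, mass u = m → u.gradSq ≤ K →
      (∀ a, (u.translate hL a).traceSq ≤ c) → u.powInt q ≤ ε := by
  -- First t₀ makes the quadratic part ε/2. Then c makes the quartic part at most ε/2, because
  -- Ladyzhenskaya's bound is proportional to the size of the cross sections.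
  obtain ⟨t₀, ht₀, ht⟩ := exists_rpow_sub_two_eq hq2 (show 0 < ε / (2 * m) by positivity)
  set A := t₀ ^ (q - 4) * (L⁻¹ * m + (m + K)) with hA
  have hA0 : 0 < A := by positivity
  refine ⟨ε / (2 * A), by positivity, fun u hu huK hc => ?_⟩
  have h1 := u.powInt_le hL hq2 hq4 ht₀
  have h2 := (u.integral_pow_four_le hL hc).2
  have h3 := two_mul_integral_norm_mul_le u.memLp_toFun u.memLp_dy one_pos
  have h4 := u.integral_dy_sq_le
  have e : ∫ z, ‖u z‖ ^ 2 ∂(stripMeasure L) = m := hu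
  rw [e, one_mul, inv_one, one_mul] at h3
  rw [ht, hu] at h1
  rw [hu] at h2
  have h5 : t₀ ^ (q - 4) * ∫ z, ‖u z‖ ^ 4 ∂(stripMeasure L) ≤
      t₀ ^ (q - 4) * (ε / (2 * A) * (L⁻¹ * m + (m + K))) := by
    gcongr
    refine h2.trans ?_
    gcongr
    linarith
  have e5 : t₀ ^ (q - 4) * (ε / (2 * A) * (L⁻¹ * m + (m + K))) = ε / 2 := by
    have : t₀ ^ (q - 4) * (ε / (2 * A) * (L⁻¹ * m + (m + K))) = ε / (2 * A) * A := by
      rw [hA]; ring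
    rw [this]; field_simp
  have e6 : ε / (2 * m) * m = ε / 2 := by field_simp
  linarith

/-- The multiple `c u`. -/
noncomputable def H1.scale (c : ℝ) (u : H1 L) : H1 L := (H1.zero L).addSMul c u

theorem H1.scale_apply (c : ℝ) (u : H1 L) (z : ℝ × ℝ) : u.scale c z = c • u z := zero_add _

theorem mass_scale (c : ℝ) (u : H1 L) : mass (u.scale c) = c ^ 2 * mass u := by
  rw [mass, mass, ← integral_const_mul]
  congr 1; ext z
  rw [H1.scale_apply, norm_smul, mul_pow, Real.norm_eq_abs, sq_abs]

theorem H1.gradSq_scale (c : ℝ) (u : H1 L) : (u.scale c).gradSq = c ^ 2 * u.gradSq := by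
  rw [gradSq, gradSq, ← integral_const_mul]
  congr 1; ext z
  have e1 : (u.scale c).dx z = c • u.dx z := zero_add _
  have e2 : (u.scale c).dy z = c • u.dy z := zero_add _
  rw [e1, e2, norm_smul, norm_smul, mul_pow, mul_pow, Real.norm_eq_abs, sq_abs]
  ring

theorem H1.trace_scale (c : ℝ) (u : H1 L) :
    ∀ᵐ y ∂(sectionMeasure L), trace (u.scale c) y = c • trace u y := by
  filter_upwards [(H1.zero L).trace_addSMul u c] with y hy
  rw [H1.scale, hy, H1.trace_zero, zero_add]

theorem H1.traceSq_scale (c : ℝ) (u : H1 L) : (u.scale c).traceSq = c ^ 2 * u.traceSq := by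
  rw [traceSq, traceSq, ← integral_const_mul]
  refine integral_congr_ae ?_
  filter_upwards [u.trace_scale c] with y hy
  rw [hy, norm_smul, mul_pow, Real.norm_eq_abs, sq_abs]

theorem H1.powInt_scale {c : ℝ} (hc : 0 ≤ c) (q : ℝ) (u : H1 L) :
    (u.scale c).powInt q = c ^ q * u.powInt q := by
  rw [powInt, powInt, ← integral_const_mul]
  congr 1; ext z
  rw [H1.scale_apply, norm_smul, Real.norm_of_nonneg hc, Real.mul_rpow hc (norm_nonneg _)]

theorem energy_scale {c : ℝ} (hc : 0 ≤ c) (γ p : ℝ) (u : H1 L) :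
    energy γ p (u.scale c) = c ^ 2 * (1 / 2 * u.gradSq + γ / 2 * u.traceSq) -
      1 / (p + 1) * (c ^ (p + 1) * u.powInt (p + 1)) := by
  rw [energy_eq, H1.gradSq_scale, H1.traceSq_scale, H1.powInt_scale hc]
  ring

theorem ae_eq_zero_of_mass_eq_zero {u : H1 L} (h : mass u = 0) :
    ∀ᵐ z ∂(stripMeasure L), u z = 0 := by
  rw [mass, integral_eq_zero_iff_of_nonneg (fun _ => by positivity)
    (integrable_norm_sq u.memLp_toFun)] at h
  filter_upwards [h] with z hz
  simpa using hz

theorem traceSq_eq_zero_of_mass_eq_zero {u : H1 L} (h : mass u = 0) : u.traceSq = 0 := by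
  refine le_antisymm (u.traceSq_le.trans_eq ?_) u.traceSq_nonneg
  refine integral_eq_zero_of_ae ?_
  filter_upwards [ae_eq_zero_of_mass_eq_zero h] with z hz
  simp [hz]

theorem powInt_eq_zero_of_mass_eq_zero {u : H1 L} (h : mass u = 0) {q : ℝ} (hq : 0 < q) :
    u.powInt q = 0 := by
  refine integral_eq_zero_of_ae ?_
  filter_upwards [ae_eq_zero_of_mass_eq_zero h] with z hz
  simp [hz, Real.zero_rpow hq.ne']

theorem H1.powInt_pos {u : H1 L} (hL : 0 < L) (h : 0 < mass u) {q : ℝ} (hq2 : 2 < q)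
    (hq4 : q < 4) : 0 < u.powInt q := by
  refine lt_of_le_of_ne (u.powInt_nonneg q) fun h0 => h.ne' ?_
  have h1 := (integral_eq_zero_iff_of_nonneg (fun _ => by positivity)
    (u.integrable_rpow hL hq2 hq4)).1 h0.symm
  refine integral_eq_zero_of_ae ?_
  filter_upwards [h1] with z hz
  have hz' : ‖u z‖ ^ q = 0 := hz
  rw [Real.rpow_eq_zero (norm_nonneg _) (by linarith)] at hz'
  simp [hz']

end Functional

/-! ### The bound state exp(-k|x|) of the delta potential -/

section Exponential

variable {L : ℝ}

theorem integrable_exp_neg_mul_abs {k : ℝ} (hk : 0 < k) :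
    Integrable (fun x : ℝ => Real.exp (-k * |x|)) := by
  have h1 : IntegrableOn (fun x : ℝ => Real.exp (-k * |x|)) (Ioi 0) :=
    (integrableOn_exp_mul_Ioi (a := -k) (by linarith) 0).congr_fun
      (fun x hx => by simp only [abs_of_pos (mem_Ioi.1 hx)]) measurableSet_Ioi
  have h2 : IntegrableOn (fun x : ℝ => Real.exp (-k * |x|)) (Iic 0) :=
    (integrableOn_exp_mul_Iic (a := k) hk 0).congr_fun
      (fun x hx => by simp only [abs_of_nonpos (mem_Iic.1 hx)]; ring_nf) measurableSet_Iic
  rw [← integrableOn_univ, ← Iic_union_Ioi (a := (0 : ℝ))]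
  exact h2.union h1

theorem abs_exp_sub_exp_le {s t : ℝ} (hs : s ≤ 0) (ht : t ≤ 0) :
    |Real.exp s - Real.exp t| ≤ |s - t| := by
  have key : ∀ {s t : ℝ}, s ≤ t → t ≤ 0 → Real.exp t - Real.exp s ≤ t - s := by
    intro s t hst ht
    have h1 := Real.add_one_le_exp (s - t)
    have h2 : Real.exp s = Real.exp t * Real.exp (s - t) := by rw [← Real.exp_add]; ring_nf
    have h3 : Real.exp t ≤ 1 := Real.exp_le_one_iff.2 ht
    have h4 := Real.exp_pos t
    rw [h2]; nlinarith
  rcases le_total s t with h | h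
  · rw [abs_sub_comm, abs_sub_comm s, abs_of_nonneg (sub_nonneg.2 (Real.exp_le_exp.2 h)),
      abs_of_nonneg (sub_nonneg.2 h)]
    exact key h ht
  · rw [abs_of_nonneg (sub_nonneg.2 (Real.exp_le_exp.2 h)), abs_of_nonneg (sub_nonneg.2 h)]
    exact key h hs

theorem primitiveOn_exp_neg_mul_abs {k : ℝ} (hk : 0 < k) :
    PrimitiveOn univ (fun x : ℝ => Real.exp (-k * |x|))
      (fun x => -k * SignType.sign x * Real.exp (-k * |x|)) := by
  have h := PrimitiveOn.of_hasDerivAt (E := ℝ) (F := fun x => x) (g := fun _ => 1)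
    (fun x => hasDerivAt_id x) continuous_const
  refine h.comp_of_dist_le ordConnected_univ (s := univ) (K := k)
    (G := fun x => Real.exp (-k * |x|)) (fun _ _ => mem_univ _) (fun s _ t _ => ?_)
    fun x _ _ hd => ?_
  · refine (abs_exp_sub_exp_le ?_ ?_).trans ?_
    · have := abs_nonneg s; nlinarith
    · have := abs_nonneg t; nlinarith
    · rw [← mul_sub, abs_mul, abs_neg, abs_of_pos hk, Real.norm_eq_abs]
      exact mul_le_mul_of_nonneg_left (abs_abs_sub_abs_le s t) hk.le
  · rcases eq_or_ne x 0 with rfl | hx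
    -- At the kink the value sign 0 = 0 is harmless: the function has a maximum there, so a
    -- derivative, if it existed, would be zero.
    · have hmax : IsLocalMax (fun x : ℝ => Real.exp (-k * |x|)) 0 :=
        Eventually.of_forall fun y => Real.exp_le_exp.2 (by
          have := abs_nonneg y; simp only [abs_zero]; nlinarith)
      have := hmax.hasDerivAt_eq_zero hd.hasDerivAt
      have h0 := hd.hasDerivAt
      rw [this] at h0
      convert! h0 using 1
      simp
    · have := ((hasDerivAt_abs hx).const_mul (-k)).exp
      convert! this using 1
      ring

theorem abs_sign_mul_exp_le {k : ℝ} (hk : 0 < k) (x : ℝ) :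
    |-k * SignType.sign x * Real.exp (-k * |x|)| ≤ k * Real.exp (-k * |x|) := by
  rw [abs_mul, abs_mul, abs_neg, abs_of_pos hk, Real.abs_exp]
  have : |((SignType.sign x : SignType) : ℝ)| ≤ 1 := by
    rcases lt_trichotomy x 0 with h | h | h <;> simp [h]
  have h2 := Real.exp_pos (-k * |x|)
  calc k * |((SignType.sign x : SignType) : ℝ)| * Real.exp (-k * |x|) ≤
      k * 1 * Real.exp (-k * |x|) := by gcongr
    _ = _ := by ring

theorem memLp_exp_neg_mul_abs (L : ℝ) {k : ℝ} (hk : 0 < k) :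
    MemLp (fun z : ℝ × ℝ => (Real.exp (-k * |z.1|) : ℂ)) 2 (stripMeasure L) := by
  rw [memLp_two_iff_integrable_sq_norm (by fun_prop), stripMeasure_eq_prod]
  have : IsFiniteMeasure (sectionMeasure L) := by rw [sectionMeasure]; infer_instance
  have h := (integrable_exp_neg_mul_abs (k := 2 * k) (by linarith)).comp_fst (sectionMeasure L)
  refine h.congr (ae_of_all _ fun z => ?_)
  simp only [Complex.norm_real, Real.norm_eq_abs, Real.abs_exp]
  rw [← Real.exp_nat_mul]
  push_cast; ring_nf

theorem memLp_sign_mul_exp (L : ℝ) {k : ℝ} (hk : 0 < k) :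
    MemLp (fun z : ℝ × ℝ => ((-k * SignType.sign z.1 * Real.exp (-k * |z.1|) : ℝ) : ℂ)) 2
      (stripMeasure L) := by
  refine ((memLp_exp_neg_mul_abs L hk).const_mul (k : ℂ)).mono ?_ (ae_of_all _ fun z => ?_)
  · have : Measurable fun z : ℝ × ℝ => ((SignType.sign z.1 : SignType) : ℝ) := by
      have h : Measurable (fun x : ℝ => ((SignType.sign x : SignType) : ℝ)) := by
        have : Monotone (fun x : ℝ => ((SignType.sign x : SignType) : ℝ)) := by
          intro x y hxy
          rcases lt_trichotomy x 0 with h | h | h <;> rcases lt_trichotomy y 0 with h' | h' | h' <;>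
            simp [h, h'] <;> linarith
        exact this.measurable
      exact h.comp measurable_fst
    exact (by fun_prop : Measurable _).aestronglyMeasurable
  · have := abs_sign_mul_exp_le hk z.1
    rw [Complex.norm_real, Real.norm_eq_abs]
    refine this.trans_eq ?_
    rw [norm_mul, Complex.norm_real, Complex.norm_real, Real.norm_of_nonneg hk.le,
      Real.norm_of_nonneg (Real.exp_pos _).le]

/-- The function `exp (-k |x|)`. -/
noncomputable def H1.expDecay (hL : 0 < L) {k : ℝ} (hk : 0 < k) : H1 L where
  toFun z := (Real.exp (-k * |z.1|) : ℂ)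
  dx z := ((-k * SignType.sign z.1 * Real.exp (-k * |z.1|) : ℝ) : ℂ)
  dy _ := 0
  memLp_toFun := memLp_exp_neg_mul_abs L hk
  memLp_dx := memLp_sign_mul_exp L hk
  memLp_dy := MemLp.zero'
  isWeakDeriv_dx := isWeakDeriv_fst_of_slices (memLp_exp_neg_mul_abs L hk)
    (memLp_sign_mul_exp L hk)
    (ae_of_all _ fun _ => ⟨_, (primitiveOn_exp_neg_mul_abs hk).ofReal, ae_of_all _ fun _ => rfl⟩)
  isWeakDeriv_dy := isWeakDeriv_snd_of_slices hL (memLp_exp_neg_mul_abs L hk) MemLp.zero'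
    (ae_of_all _ fun x => ⟨fun _ => (Real.exp (-k * |x|) : ℂ),
      (PrimitiveOn.of_hasDerivAt (fun _ => hasDerivAt_const _ _)
      continuous_const).mono (subset_univ _), ae_of_all _ fun _ => rfl⟩)

theorem H1.trace_expDecay (hL : 0 < L) {k : ℝ} (hk : 0 < k) (y : ℝ) :
    trace (H1.expDecay hL hk) y = 1 := by
  rw [trace_of_continuous _ _ (by simp only [H1.expDecay]; fun_prop)]
  simp [H1.expDecay]

theorem PrimitiveOn.comp_neg {F g : ℝ → ℂ} (h : PrimitiveOn univ F g) :
    PrimitiveOn univ (fun x => F (-x)) (fun x => -g (-x)) := fun x _ y _ => by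
  obtain ⟨h1, h2⟩ := h (-x) (mem_univ _) (-y) (mem_univ _)
  refine ⟨?_, ?_⟩
  · have := (IntervalIntegrable.iff_comp_neg (f := g) (a := -x) (b := -y)).1 h1
    simp only [neg_neg] at this
    exact this.neg
  · rw [intervalIntegral.integral_neg, intervalIntegral.integral_comp_neg, h2,
      intervalIntegral.integral_symm]

theorem PrimitiveOn.norm_sq_le_integral {F g : ℝ → ℂ} (h : PrimitiveOn univ F g)
    (h1 : Integrable (fun x => ‖F x‖ ^ 2)) (h2 : Integrable (fun x => ‖F x‖ * ‖g x‖)) (x : ℝ) :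
    ‖F x‖ ^ 2 ≤ (∫ t, ‖F t‖ ^ 2) + 2 * ∫ t, ‖F t‖ * ‖g t‖ := by
  have h3 := (h.mono (subset_univ (Icc x (x + 1)))).mul_norm_sq_le
    (left_mem_Icc.2 (by linarith : x ≤ x + 1))
  rw [intervalIntegral.integral_of_le (by linarith), intervalIntegral.integral_of_le (by linarith)]
    at h3
  have h4 := setIntegral_le_integral (s := Ioc x (x + 1)) h1 (ae_of_all _ fun x => by positivity)
  have h5 := setIntegral_le_integral (s := Ioc x (x + 1)) h2 (ae_of_all _ fun x => by positivity)
  simp only [add_sub_cancel_left, one_mul, mul_one] at h3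
  linarith

/-- Integration by parts on (0, n). F is bounded by `norm_sq_le_integral`, so the exponential
removes the boundary term at n in the limit. -/
theorem PrimitiveOn.integral_Ioi_exp_smul {F g : ℝ → ℂ} (h : PrimitiveOn univ F g)
    (h1 : Integrable (fun x => ‖F x‖ ^ 2)) (h2 : Integrable (fun x => ‖F x‖ * ‖g x‖))
    {k : ℝ} (hk : 0 < k) (h3 : Integrable (fun x => Real.exp (-k * |x|) • F x))
    (h4 : Integrable (fun x => Real.exp (-k * |x|) • g x)) :
    ∫ x in Ioi 0, Real.exp (-k * |x|) • g x =
      -F 0 + k • ∫ x in Ioi 0, Real.exp (-k * |x|) • F x := by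
  have l1 := intervalIntegral_tendsto_integral_Ioi (μ := volume) 0 h4.integrableOn
    (tendsto_natCast_atTop_atTop (R := ℝ))
  have l2 := intervalIntegral_tendsto_integral_Ioi (μ := volume) 0 h3.integrableOn
    (tendsto_natCast_atTop_atTop (R := ℝ))
  have e : ∀ n : ℕ, ∫ x in (0 : ℝ)..n, Real.exp (-k * |x|) • g x =
      (Real.exp (-k * |(n : ℝ)|) • F n - F 0) +
        k • ∫ x in (0 : ℝ)..n, Real.exp (-k * |x|) • F x := by
    intro n
    have h5 := ((h.smul ordConnected_univ (primitiveOn_exp_neg_mul_abs hk)) 0 (mem_univ _) n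
      (mem_univ _)).2
    have e1 : ∫ x in (0 : ℝ)..n, (Real.exp (-k * |x|) • g x +
        (-k * SignType.sign x * Real.exp (-k * |x|)) • F x) =
        ∫ x in (0 : ℝ)..n, (Real.exp (-k * |x|) • g x - k • (Real.exp (-k * |x|) • F x)) := by
      refine intervalIntegral.integral_congr_ae (ae_of_all _ fun x hx => ?_)
      rw [uIoc_of_le n.cast_nonneg] at hx
      rw [sign_pos hx.1, smul_smul, sub_eq_add_neg, ← neg_smul]
      simp
    have hs : IntervalIntegrable (fun x => k • (Real.exp (-k * |x|) • F x)) volume 0 n :=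
      h3.intervalIntegrable.smul k
    rw [e1, intervalIntegral.integral_sub h4.intervalIntegrable hs, intervalIntegral.integral_smul] at h5
    simp only [abs_zero, mul_zero, Real.exp_zero, one_smul] at h5
    rw [h5, sub_add_cancel]
  have l3 : Tendsto (fun n : ℕ => Real.exp (-k * |(n : ℝ)|) • F n) atTop (𝓝 0) := by
    have hb : ∀ n : ℕ, ‖Real.exp (-k * |(n : ℝ)|) • F n‖ ≤
        Real.exp (-k * |(n : ℝ)|) * Real.sqrt ((∫ t, ‖F t‖ ^ 2) + 2 * ∫ t, ‖F t‖ * ‖g t‖) := by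
      intro n
      rw [norm_smul, Real.norm_of_nonneg (Real.exp_pos _).le]
      gcongr
      exact Real.le_sqrt_of_sq_le (h.norm_sq_le_integral h1 h2 n)
    refine squeeze_zero_norm hb ?_
    rw [← zero_mul (Real.sqrt ((∫ t, ‖F t‖ ^ 2) + 2 * ∫ t, ‖F t‖ * ‖g t‖))]
    refine Tendsto.mul_const _ (Real.tendsto_exp_atBot.comp ?_)
    simp only [Nat.abs_cast]
    exact tendsto_natCast_atTop_atTop.const_mul_atTop_of_neg (by linarith)
  have l4 := (l3.sub_const (F 0)).add (l2.const_smul k)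
  rw [zero_sub] at l4
  exact tendsto_nhds_unique l1 (l4.congr fun n => (e n).symm)

/-- The half-line identity is applied to F and to its reflection. The sign change of the derivative
at 0 makes the two boundary terms add up, which produces the point source 2k F(0). -/
theorem PrimitiveOn.integral_sign_exp_smul {F g : ℝ → ℂ} (h : PrimitiveOn univ F g)
    (h1 : Integrable (fun x => ‖F x‖ ^ 2)) (h2 : Integrable (fun x => ‖F x‖ * ‖g x‖))
    {k : ℝ} (hk : 0 < k) (h3 : Integrable (fun x => Real.exp (-k * |x|) • F x))
    (h4 : Integrable (fun x => Real.exp (-k * |x|) • g x)) 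
    (h5 : Integrable (fun x => (-k * SignType.sign x * Real.exp (-k * |x|)) • g x)) :
    ∫ x, (-k * SignType.sign x * Real.exp (-k * |x|)) • g x =
      (2 * k) • F 0 - (k ^ 2) • ∫ x, Real.exp (-k * |x|) • F x := by
  have r := h.integral_Ioi_exp_smul h1 h2 hk h3 h4
  have l := h.comp_neg.integral_Ioi_exp_smul (k := k) h1.comp_neg
    (by simpa only [norm_neg] using h2.comp_neg) hk
    (by simpa only [abs_neg] using h3.comp_neg)
    (by simpa only [abs_neg, smul_neg] using h4.comp_neg.fun_neg)
  have e1 : ∫ x in Ioi 0, Real.exp (-k * |x|) • -g (-x) =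
      -∫ x in Iic 0, Real.exp (-k * |x|) • g x := by
    have := integral_comp_neg_Ioi 0 (fun x => Real.exp (-k * |x|) • g x)
    simp only [abs_neg, neg_zero] at this
    simp only [smul_neg]
    rw [integral_neg, this]
  have e2 : ∫ x in Ioi 0, Real.exp (-k * |x|) • F (-x) =
      ∫ x in Iic 0, Real.exp (-k * |x|) • F x := by
    have := integral_comp_neg_Ioi 0 (fun x => Real.exp (-k * |x|) • F x)
    simpa only [abs_neg, neg_zero] using this
  rw [e1, e2, neg_zero] at l
  have s1 : ∫ x in Ioi 0, (-k * SignType.sign x * Real.exp (-k * |x|)) • g x =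
      -k • ∫ x in Ioi 0, Real.exp (-k * |x|) • g x := by
    rw [← integral_smul]
    refine setIntegral_congr_fun measurableSet_Ioi fun x hx => ?_
    simp only [sign_pos (mem_Ioi.1 hx), smul_smul]; simp
  have s2 : ∫ x in Iic 0, (-k * SignType.sign x * Real.exp (-k * |x|)) • g x =
      k • ∫ x in Iic 0, Real.exp (-k * |x|) • g x := by
    rw [integral_Iic_eq_integral_Iio, integral_Iic_eq_integral_Iio, ← integral_smul]
    refine setIntegral_congr_fun measurableSet_Iio fun x hx => ?_
    simp only [sign_neg (mem_Iio.1 hx), smul_smul]; simp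
  rw [← integral_add_compl measurableSet_Iic h5 (s := Iic (0 : ℝ)),
    ← integral_add_compl measurableSet_Iic h3 (s := Iic (0 : ℝ)), compl_Iic, s1, s2, r]
  rw [neg_eq_iff_eq_neg.1 l]
  module

/-- `exp (-k |x|)` is a weak solution of `-∂ₓₓψ - 2 k δ₀ ψ = -k² ψ`. -/
theorem H1.integral_expDecay (u : H1 L) (hL : 0 < L) {k : ℝ} (hk : 0 < k) :
    ∫ z, (H1.expDecay hL hk).dx z * u.dx z ∂(stripMeasure L) =
      2 * k * (∫ y, trace u y ∂(sectionMeasure L)) -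
        k ^ 2 * ∫ z, H1.expDecay hL hk z * u z ∂(stripMeasure L) := by
  have : IsFiniteMeasure (sectionMeasure L) := by rw [sectionMeasure]; infer_instance
  set ψ := H1.expDecay hL hk with hψ
  have i1 := integrable_norm_sq u.memLp_toFun
  have i2 := integrable_norm_mul_norm u.memLp_toFun u.memLp_dx
  have i3 : Integrable (fun z => ψ z * u z) (stripMeasure L) :=
    ψ.memLp_toFun.integrable_mul u.memLp_toFun
  have i4 : Integrable (fun z => ψ z * u.dx z) (stripMeasure L) :=
    ψ.memLp_toFun.integrable_mul u.memLp_dx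
  have i5 : Integrable (fun z => ψ.dx z * u.dx z) (stripMeasure L) :=
    ψ.memLp_dx.integrable_mul u.memLp_dx
  have i6 : Integrable (fun y => trace u y) (sectionMeasure L) :=
    u.memLp_trace.integrable (by norm_num)
  rw [stripMeasure_eq_prod] at i1 i2 i3 i4 i5 ⊢
  rw [integral_prod_symm _ i5, integral_prod_symm _ i3, ← integral_const_mul,
    ← integral_const_mul, ← integral_sub (i6.const_mul _) (i3.integral_prod_right.const_mul _)]
  refine integral_congr_ae ?_
  filter_upwards [u.slice_fst, i1.prod_left_ae, i2.prod_left_ae, i3.prod_left_ae, i4.prod_left_ae,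
    i5.prod_left_ae] with y hy j1 j2 j3 j4 j5
  obtain ⟨F, hF, hFe⟩ := hy
  rw [trace_eq_of_primitiveOn hF hFe]
  rw [Measure.restrict_univ] at hFe
  have key := hF.integral_sign_exp_smul (j1.congr (hFe.mono fun x hx => by simp only [hx]))
    (j2.congr (hFe.mono fun x hx => by simp only [hx])) hk
    (j3.congr (hFe.mono fun x hx => by simp only [hx]; simp [hψ, H1.expDecay]))
    (j4.congr (ae_of_all _ fun x => by simp [hψ, H1.expDecay]))
    (j5.congr (ae_of_all _ fun x => by simp [hψ, H1.expDecay]))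
  have e : ∫ x, ψ (x, y) * u (x, y) = ∫ x, Real.exp (-k * |x|) • F x :=
    integral_congr_ae (hFe.mono fun x hx => by simp only [hx]; simp [hψ, H1.expDecay])
  rw [e]
  simp only [Complex.real_smul] at key ⊢
  refine key.trans ?_
  push_cast; rfl

theorem H1.gradSq_expDecay (hL : 0 < L) {k : ℝ} (hk : 0 < k) :
    (H1.expDecay hL hk).gradSq =
      2 * k * (H1.expDecay hL hk).traceSq - k ^ 2 * mass (H1.expDecay hL hk) := by
  have h := (H1.expDecay hL hk).integral_expDecay hL hk
  have e1 : ∀ z, (H1.expDecay hL hk).dx z * (H1.expDecay hL hk).dx z =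
      ((‖(H1.expDecay hL hk).dx z‖ ^ 2 + ‖(H1.expDecay hL hk).dy z‖ ^ 2 : ℝ) : ℂ) := fun z => by
    simp only [H1.expDecay, Complex.norm_real, norm_zero, Real.norm_eq_abs, sq_abs]
    push_cast; ring
  have e2 : ∀ z, H1.expDecay hL hk z * H1.expDecay hL hk z =
      ((‖H1.expDecay hL hk z‖ ^ 2 : ℝ) : ℂ) := fun z => by
    simp only [H1.expDecay, Complex.norm_real, Real.norm_eq_abs, sq_abs]
    push_cast; ring
  have e3 : ∀ y, trace (H1.expDecay hL hk) y = ((‖trace (H1.expDecay hL hk) y‖ ^ 2 : ℝ) : ℂ) :=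
    fun y => by rw [H1.trace_expDecay]; simp
  simp only [e1, e2] at h
  rw [integral_congr_ae (ae_of_all _ e3), integral_complex_ofReal, integral_complex_ofReal,
    integral_complex_ofReal] at h
  exact_mod_cast h

theorem H1.mass_expDecay_pos (hL : 0 < L) {k : ℝ} (hk : 0 < k) :
    0 < mass (H1.expDecay hL hk) := by
  refine lt_of_le_of_ne (mass_nonneg _) fun h => ?_
  have h1 := traceSq_eq_zero_of_mass_eq_zero h.symm
  rw [traceSq] at h1
  simp only [H1.trace_expDecay] at h1
  simp at h1
  linarith

/-- The ground state energy lies strictly below the bottom of the spectrum. -/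
theorem exists_energy_lt (hL : 0 < L) {γ p m : ℝ} (hγ : γ < 0) (hp : 1 < p) (hp3 : p < 3)
    (hm : 0 < m) : ∃ u : H1 L, mass u = m ∧ energy γ p u < -(γ ^ 2 / 8) * m := by
  -- For this decay rate the quadratic energy is exactly -γ²/8 times the mass, so the nonlinear term
  -- makes the inequality strict.
  have hk : 0 < -γ / 2 := by linarith
  set ψ := H1.expDecay hL hk with hψ
  have hM := H1.mass_expDecay_pos hL hk
  rw [← hψ] at hM
  have hc : 0 < Real.sqrt (m / mass ψ) := Real.sqrt_pos.2 (by positivity)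
  have hmass : mass (ψ.scale (Real.sqrt (m / mass ψ))) = m := by
    rw [mass_scale, Real.sq_sqrt (by positivity)]
    field_simp
  refine ⟨ψ.scale (Real.sqrt (m / mass ψ)), hmass, ?_⟩
  rw [energy_scale hc.le]
  have h1 := H1.gradSq_expDecay hL hk
  rw [← hψ] at h1
  have h2 := H1.powInt_pos hL hM (q := p + 1) (by linarith) (by linarith)
  rw [mass_scale] at hmass
  have h3 : 0 < 1 / (p + 1) * (Real.sqrt (m / mass ψ) ^ (p + 1) * ψ.powInt (p + 1)) := by
    have : 0 < p + 1 := by linarith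
    positivity
  rw [h1]
  have e : 1 / 2 * (2 * (-γ / 2) * ψ.traceSq - (-γ / 2) ^ 2 * mass ψ) + γ / 2 * ψ.traceSq =
    -(γ ^ 2 / 8) * mass ψ := by ring
  rw [e]
  linear_combination h3 - (γ ^ 2 / 8) * hmass

end Exponential

/-! ### Splitting of the functionals along weakly convergent sequences -/

section Splitting

variable {L : ℝ}

theorem integral_norm_add_neg_smul_sq {μ : Measure (ℝ × ℝ)} {f g : ℝ × ℝ → ℂ} (hf : MemLp f 2 μ)
    (hg : MemLp g 2 μ) : (∫ z, ‖f z‖ ^ 2 ∂μ) - ∫ z, ‖f z + (-1 : ℝ) • g z‖ ^ 2 ∂μ =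
      2 * (∫ z, star (g z) * f z ∂μ).re - ∫ z, ‖g z‖ ^ 2 ∂μ := by
  have i1 := integrable_norm_sq hf
  have i2 := integrable_norm_sq hg
  have i3 : Integrable (fun z => star (g z) * f z) μ := hg.star.integrable_mul hf
  have i4 : Integrable (fun z => (star (g z) * f z).re) μ := Complex.reCLM.integrable_comp i3
  have e : ∀ z, ‖f z + (-1 : ℝ) • g z‖ ^ 2 =
      ‖f z‖ ^ 2 - 2 * (star (g z) * f z).re + ‖g z‖ ^ 2 := fun z => by
    rw [neg_one_smul]
    simp only [← Complex.normSq_eq_norm_sq, Complex.normSq_apply, Complex.add_re, Complex.add_im,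
      Complex.mul_re, Complex.star_def, Complex.conj_re, Complex.conj_im, Complex.neg_re,
      Complex.neg_im]
    ring
  have e2 : (∫ z, star (g z) * f z ∂μ).re = ∫ z, (star (g z) * f z).re ∂μ :=
    (Complex.reCLM.integral_comp_comm i3).symm
  simp only [e]
  have i5 : Integrable (fun z => ‖f z‖ ^ 2 - 2 * (star (g z) * f z).re) μ :=
    i1.sub (i4.const_mul 2)
  rw [integral_add i5 i2, integral_sub i1 (i4.const_mul 2),
    integral_const_mul, e2]
  ring

/-- Expanding the square, ‖f‖² - ‖f - g‖² = 2 Re⟨g, f⟩ - ‖g‖² is affine in f, so weak convergence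
suffices. -/
theorem tendsto_integral_norm_sq_sub {μ : Measure (ℝ × ℝ)} {l : Filter ℕ} {f : ℕ → ℝ × ℝ → ℂ}
    {g : ℝ × ℝ → ℂ} (hf : ∀ n, MemLp (f n) 2 μ) (hg : MemLp g 2 μ)
    (h : ∀ φ, MemLp φ 2 μ → Tendsto (fun n => ∫ z, φ z * f n z ∂μ) l (𝓝 (∫ z, φ z * g z ∂μ))) :
    Tendsto (fun n => (∫ z, ‖f n z‖ ^ 2 ∂μ) - ∫ z, ‖f n z + (-1 : ℝ) • g z‖ ^ 2 ∂μ) l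
      (𝓝 (∫ z, ‖g z‖ ^ 2 ∂μ)) := by
  simp only [integral_norm_add_neg_smul_sq (hf _) hg]
  have h1 := (((Complex.continuous_re.tendsto _).comp (h _ hg.star)).const_mul 2).sub_const
    (∫ z, ‖g z‖ ^ 2 ∂μ)
  have e : (∫ z, star g z * g z ∂μ).re = ∫ z, ‖g z‖ ^ 2 ∂μ := by
    have e1 : ∀ z, star g z * g z = ((‖g z‖ ^ 2 : ℝ) : ℂ) := fun z => by
      rw [Pi.star_apply, Complex.star_def, Complex.conj_mul']; push_cast; rfl
    simp only [e1]
    rw [integral_complex_ofReal, Complex.ofReal_re]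
  rw [e] at h1
  convert! h1 using 2
  ring

theorem H1.gradSq_eq_add (u : H1 L) : u.gradSq = (∫ z, ‖u.dx z‖ ^ 2 ∂(stripMeasure L)) +
    ∫ z, ‖u.dy z‖ ^ 2 ∂(stripMeasure L) :=
  integral_add (integrable_norm_sq u.memLp_dx) (integrable_norm_sq u.memLp_dy)

theorem norm_add_sq_le (z w : ℂ) {η : ℝ} (hη : 0 < η) :
    ‖z + w‖ ^ 2 ≤ (1 + η) * ‖z‖ ^ 2 + (1 + η⁻¹) * ‖w‖ ^ 2 := by
  have h1 : ‖z + w‖ ^ 2 ≤ (‖z‖ + ‖w‖) ^ 2 := by gcongr; exact norm_add_le z w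
  have h2 : 0 ≤ η⁻¹ * (η * ‖z‖ - ‖w‖) ^ 2 := by positivity
  have e : η⁻¹ * (η * ‖z‖ - ‖w‖) ^ 2 = η * ‖z‖ ^ 2 - 2 * (‖z‖ * ‖w‖) + η⁻¹ * ‖w‖ ^ 2 := by
    field_simp; ring
  rw [e] at h2
  linarith

theorem H1.traceSq_le_add (u v : H1 L) {η : ℝ} (hη : 0 < η) :
    u.traceSq ≤ (1 + η) * v.traceSq + (1 + η⁻¹) * (u.addSMul (-1) v).traceSq := by
  have i1 := (u.traceSq_window one_pos).1
  have i2 := (v.traceSq_window one_pos).1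
  have i3 := ((u.addSMul (-1) v).traceSq_window one_pos).1
  rw [sectionMeasure] at i1 i2 i3
  rw [traceSq, traceSq, traceSq, ← integral_const_mul, ← integral_const_mul,
    ← integral_add (i2.const_mul _) (i3.const_mul _)]
  refine integral_mono_ae i1 ((i2.const_mul _).add (i3.const_mul _)) ?_
  filter_upwards [u.trace_addSMul v (-1)] with y hy
  have := norm_add_sq_le (trace v y) (trace (u.addSMul (-1) v) y) hη
  rw [hy] at this ⊢
  convert! this using 2
  rw [neg_one_smul, add_neg_cancel_comm_assoc]

/-- This half of the convergence of traces serves twice: it passes the lower bound on the traces to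
the weak limit, and, as γ < 0, it bounds the trace energy from below. -/
theorem eventually_traceSq_le {l : Filter ℕ} {u : ℕ → H1 L} {v : H1 L}
    (h : Tendsto (fun n => ((u n).addSMul (-1) v).traceSq) l (𝓝 0)) {ε : ℝ} (hε : 0 < ε) :
    ∀ᶠ n in l, (u n).traceSq ≤ v.traceSq + ε := by
  set η := ε / (2 * (v.traceSq + 1)) with hη
  have hv := v.traceSq_nonneg
  have hη0 : 0 < η := by positivity
  have h1 := h.const_mul (1 + η⁻¹)
  rw [mul_zero] at h1
  filter_upwards [h1.eventually_lt_const (half_pos hε)] with n hn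
  have h2 := (u n).traceSq_le_add v hη0
  have h3 : η * v.traceSq ≤ ε / 2 := by
    rw [hη, div_mul_eq_mul_div, div_le_div_iff₀ (by positivity) two_pos]
    nlinarith
  linarith

theorem tendsto_setIntegral_window {f : ℝ × ℝ → ℝ} (hf : Integrable f (stripMeasure L)) :
    Tendsto (fun n : ℕ => ∫ z in window n, f z ∂(stripMeasure L)) atTop
      (𝓝 (∫ z, f z ∂(stripMeasure L))) := by
  have hU : (⋃ n : ℕ, window n) = univ := by
    refine eq_univ_of_forall fun z => mem_iUnion.2 ?_
    obtain ⟨n, hn⟩ := exists_nat_gt |z.1|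
    exact ⟨n, ⟨(abs_lt.1 hn).1, (abs_lt.1 hn).2.le⟩, mem_univ _⟩
  have := tendsto_setIntegral_of_monotone (μ := stripMeasure L) (f := f)
    (s := fun n : ℕ => window n) (fun n => measurableSet_window _) (fun n m hnm => by
      have : (n : ℝ) ≤ m := by exact_mod_cast hnm
      exact prod_mono (Ioc_subset_Ioc (by linarith) this) le_rfl) hf.integrableOn
  rwa [hU, setIntegral_univ] at this

/-- Interpolation: the L² norm on the window tends to zero by Rellich, while the L⁴ norm stays
bounded and gets a small coefficient. -/
theorem eventually_setIntegral_window_rpow_le (hL : 0 < L) {l : Filter ℕ} {w : ℕ → H1 L} {K : ℝ}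
    (hw : ∀ φ, MemLp φ 2 (stripMeasure L) →
      Tendsto (fun n => ∫ z, φ z * w n z ∂(stripMeasure L)) l (𝓝 0))
    (hM : ∀ᶠ n in l, mass (w n) ≤ K) (hK : ∀ᶠ n in l, (w n).gradSq ≤ K)
    {q : ℝ} (hq2 : 2 < q) (hq4 : q < 4) {R : ℝ} (hR : 0 < R) {ε : ℝ} (hε : 0 < ε) :
    ∀ᶠ n in l, ∫ z in window R, ‖w n z‖ ^ q ∂(stripMeasure L) ≤ ε := by
  set P := 3 * |K| * |K| + |K| ^ 2 / L ^ 2 with hP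
  have hP0 : 0 ≤ P := by positivity
  obtain ⟨t₀, ht₀, ht⟩ := exists_rpow_sub_four_eq hq4 (show 0 < ε / (2 * (P + 1)) by positivity)
  have h1 := (tendsto_integral_window_norm_sq hL hw hK hR).const_mul (t₀ ^ (q - 2))
  rw [mul_zero] at h1
  filter_upwards [h1.eventually_lt_const (half_pos hε), hM, hK] with n h2 h3 h4
  refine ((w n).setIntegral_rpow_le hL hq2 hq4 ht₀ _).trans ?_
  have h5 : ∫ z in window R, ‖w n z‖ ^ 4 ∂(stripMeasure L) ≤ P := by
    refine (setIntegral_le_integral ((w n).integrable_pow_four hL)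
      (ae_of_all _ fun z => by positivity)).trans
      (((w n).integral_pow_four_le_gradSq hL).trans ?_)
    have h3' := h3.trans (le_abs_self K)
    have h4' := h4.trans (le_abs_self K)
    have := mass_nonneg (w n)
    have := (w n).gradSq_nonneg
    rw [hP]
    gcongr
  rw [ht]
  have h6 : ε / (2 * (P + 1)) * (∫ z in window R, ‖w n z‖ ^ 4 ∂(stripMeasure L)) ≤
      ε / (2 * (P + 1)) * (P + 1) := by gcongr; linarith
  have e : ε / (2 * (P + 1)) * (P + 1) = ε / 2 := by field_simp
  linarith

/-- An asymptotic upper bound for the nonlinear term along a weakly convergent sequence. -/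
theorem eventually_powInt_le (hL : 0 < L) {l : Filter ℕ} {u : ℕ → H1 L} {v : H1 L} {K : ℝ}
    (hw : ∀ φ, MemLp φ 2 (stripMeasure L) →
      Tendsto (fun n => ∫ z, φ z * (u n).addSMul (-1) v z ∂(stripMeasure L)) l (𝓝 0))
    (hM : ∀ᶠ n in l, mass ((u n).addSMul (-1) v) ≤ K)
    (hK : ∀ᶠ n in l, ((u n).addSMul (-1) v).gradSq ≤ K)
    {q : ℝ} (hq2 : 2 < q) (hq4 : q < 4) {ε : ℝ} (hε : 0 < ε) :
    ∀ᶠ n in l, (u n).powInt q ≤ v.powInt q + ((u n).addSMul (-1) v).powInt q + ε := by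
  set P := 3 * |K| * |K| + |K| ^ 2 / L ^ 2 with hP
  have hP0 : 0 ≤ P := by positivity
  -- B dominates the nonlinear terms of v and w together, so the relative error ε/(3B) costs at most
  -- ε/3.
  set B := v.powInt q + (|K| + P) + 1 with hB
  have hv0 := v.powInt_nonneg q
  have hB0 : 0 < B := by positivity
  obtain ⟨C, hC0, hC⟩ := exists_add_rpow_le (q := q) (by linarith)
    (show 0 < ε / (3 * B) by positivity)
  have hδ : 0 < ε / (3 * (C + 1)) := by positivity
  have iv := v.integrable_rpow hL hq2 hq4
  obtain ⟨N, hN, hN0⟩ := (((tendsto_setIntegral_window iv).eventually_const_lt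
    (show (∫ z, ‖v z‖ ^ q ∂(stripMeasure L)) - ε / (3 * (C + 1)) < _ by
      exact sub_lt_self _ hδ)).and (eventually_gt_atTop 0)).exists
  have hR : (0 : ℝ) < N := by exact_mod_cast hN0
  filter_upwards [eventually_setIntegral_window_rpow_le hL hw hM hK hq2 hq4 hR hδ, hM, hK]
    with n h1 h2 h3
  set w := (u n).addSMul (-1) v with hwdef
  have iw := w.integrable_rpow hL hq2 hq4
  have iu := (u n).integrable_rpow hL hq2 hq4
  have hms := measurableSet_window (N : ℝ)
  have huw : ∀ z, u n z = v z + w z := fun z => by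
    simp only [hwdef, H1.addSMul]; rw [neg_one_smul, add_neg_cancel_comm_assoc]
  have hPw : w.powInt q ≤ |K| + P := by
    have h4 := w.powInt_le hL hq2 hq4 one_pos
    simp only [Real.one_rpow, one_mul] at h4
    have h5 := w.integral_pow_four_le_gradSq hL
    have h2' := h2.trans (le_abs_self K)
    have h3' := h3.trans (le_abs_self K)
    have h6 : 3 * mass w * w.gradSq + mass w ^ 2 / L ^ 2 ≤ P := by
      have := mass_nonneg w
      have := w.gradSq_nonneg
      rw [hP]
      gcongr
    linarith
  -- Inside the window w is negligible and v is the main part; outside, v is negligible and the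
  -- roles are exchanged. The large constant C only meets the negligible part.
  have a1 : ∫ z in window N, ‖u n z‖ ^ q ∂(stripMeasure L) ≤
      (1 + ε / (3 * B)) * (∫ z in window N, ‖v z‖ ^ q ∂(stripMeasure L)) +
        C * ∫ z in window N, ‖w z‖ ^ q ∂(stripMeasure L) := by
    rw [← integral_const_mul, ← integral_const_mul,
      ← integral_add (iv.integrableOn.const_mul _) (iw.integrableOn.const_mul _)]
    refine integral_mono iu.integrableOn
      ((iv.integrableOn.const_mul _).add (iw.integrableOn.const_mul _)) fun z => ?_
    simp only [huw]
    exact hC _ _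
  have a2 : ∫ z in (window N)ᶜ, ‖u n z‖ ^ q ∂(stripMeasure L) ≤
      (1 + ε / (3 * B)) * (∫ z in (window N)ᶜ, ‖w z‖ ^ q ∂(stripMeasure L)) +
        C * ∫ z in (window N)ᶜ, ‖v z‖ ^ q ∂(stripMeasure L) := by
    rw [← integral_const_mul, ← integral_const_mul,
      ← integral_add (iw.integrableOn.const_mul _) (iv.integrableOn.const_mul _)]
    refine integral_mono iu.integrableOn
      ((iw.integrableOn.const_mul _).add (iv.integrableOn.const_mul _)) fun z => ?_
    simp only [huw, add_comm (v z)]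
    exact hC _ _
  have s1 : (∫ z in window N, ‖u n z‖ ^ q ∂(stripMeasure L)) +
      ∫ z in (window N)ᶜ, ‖u n z‖ ^ q ∂(stripMeasure L) = (u n).powInt q :=
    integral_add_compl hms iu
  have s2 : (∫ z in window N, ‖v z‖ ^ q ∂(stripMeasure L)) +
      ∫ z in (window N)ᶜ, ‖v z‖ ^ q ∂(stripMeasure L) = v.powInt q :=
    integral_add_compl hms iv
  have s3 : (∫ z in window N, ‖w z‖ ^ q ∂(stripMeasure L)) +
      ∫ z in (window N)ᶜ, ‖w z‖ ^ q ∂(stripMeasure L) = w.powInt q :=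
    integral_add_compl hms iw
  have p1 : 0 ≤ ∫ z in (window N)ᶜ, ‖v z‖ ^ q ∂(stripMeasure L) :=
    integral_nonneg fun _ => by positivity
  have p2 : 0 ≤ ∫ z in window N, ‖w z‖ ^ q ∂(stripMeasure L) :=
    integral_nonneg fun _ => by positivity
  have hN' : v.powInt q - ε / (3 * (C + 1)) < ∫ z in window N, ‖v z‖ ^ q ∂(stripMeasure L) := hN
  set V1 := ∫ z in window N, ‖v z‖ ^ q ∂(stripMeasure L)
  set V2 := ∫ z in (window N)ᶜ, ‖v z‖ ^ q ∂(stripMeasure L)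
  set W1 := ∫ z in window N, ‖w z‖ ^ q ∂(stripMeasure L)
  set W2 := ∫ z in (window N)ᶜ, ‖w z‖ ^ q ∂(stripMeasure L)
  have b1 : C * W1 ≤ ε / 3 := by
    calc C * W1 ≤ (C + 1) * (ε / (3 * (C + 1))) := by gcongr; linarith
      _ = ε / 3 := by field_simp
  have b2 : C * V2 ≤ ε / 3 := by
    calc C * V2 ≤ (C + 1) * (ε / (3 * (C + 1))) := by
          gcongr
          · linarith
          · linarith
      _ = ε / 3 := by field_simp
  have b3 : ε / (3 * B) * (V1 + W2) ≤ ε / 3 := by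
    calc ε / (3 * B) * (V1 + W2) ≤ ε / (3 * B) * B := by gcongr; linarith
      _ = ε / 3 := by field_simp
  linarith

end Splitting

/-! ### Existence of a minimizer -/

section Minimizer

variable {L : ℝ}

/-- Scale u up to mass m by θ = √(m / M(u)) ≥ 1. The quadratic part is multiplied by θ² and the
negative nonlinear part by θ^(p+1), so I ≤ θ² E(u), with strict inequality if θ > 1. This is what
excludes splitting of the mass. -/
theorem mul_le_energy_of_mass_le (hL : 0 < L) {γ p m I : ℝ} (hp : 1 < p) (hp3 : p < 3)
    (hm : 0 < m) (hI : ∀ u : H1 L, mass u = m → I ≤ energy γ p u) {u : H1 L}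
    (hu : mass u ≤ m) : mass u / m * I ≤ energy γ p u ∧
      (0 < mass u → mass u < m → mass u / m * I < energy γ p u) := by
  rcases (mass_nonneg u).eq_or_lt with h0 | h0
  · refine ⟨?_, fun h => absurd h0 h.ne⟩
    rw [← h0, energy_eq, traceSq_eq_zero_of_mass_eq_zero h0.symm,
      powInt_eq_zero_of_mass_eq_zero h0.symm (by linarith)]
    have := u.gradSq_nonneg
    simp only [zero_div, zero_mul, mul_zero, add_zero, sub_zero]
    positivity
  set θ := Real.sqrt (m / mass u) with hθ
  have hθ2 : θ ^ 2 = m / mass u := Real.sq_sqrt (by positivity)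
  have hθ0 : 0 < θ := Real.sqrt_pos.2 (by positivity)
  have hθ1 : 1 ≤ θ := by
    rw [hθ, Real.one_le_sqrt, one_le_div h0]; exact hu
  have hs := hI (u.scale θ) (by rw [mass_scale, hθ2]; field_simp)
  rw [energy_scale hθ0.le] at hs
  have hN := H1.powInt_pos hL h0 (q := p + 1) (by linarith) (by linarith)
  have hN' : 0 < 1 / (p + 1) * u.powInt (p + 1) := mul_pos (by positivity) hN
  have hpow : θ ^ 2 ≤ θ ^ (p + 1) := by
    rw [← Real.rpow_natCast]
    exact Real.rpow_le_rpow_of_exponent_le hθ1 (by push_cast; linarith)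
  have hE : I ≤ θ ^ 2 * energy γ p u -
      (θ ^ (p + 1) - θ ^ 2) * (1 / (p + 1) * u.powInt (p + 1)) := by
    rw [energy_eq]; linarith
  have hdiv : mass u / m * (θ ^ 2 * energy γ p u) = energy γ p u := by
    rw [hθ2]; field_simp
  have hMm : 0 < mass u / m := by positivity
  constructor
  · have h1 : I ≤ θ ^ 2 * energy γ p u := by nlinarith
    calc mass u / m * I ≤ mass u / m * (θ ^ 2 * energy γ p u) := by gcongr
      _ = _ := hdiv
  · intro _ hlt
    have hθ1' : 1 < θ := by
      rw [hθ, Real.lt_sqrt one_pos.le, one_pow, one_lt_div h0]; exact hlt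
    have hpow' : θ ^ 2 < θ ^ (p + 1) := by
      rw [← Real.rpow_natCast]
      exact Real.rpow_lt_rpow_of_exponent_lt hθ1' (by push_cast; linarith)
    have h1 : I < θ ^ 2 * energy γ p u := by nlinarith
    calc mass u / m * I < mass u / m * (θ ^ 2 * energy γ p u) := by gcongr
      _ = _ := hdiv

theorem mass_translate (u : H1 L) (hL : 0 < L) (a : ℝ) : mass (u.translate hL a) = mass u :=
  integral_translate L a fun z => ‖u z‖ ^ 2

theorem H1.gradSq_translate (u : H1 L) (hL : 0 < L) (a : ℝ) :
    (u.translate hL a).gradSq = u.gradSq :=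
  integral_translate L a fun z => ‖u.dx z‖ ^ 2 + ‖u.dy z‖ ^ 2

theorem H1.powInt_translate (u : H1 L) (hL : 0 < L) (a q : ℝ) :
    (u.translate hL a).powInt q = u.powInt q :=
  integral_translate L a fun z => ‖u z‖ ^ q

/-- Minimizing sequences may be chosen with traces which do not vanish. -/
theorem exists_le_traceSq (hL : 0 < L) {γ p m I : ℝ} (hγ : γ < 0) (hp : 1 < p) (hp3 : p < 3)
    (hm : 0 < m) (hI : I < -(γ ^ 2 / 8) * m)
    (hI' : ∀ ε > 0, ∃ u : H1 L, mass u = m ∧ energy γ p u < I + ε) :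
    ∃ c > 0, ∃ K : ℝ, ∀ ε > 0, ∃ u : H1 L, mass u = m ∧ energy γ p u < I + ε ∧
      u.gradSq ≤ K ∧ c ≤ u.traceSq := by
  obtain ⟨C, hC⟩ := exists_gradSq_le_energy hL hγ hp hp3 hm
  -- Half the gap between I and the spectral threshold. The energy of a near minimizer is below the
  -- threshold by κ, and only the nonlinear term can account for this.
  set κ := (-(γ ^ 2 / 8) * m - I) / 2 with hκ
  have hκ0 : 0 < κ := by rw [hκ]; linarith
  obtain ⟨c, hc0, hc⟩ := exists_powInt_le_of_traceSq_le hL (q := p + 1) (by linarith)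
    (by linarith) hm (K := |4 * (I + κ + C)| + 1) (by positivity)
    (show 0 < (p + 1) * κ by positivity)
  refine ⟨c, hc0, |4 * (I + κ + C)| + 1, fun ε hε => ?_⟩
  obtain ⟨u, hu, huE⟩ := hI' (min ε κ) (lt_min hε hκ0)
  have h1 : energy γ p u < I + ε := huE.trans_le (by gcongr; exact min_le_left _ _)
  have h2 : energy γ p u < I + κ := huE.trans_le (by gcongr; exact min_le_right _ _)
  have hK : u.gradSq ≤ |4 * (I + κ + C)| + 1 := by
    have := hC u hu
    have := le_abs_self (4 * (I + κ + C))
    linarith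
  have hN : (p + 1) * κ < u.powInt (p + 1) := by
    have h3 := u.neg_mass_le hγ
    rw [hu] at h3
    rw [energy_eq] at h2
    have h4 : κ < 1 / (p + 1) * u.powInt (p + 1) := by linarith
    rwa [one_div, inv_mul_eq_div, lt_div_iff₀' (by linarith)] at h4
  -- Otherwise all cross sections are small and so is the nonlinear term.
  have hex : ∃ a, c < (u.translate hL a).traceSq := by
    by_contra! h
    exact absurd (hc u hu hK h) (not_le.2 hN)
  obtain ⟨a, ha⟩ := hex
  rcases le_total c u.traceSq with h | h
  · exact ⟨u, hu, h1, hK, h⟩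
  -- Here the translation increases the trace and changes nothing else, so it lowers the energy
  -- since γ < 0.
  · refine ⟨u.translate hL a, by rw [mass_translate, hu], lt_of_le_of_lt ?_ h1,
      by rwa [H1.gradSq_translate], ha.le⟩
    rw [energy_eq, energy_eq, H1.gradSq_translate, H1.powInt_translate]
    nlinarith

/-- The delta potential holds the minimizing sequence in place: traces bounded below give a nonzero
weak limit, and strict scaling then forbids any loss of mass. -/
theorem exists_energy_minimizer (hL : 0 < L) {γ p m : ℝ} (hγ : γ < 0) (hp : 1 < p) (hp3 : p < 3)
    (hm : 0 < m) : ∃ v : H1 L, mass v = m ∧ ∀ u : H1 L, mass u = m → energy γ p v ≤ energy γ p u := by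
  obtain ⟨C₀, hC₀⟩ := exists_gradSq_le_energy hL hγ hp hp3 hm
  obtain ⟨u₀, hu₀, hu₀E⟩ := exists_energy_lt hL hγ hp hp3 hm
  set S := {e : ℝ | ∃ v : H1 L, mass v = m ∧ energy γ p v = e} with hS
  have hbdd : BddBelow S := by
    refine ⟨-C₀, ?_⟩
    rintro _ ⟨v, hv, rfl⟩
    have := hC₀ v hv
    have := v.gradSq_nonneg
    linarith
  have hne : S.Nonempty := ⟨_, u₀, hu₀, rfl⟩
  set I := sInf S with hIdef
  have hI : ∀ u : H1 L, mass u = m → I ≤ energy γ p u := fun u hu => csInf_le hbdd ⟨u, hu, rfl⟩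
  have hI' : ∀ ε > 0, ∃ u : H1 L, mass u = m ∧ energy γ p u < I + ε := by
    intro ε hε
    obtain ⟨_, ⟨v, hv, rfl⟩, hlt⟩ := exists_lt_of_csInf_lt hne (lt_add_of_pos_right I hε)
    exact ⟨v, hv, hlt⟩
  obtain ⟨c, hc, K, hK⟩ := exists_le_traceSq hL hγ hp hp3 hm ((hI u₀ hu₀).trans_lt hu₀E) hI'
  choose u hum huE huK huc using fun n : ℕ => hK (1 / ((n : ℝ) + 1)) (by positivity)
  -- A nonprincipal ultrafilter takes the place of successive subsequences.
  set 𝒰 : Ultrafilter ℕ := hyperfilter ℕ with h𝒰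
  obtain ⟨v, hv⟩ := H1.exists_weak_limit 𝒰 (u := u) (C := max m K)
    (fun n => (hum n).le.trans (le_max_left _ _)) (fun n => (huK n).trans (le_max_right _ _))
  set w : ℕ → H1 L := fun n => (u n).addSMul (-1) v with hwdef
  have hw : ∀ φ, MemLp φ 2 (stripMeasure L) →
      Tendsto (fun n => ∫ z, φ z * w n z ∂(stripMeasure L)) 𝒰 (𝓝 0) := by
    intro φ hφ
    have h1 := ((hv φ hφ).1).sub_const (∫ z, φ z * v z ∂(stripMeasure L))
    rw [sub_self] at h1
    refine h1.congr fun n => ?_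
    have i1 : Integrable (fun z => φ z * u n z) (stripMeasure L) :=
      hφ.integrable_mul (u n).memLp_toFun
    have i2 : Integrable (fun z => φ z * v z) (stripMeasure L) :=
      hφ.integrable_mul v.memLp_toFun
    rw [← integral_sub i1 i2]
    congr 1; ext z
    simp only [hwdef, H1.addSMul, neg_one_smul]
    ring
  have hmass : Tendsto (fun n => mass (u n) - mass (w n)) 𝒰 (𝓝 (mass v)) :=
    tendsto_integral_norm_sq_sub (fun n => (u n).memLp_toFun) v.memLp_toFun
      fun φ hφ => (hv φ hφ).1
  have hgrad : Tendsto (fun n => (u n).gradSq - (w n).gradSq) 𝒰 (𝓝 v.gradSq) := by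
    have h1 := tendsto_integral_norm_sq_sub (fun n => (u n).memLp_dx) v.memLp_dx
      fun φ hφ => (hv φ hφ).2.1
    have h2 := tendsto_integral_norm_sq_sub (fun n => (u n).memLp_dy) v.memLp_dy
      fun φ hφ => (hv φ hφ).2.2
    rw [v.gradSq_eq_add]
    refine (h1.add h2).congr fun n => ?_
    rw [(u n).gradSq_eq_add, (w n).gradSq_eq_add]
    simp only [hwdef, H1.addSMul]
    ring
  have hwm : Tendsto (fun n => mass (w n)) 𝒰 (𝓝 (m - mass v)) := by
    refine (hmass.const_sub m).congr fun n => ?_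
    rw [hum n]; ring
  have hwM : ∀ᶠ n in (𝒰 : Filter ℕ), mass (w n) ≤ |m - mass v| + 1 + |K| + 1 := by
    filter_upwards [hwm.eventually_lt_const (lt_add_one _)] with n hn
    have := le_abs_self (m - mass v)
    have := abs_nonneg K
    linarith
  have hwK : ∀ᶠ n in (𝒰 : Filter ℕ), (w n).gradSq ≤ |m - mass v| + 1 + |K| + 1 := by
    filter_upwards [hgrad.eventually_const_lt (sub_one_lt _)] with n hn
    have := le_abs_self K
    have := abs_nonneg (m - mass v)
    have := huK n
    have := v.gradSq_nonneg
    linarith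
  have hT := tendsto_traceSq hL hw hwK
  -- The compact trace is what prevents the weak limit from being zero.
  have hvT : c ≤ v.traceSq := by
    refine le_of_forall_pos_le_add fun ε hε => ?_
    obtain ⟨n, hn⟩ := (eventually_traceSq_le hT hε).exists
    exact (huc n).trans hn
  have hvm : 0 < mass v := by
    refine lt_of_le_of_ne (mass_nonneg v) fun h => ?_
    rw [traceSq_eq_zero_of_mass_eq_zero h.symm] at hvT
    linarith
  have hvm' : mass v ≤ m := by
    have := ge_of_tendsto' hwm fun n => mass_nonneg (w n)
    linarith
  have hn : Tendsto (fun n : ℕ => 1 / ((n : ℝ) + 1)) 𝒰 (𝓝 0) :=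
    tendsto_one_div_add_atTop_nhds_zero_nat.mono_left Nat.hyperfilter_le_atTop
  -- Up to small errors, E(v) ≤ E(uₙ) - E(wₙ), where E(uₙ) tends to I and E(wₙ) ≥ (M(wₙ)/m) I, with
  -- right side tending to (1 - M(v)/m) I. The five errors are the 1/(n+1) of the sequence,
  -- gradient, trace, nonlinear term and mass.
  have hEv : energy γ p v ≤ mass v / m * I := by
    refine le_of_forall_pos_le_add fun ε hε => ?_
    have hlim := (hwm.div_const m).mul_const I
    have hδ : 0 < ε / 5 := by positivity
    have hδγ : 0 < ε / 5 / (-γ) := div_pos hδ (by linarith)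
    obtain ⟨n, h1, h2, h3, h4, h5, h6⟩ := ((hn.eventually_lt_const hδ).and
      ((hgrad.eventually_const_lt (sub_lt_self _ hδ)).and
      ((eventually_traceSq_le hT hδγ).and
      ((eventually_powInt_le hL hw hwM hwK (q := p + 1) (by linarith) (by linarith) hδ).and
      ((hwm.eventually_lt_const (sub_lt_self m hvm)).and
      (hlim.eventually_const_lt (sub_lt_self _ hδ))))))).exists
    have h7 := (mul_le_energy_of_mass_le hL hp hp3 hm hI h5.le).1
    have h8 := huE n
    rw [energy_eq] at h7 h8 ⊢
    have h9 : γ / 2 * (v.traceSq + ε / 5 / (-γ)) ≤ γ / 2 * (u n).traceSq :=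
      mul_le_mul_of_nonpos_left h3 (by linarith)
    have e9 : γ / 2 * (v.traceSq + ε / 5 / (-γ)) = γ / 2 * v.traceSq - ε / 10 := by
      have : γ ≠ 0 := hγ.ne
      field_simp; ring
    have h10 : γ / 2 * (w n).traceSq ≤ 0 :=
      mul_nonpos_of_nonpos_of_nonneg (by linarith) (w n).traceSq_nonneg
    have h11 : 1 / (p + 1) * (u n).powInt (p + 1) ≤
        1 / (p + 1) * (v.powInt (p + 1) + (w n).powInt (p + 1) + ε / 5) := by gcongr
    have h12 : 1 / (p + 1) * (ε / 5) ≤ ε / 5 := by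
      have : 1 / (p + 1) ≤ 1 := by rw [div_le_one (by linarith)]; linarith
      nlinarith
    have e13 : (m - mass v) / m * I = I - mass v / m * I := by field_simp
    linarith
  -- A mass strictly between 0 and m would make the scaling inequality for v strict, against `hEv`.
  have hmv : mass v = m := by
    by_contra hne'
    exact absurd hEv (not_le.2 ((mul_le_energy_of_mass_le hL hp hp3 hm hI hvm').2 hvm
      (lt_of_le_of_ne hvm' hne')))
  refine ⟨v, hmv, fun u hu => hEv.trans ?_⟩
  rw [hmv, div_self hm.ne', one_mul]
  exact hI u hu

end Minimizer

/-! ### Moduli and functions of the modulus -/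

section Composition

variable {L : ℝ}

open PrimitiveOn (normDeriv abs_normDeriv_le)

/-- `G` is continuously differentiable on `[0, ∞)` with derivative `G'` bounded by `K`. -/
structure IsProfile (G G' : ℝ → ℝ) (K : ℝ) : Prop where
  hasDerivAt : ∀ s, 0 ≤ s → HasDerivAt G (G' s) s
  abs_le : ∀ s, 0 ≤ s → |G' s| ≤ K
  measurable : Measurable G
  measurable_deriv : Measurable G'

theorem IsProfile.abs_sub_le {G G' : ℝ → ℝ} {K : ℝ} (h : IsProfile G G' K) {s t : ℝ} (hs : 0 ≤ s)
    (ht : 0 ≤ t) : |G s - G t| ≤ K * |s - t| :=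
  (convex_Ici (0 : ℝ)).norm_image_sub_le_of_norm_hasDerivWithin_le
    (fun x hx => (h.hasDerivAt x hx).hasDerivWithinAt) (fun x hx => h.abs_le x hx) ht hs

theorem AEPrimitiveOn.comp_norm {I : Set ℝ} (hI : I.OrdConnected) {f g : ℝ → ℂ}
    (h : AEPrimitiveOn I f g) {G G' : ℝ → ℝ} {K : ℝ} (hG : IsProfile G G' K) :
    AEPrimitiveOn I (fun x => ((G ‖f x‖ : ℝ) : ℂ))
      (fun x => ((G' ‖f x‖ * normDeriv (f x) (g x) : ℝ) : ℂ)) := by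
  obtain ⟨F, hF, hFe⟩ := h
  refine ⟨fun x => ((G ‖F x‖ : ℝ) : ℂ), PrimitiveOn.ofReal ?_, hFe.mono fun x hx => by
    simp only [hx]⟩
  have h1 : PrimitiveOn I (fun x => G ‖F x‖) (fun x => G' ‖F x‖ * normDeriv (F x) (g x)) :=
    (hF.norm hI).comp_of_dist_le hI (s := Ici 0) (G := G) (K := K)
      (fun x _ => norm_nonneg (F x)) (fun s hs t ht => hG.abs_sub_le hs ht)
      fun x _ hd _ => (hG.hasDerivAt _ (norm_nonneg (F x))).comp x hd
  refine h1.congr_deriv hI ?_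
  rw [ae_restrict_iff' hI.measurableSet] at hFe
  filter_upwards [hFe] with x hx hxI
  rw [hx hxI]

theorem AEPrimitiveOn.ofReal_mul {I : Set ℝ} (hI : I.OrdConnected) {f g : ℝ → ℂ}
    (h : AEPrimitiveOn I f g) {c c' : ℝ → ℝ} (hc : PrimitiveOn I c c') :
    AEPrimitiveOn I (fun x => (c x : ℂ) * f x) (fun x => (c x : ℂ) * g x + (c' x : ℂ) * f x) := by
  obtain ⟨F, hF, hFe⟩ := h
  refine ⟨_, (hF.smul hI hc).congr_deriv (g' := fun x => (c x : ℂ) * g x + (c' x : ℂ) * f x) hI ?_,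
    hFe.mono fun x hx => by simp only [hx, Complex.real_smul]⟩
  rw [ae_restrict_iff' hI.measurableSet] at hFe
  filter_upwards [hFe] with x hx hxI
  rw [hx hxI, Complex.real_smul, Complex.real_smul]

theorem aemeasurable_normDeriv {μ : Measure (ℝ × ℝ)} {f g : ℝ × ℝ → ℂ}
    (hf : AEStronglyMeasurable f μ) (hg : AEStronglyMeasurable g μ) :
    AEMeasurable (fun z => normDeriv (f z) (g z)) μ :=
  (hf.inner hg).aemeasurable.div hf.norm.aemeasurable

theorem IsProfile.memLp_comp_norm {μ : Measure (ℝ × ℝ)} {f : ℝ × ℝ → ℂ} (hf : MemLp f 2 μ)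
    {G G' : ℝ → ℝ} {K : ℝ} (hG : IsProfile G G' K) (hG0 : G 0 = 0) :
    MemLp (fun z => ((G ‖f z‖ : ℝ) : ℂ)) 2 μ := by
  refine (hf.norm.const_mul K).mono ?_ (ae_of_all _ fun z => ?_)
  · exact (Complex.measurable_ofReal.comp_aemeasurable
      (hG.measurable.comp_aemeasurable hf.1.norm.aemeasurable)).aestronglyMeasurable
  · have h1 := hG.abs_sub_le (norm_nonneg (f z)) le_rfl
    rw [hG0, sub_zero, sub_zero, abs_norm] at h1
    rw [Complex.norm_real]
    exact h1.trans (le_abs_self _)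

theorem IsProfile.memLp_mul_normDeriv {μ : Measure (ℝ × ℝ)} {f g : ℝ × ℝ → ℂ} (hf : MemLp f 2 μ)
    (hg : MemLp g 2 μ) {G G' : ℝ → ℝ} {K : ℝ} (hG : IsProfile G G' K) :
    MemLp (fun z => ((G' ‖f z‖ * normDeriv (f z) (g z) : ℝ) : ℂ)) 2 μ := by
  refine (hg.norm.const_mul K).mono ?_ (ae_of_all _ fun z => ?_)
  · exact (Complex.measurable_ofReal.comp_aemeasurable
      ((hG.measurable_deriv.comp_aemeasurable hf.1.norm.aemeasurable).mul
        (aemeasurable_normDeriv hf.1 hg.1))).aestronglyMeasurable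
  · have h1 := hG.abs_le _ (norm_nonneg (f z))
    rw [Complex.norm_real, Real.norm_eq_abs, abs_mul]
    exact (mul_le_mul h1 (abs_normDeriv_le _ _) (abs_nonneg _) ((abs_nonneg _).trans h1)).trans
      (le_abs_self _)

/-- The function `G(|u|)`. -/
noncomputable def H1.compNorm (u : H1 L) (hL : 0 < L) {G G' : ℝ → ℝ} {K : ℝ}
    (hG : IsProfile G G' K) (hG0 : G 0 = 0) : H1 L where
  toFun z := ((G ‖u z‖ : ℝ) : ℂ)
  dx z := ((G' ‖u z‖ * normDeriv (u z) (u.dx z) : ℝ) : ℂ)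
  dy z := ((G' ‖u z‖ * normDeriv (u z) (u.dy z) : ℝ) : ℂ)
  memLp_toFun := hG.memLp_comp_norm u.memLp_toFun hG0
  memLp_dx := hG.memLp_mul_normDeriv u.memLp_toFun u.memLp_dx
  memLp_dy := hG.memLp_mul_normDeriv u.memLp_toFun u.memLp_dy
  isWeakDeriv_dx := isWeakDeriv_fst_of_slices (hG.memLp_comp_norm u.memLp_toFun hG0)
    (hG.memLp_mul_normDeriv u.memLp_toFun u.memLp_dx)
    (u.slice_fst.mono fun _ h => h.comp_norm ordConnected_univ hG)
  isWeakDeriv_dy := isWeakDeriv_snd_of_slices hL (hG.memLp_comp_norm u.memLp_toFun hG0)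
    (hG.memLp_mul_normDeriv u.memLp_toFun u.memLp_dy)
    ((u.slice_snd hL).mono fun _ h => h.comp_norm ordConnected_Icc hG)

theorem isProfile_id : IsProfile (fun s => s) (fun _ => 1) 1 where
  hasDerivAt s _ := hasDerivAt_id s
  abs_le s _ := by simp
  measurable := measurable_id
  measurable_deriv := measurable_const

/-- Subtracting log ε makes the profile vanish at 0, so that its composition with |u| is square
integrable on the unbounded strip. -/
theorem isProfile_log {ε : ℝ} (hε : 0 < ε) :
    IsProfile (fun s => Real.log (s + ε) - Real.log ε) (fun s => (s + ε)⁻¹) ε⁻¹ where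
  hasDerivAt s hs := by
    have := (((hasDerivAt_id s).add_const ε).log (by simp only [id]; linarith)).sub_const
      (Real.log ε)
    simpa using this
  abs_le s hs := by
    rw [abs_of_nonneg (by positivity)]
    exact inv_anti₀ hε (by linarith)
  measurable := by fun_prop
  measurable_deriv := by fun_prop

/-- This profile does not vanish at 0, so its composition with |u| is merely bounded; it enters H¹
only after multiplication by an exponential. -/
theorem isProfile_inv {ε : ℝ} (hε : 0 < ε) :
    IsProfile (fun s => (s + ε)⁻¹) (fun s => -((s + ε) ^ 2)⁻¹) (ε ^ 2)⁻¹ where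
  hasDerivAt s hs := by
    have := ((hasDerivAt_id s).add_const ε).inv (by simp only [id]; linarith)
    convert! this using 1
    simp only [id]; field_simp
  abs_le s hs := by
    rw [abs_neg, abs_of_nonneg (by positivity)]
    exact inv_anti₀ (by positivity) (by gcongr; linarith)
  measurable := by fun_prop
  measurable_deriv := by fun_prop

/-- The modulus of `u`. -/
noncomputable def H1.modulus (u : H1 L) (hL : 0 < L) : H1 L := u.compNorm hL isProfile_id rfl

theorem H1.modulus_apply (u : H1 L) (hL : 0 < L) (z : ℝ × ℝ) :
    u.modulus hL z = ((‖u z‖ : ℝ) : ℂ) := rfl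

theorem H1.modulus_dx (u : H1 L) (hL : 0 < L) (z : ℝ × ℝ) :
    (u.modulus hL).dx z = ((normDeriv (u z) (u.dx z) : ℝ) : ℂ) := by
  simp [modulus, compNorm]

theorem H1.modulus_dy (u : H1 L) (hL : 0 < L) (z : ℝ × ℝ) :
    (u.modulus hL).dy z = ((normDeriv (u z) (u.dy z) : ℝ) : ℂ) := by
  simp [modulus, compNorm]

theorem H1.trace_modulus (u : H1 L) (hL : 0 < L) : ∀ᵐ y ∂(sectionMeasure L),
    trace (u.modulus hL) y = ((‖trace u y‖ : ℝ) : ℂ) := by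
  filter_upwards [u.slice_fst] with y hy
  obtain ⟨F, hF, hFe⟩ := hy
  rw [trace_eq_of_primitiveOn hF hFe]
  exact trace_eq_of_primitiveOn (F := fun x => ((‖F x‖ : ℝ) : ℂ))
    (hF.norm ordConnected_univ).ofReal
    (hFe.mono fun x hx => by rw [u.modulus_apply]; simp only [hx])

theorem mass_modulus (u : H1 L) (hL : 0 < L) : mass (u.modulus hL) = mass u := by
  simp only [mass, H1.modulus_apply, Complex.norm_real, norm_norm]

theorem energy_modulus_le (u : H1 L) (hL : 0 < L) (γ p : ℝ) :
    energy γ p (u.modulus hL) ≤ energy γ p u := by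
  have h1 : (u.modulus hL).gradSq ≤ u.gradSq := by
    refine integral_mono ((integrable_norm_sq (u.modulus hL).memLp_dx).add
      (integrable_norm_sq (u.modulus hL).memLp_dy))
      ((integrable_norm_sq u.memLp_dx).add (integrable_norm_sq u.memLp_dy)) fun z => ?_
    simp only [H1.modulus_dx, H1.modulus_dy, Complex.norm_real, Real.norm_eq_abs]
    gcongr <;> exact abs_normDeriv_le _ _
  have h2 : (u.modulus hL).traceSq = u.traceSq := by
    refine integral_congr_ae ?_
    filter_upwards [u.trace_modulus hL] with y hy
    rw [hy, Complex.norm_real, norm_norm]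
  have h3 : (u.modulus hL).powInt (p + 1) = u.powInt (p + 1) := by
    simp only [H1.powInt, H1.modulus_apply, Complex.norm_real, norm_norm]
  rw [energy_eq, energy_eq, h2, h3]
  linarith

/-- The function `exp (-k |x|) / (|u| + ε)`. -/
noncomputable def H1.expDecayDiv (u : H1 L) (hL : 0 < L) {k ε : ℝ} (hk : 0 < k) (hε : 0 < ε) :
    H1 L :=
  have hs : ∀ z, |(‖u z‖ + ε)⁻¹| ≤ ε⁻¹ := fun z => by
    rw [abs_of_nonneg (by positivity)]
    exact inv_anti₀ hε (by linarith [norm_nonneg (u z)])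
  have hm : AEMeasurable (fun z => (((‖u z‖ + ε)⁻¹ : ℝ) : ℂ)) (stripMeasure L) :=
    Complex.measurable_ofReal.comp_aemeasurable
      ((u.memLp_toFun.1.norm.aemeasurable.add_const ε).inv)
  have mul {f : ℝ × ℝ → ℂ} (hf : MemLp f 2 (stripMeasure L)) :
      MemLp (fun z => f z * (((‖u z‖ + ε)⁻¹ : ℝ) : ℂ)) 2 (stripMeasure L) :=
    (hf.const_mul ((ε⁻¹ : ℝ) : ℂ)).mono (hf.1.mul hm.aestronglyMeasurable) (ae_of_all _ fun z => by
      rw [norm_mul, norm_mul, mul_comm, Complex.norm_real, Complex.norm_real,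
        Real.norm_of_nonneg (inv_nonneg.2 hε.le)]
      exact mul_le_mul_of_nonneg_right (hs z) (norm_nonneg _))
  have mul' {f : ℝ × ℝ → ℂ} (hf : MemLp f 2 (stripMeasure L)) :
      MemLp (fun z => (Real.exp (-k * |z.1|) : ℂ) * f z) 2 (stripMeasure L) :=
    hf.mono ((by fun_prop : Continuous fun z : ℝ × ℝ =>
      (Real.exp (-k * |z.1|) : ℂ)).aestronglyMeasurable.mul hf.1) (ae_of_all _ fun z => by
      rw [norm_mul, Complex.norm_real, Real.norm_of_nonneg (Real.exp_pos _).le]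
      have h1 : Real.exp (-k * |z.1|) ≤ 1 := Real.exp_le_one_iff.2 (by
        have := abs_nonneg z.1; nlinarith)
      exact mul_le_of_le_one_left (norm_nonneg _) h1)
  have m0 := mul (memLp_exp_neg_mul_abs L hk)
  have mx := (mul' ((isProfile_inv hε).memLp_mul_normDeriv u.memLp_toFun u.memLp_dx)).add
    (mul (memLp_sign_mul_exp L hk))
  have my := mul' ((isProfile_inv hε).memLp_mul_normDeriv u.memLp_toFun u.memLp_dy)
  { toFun := fun z => (Real.exp (-k * |z.1|) : ℂ) * (((‖u z‖ + ε)⁻¹ : ℝ) : ℂ)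
    dx := fun z => (Real.exp (-k * |z.1|) : ℂ) *
      ((-((‖u z‖ + ε) ^ 2)⁻¹ * normDeriv (u z) (u.dx z) : ℝ) : ℂ) +
      ((-k * SignType.sign z.1 * Real.exp (-k * |z.1|) : ℝ) : ℂ) * (((‖u z‖ + ε)⁻¹ : ℝ) : ℂ)
    dy := fun z => (Real.exp (-k * |z.1|) : ℂ) *
      ((-((‖u z‖ + ε) ^ 2)⁻¹ * normDeriv (u z) (u.dy z) : ℝ) : ℂ)
    memLp_toFun := m0
    memLp_dx := mx
    memLp_dy := my
    isWeakDeriv_dx := isWeakDeriv_fst_of_slices m0 mx (u.slice_fst.mono fun _ h =>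
      (h.comp_norm ordConnected_univ (isProfile_inv hε)).ofReal_mul ordConnected_univ
        (primitiveOn_exp_neg_mul_abs hk))
    isWeakDeriv_dy := isWeakDeriv_snd_of_slices hL m0 my ((u.slice_snd hL).mono fun x h => by
      have := (h.comp_norm ordConnected_Icc (isProfile_inv hε)).ofReal_mul ordConnected_Icc
        ((PrimitiveOn.of_hasDerivAt (F := fun _ => Real.exp (-k * |x|))
          (fun t => hasDerivAt_const t _) continuous_const).mono (subset_univ _))
      simpa using this) }

theorem H1.trace_expDecayDiv (u : H1 L) (hL : 0 < L) {k ε : ℝ} (hk : 0 < k) (hε : 0 < ε) :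
    ∀ᵐ y ∂(sectionMeasure L),
      trace (u.expDecayDiv hL hk hε) y = (((‖trace u y‖ + ε)⁻¹ : ℝ) : ℂ) := by
  filter_upwards [u.slice_fst] with y hy
  obtain ⟨F, hF, hFe⟩ := hy
  rw [trace_eq_of_primitiveOn hF hFe]
  have e : trace (u.expDecayDiv hL hk hε) y =
      trace (fun z => (Real.exp (-k * |z.1|) : ℂ) * (((‖F z.1‖ + ε)⁻¹ : ℝ) : ℂ)) y := by
    rw [Measure.restrict_univ] at hFe
    refine trace_congr (hFe.mono fun x hx => ?_)
    simp only [expDecayDiv, hx]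
  rw [e, trace_of_continuous]
  · simp
  · have := hF.continuous
    have h0 : ∀ x, ‖F x‖ + ε ≠ 0 := fun x => by positivity
    simp only
    fun_prop (disch := assumption)

end Composition

/-! ### The Euler-Lagrange equation -/

section EulerLagrange

variable {L : ℝ}

theorem hasDerivAt_integral_norm_add_smul_sq {α : Type*} [MeasurableSpace α] {μ : Measure α}
    {f g : α → ℂ} (hf : MemLp f 2 μ) (hg : MemLp g 2 μ) :
    HasDerivAt (fun t : ℝ => ∫ z, ‖f z + t • g z‖ ^ 2 ∂μ) (2 * ∫ z, (f z * star (g z)).re ∂μ) 0 := by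
  have i1 : Integrable (fun z => ‖f z‖ ^ 2) μ := by
    simpa using hf.integrable_norm_pow two_ne_zero
  have i2 : Integrable (fun z => ‖g z‖ ^ 2) μ := by
    simpa using hg.integrable_norm_pow two_ne_zero
  have i3 : Integrable (fun z => f z * star (g z)) μ := hf.integrable_mul hg.star
  have i4 : Integrable (fun z => (f z * star (g z)).re) μ := Complex.reCLM.integrable_comp i3
  have e : (fun t : ℝ => ∫ z, ‖f z + t • g z‖ ^ 2 ∂μ) = fun t =>
      (∫ z, ‖f z‖ ^ 2 ∂μ) + t * (2 * ∫ z, (f z * star (g z)).re ∂μ) +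
        t ^ 2 * ∫ z, ‖g z‖ ^ 2 ∂μ := by
    ext t
    have e1 : ∀ z, ‖f z + t • g z‖ ^ 2 =
        ‖f z‖ ^ 2 + t * (2 * (f z * star (g z)).re) + t ^ 2 * ‖g z‖ ^ 2 := fun z => by
      simp only [← Complex.normSq_eq_norm_sq, Complex.normSq_apply, Complex.add_re, Complex.add_im,
        Complex.mul_re, Complex.star_def, Complex.conj_re, Complex.conj_im, Complex.real_smul,
        Complex.ofReal_re, Complex.ofReal_im, Complex.mul_im]
      ring
    have i5 : Integrable (fun z => ‖f z‖ ^ 2 + t * (2 * (f z * star (g z)).re)) μ :=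
      i1.add ((i4.const_mul 2).const_mul t)
    simp only [e1]
    rw [integral_add i5 (i2.const_mul _), integral_add i1 ((i4.const_mul 2).const_mul t),
      integral_const_mul, integral_const_mul, integral_const_mul]
  rw [e]
  have h1 := ((hasDerivAt_id (0 : ℝ)).mul_const (2 * ∫ z, (f z * star (g z)).re ∂μ)).const_add
    (∫ z, ‖f z‖ ^ 2 ∂μ)
  have h2 := ((hasDerivAt_id (0 : ℝ)).pow 2).mul_const (∫ z, ‖g z‖ ^ 2 ∂μ)
  convert! h1.add h2 using 1
  simp

/-- The power is written as (|·|²)^(q/2); since q/2 ≥ 1 it is differentiable at the zeros as well.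
-/
theorem hasDerivAt_norm_add_smul_rpow (z w : ℂ) {q : ℝ} (hq : 2 ≤ q) (t : ℝ) :
    HasDerivAt (fun t : ℝ => ‖z + t • w‖ ^ q)
      (q * (‖z + t • w‖ ^ (q - 2) * ((z + t • w) * star w).re)) t := by
  have h1 : HasDerivAt (fun t : ℝ => z + t • w) w t := by
    simpa using ((hasDerivAt_id t).smul_const w).const_add z
  have h2 := (h1.norm_sq).rpow_const (p := q / 2) (Or.inr (by linarith))
  have e : ∀ (s : ℝ) (x : ℂ), (‖x‖ ^ 2) ^ s = ‖x‖ ^ (2 * s) := fun s x => by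
    rw [← Real.rpow_natCast, ← Real.rpow_mul (norm_nonneg _)]; norm_num
  simp only [e] at h2
  have e2 : 2 * (q / 2) = q := by ring
  have e3 : 2 * (q / 2 - 1) = q - 2 := by ring
  rw [e2, e3] at h2
  convert! h2 using 1
  have e4 : inner ℝ (z + t • w) w = ((z + t • w) * star w).re := by
    rw [Complex.inner, mul_comm, ← Complex.conj_re]
    simp
  rw [e4]
  ring

theorem H1.integrable_norm_add_norm_rpow (u v : H1 L) (hL : 0 < L) {q : ℝ} (hq2 : 2 < q)
    (hq4 : q < 4) : Integrable (fun z => (‖u z‖ + ‖v z‖) ^ q) (stripMeasure L) := by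
  obtain ⟨C, hC0, hC⟩ := exists_add_rpow_le (q := q) (by linarith) one_pos
  refine (((u.integrable_rpow hL hq2 hq4).const_mul (1 + 1)).add
    ((v.integrable_rpow hL hq2 hq4).const_mul C)).mono' ?_ (ae_of_all _ fun z => ?_)
  · exact ((u.memLp_toFun.1.norm.add v.memLp_toFun.1.norm).aemeasurable.pow_const
      q).aestronglyMeasurable
  · have h := hC (‖u z‖ : ℂ) (‖v z‖ : ℂ)
    rw [← Complex.ofReal_add, Complex.norm_real, Complex.norm_real, Complex.norm_real, norm_norm,
      norm_norm] at h
    rw [Real.norm_eq_abs] at h ⊢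
    rw [abs_of_nonneg (by positivity)] at h ⊢
    exact h

/-- Differentiation under the integral: for |t| < 1 the derivative is dominated by q (|u| + |v|)^q,
which is integrable. -/
theorem H1.hasDerivAt_powInt (u v : H1 L) (hL : 0 < L) {q : ℝ} (hq2 : 2 < q) (hq4 : q < 4) :
    Integrable (fun z => ‖u z‖ ^ (q - 2) * (u z * star (v z)).re) (stripMeasure L) ∧
    HasDerivAt (fun t : ℝ => (u.addSMul t v).powInt q)
      (q * ∫ z, ‖u z‖ ^ (q - 2) * (u z * star (v z)).re ∂(stripMeasure L)) 0 := by
  have hm : ∀ t : ℝ, AEStronglyMeasurable (fun z => u z + t • v z) (stripMeasure L) := fun t =>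
    (u.addSMul t v).memLp_toFun.1
  have h := hasDerivAt_integral_of_dominated_loc_of_deriv_le (μ := stripMeasure L) (𝕜 := ℝ)
    (F := fun (t : ℝ) z => ‖u z + t • v z‖ ^ q)
    (F' := fun t z => q * (‖u z + t • v z‖ ^ (q - 2) * ((u z + t • v z) * star (v z)).re))
    (x₀ := 0) (s := Metric.ball 0 1) (bound := fun z => q * (‖u z‖ + ‖v z‖) ^ q)
    (Metric.ball_mem_nhds _ one_pos)
    (Eventually.of_forall fun t => ((hm t).norm.aemeasurable.pow_const q).aestronglyMeasurable)
    (by simpa using u.integrable_rpow hL hq2 hq4) ?_ (ae_of_all _ fun z t ht => ?_)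
    ((u.integrable_norm_add_norm_rpow v hL hq2 hq4).const_mul q)
    (ae_of_all _ fun z t _ => hasDerivAt_norm_add_smul_rpow _ _ hq2.le t)
  · simp only [zero_smul, add_zero] at h
    rw [integral_const_mul] at h
    exact ⟨(integrable_const_mul_iff (isUnit_iff_ne_zero.2 (by linarith)) _).1 h.1, h.2⟩
  · refine AEStronglyMeasurable.const_mul (AEStronglyMeasurable.mul
      ((hm 0).norm.aemeasurable.pow_const _).aestronglyMeasurable ?_) q
    exact Complex.continuous_re.comp_aestronglyMeasurable ((hm 0).mul v.memLp_toFun.1.star)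
  · rw [mem_ball_zero_iff, Real.norm_eq_abs] at ht
    have h1 : ‖u z + t • v z‖ ≤ ‖u z‖ + ‖v z‖ := by
      refine (norm_add_le _ _).trans ?_
      rw [norm_smul, Real.norm_eq_abs]
      have := norm_nonneg (v z)
      nlinarith
    have h2 : |((u z + t • v z) * star (v z)).re| ≤ (‖u z‖ + ‖v z‖) ^ 2 := by
      refine (Complex.abs_re_le_norm _).trans ?_
      rw [norm_mul, norm_star, sq]
      gcongr
      linarith [norm_nonneg (u z)]
    have h3 : ‖u z + t • v z‖ ^ (q - 2) ≤ (‖u z‖ + ‖v z‖) ^ (q - 2) :=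
      Real.rpow_le_rpow (norm_nonneg _) h1 (by linarith)
    have h0 : 0 ≤ ‖u z‖ + ‖v z‖ := by positivity
    have e : (‖u z‖ + ‖v z‖) ^ q = (‖u z‖ + ‖v z‖) ^ (q - 2) * (‖u z‖ + ‖v z‖) ^ 2 := by
      rw [← Real.rpow_natCast, ← Real.rpow_add_of_nonneg h0 (by linarith) (by norm_num)]
      norm_num
    rw [Real.norm_eq_abs, abs_mul, abs_mul, abs_of_nonneg (by linarith : 0 ≤ q),
      abs_of_nonneg (by positivity), e]
    gcongr

theorem H1.hasDerivAt_mass (u v : H1 L) : HasDerivAt (fun t : ℝ => mass (u.addSMul t v))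
    (2 * ∫ z, (u z * star (v z)).re ∂(stripMeasure L)) 0 :=
  hasDerivAt_integral_norm_add_smul_sq u.memLp_toFun v.memLp_toFun

theorem H1.hasDerivAt_gradSq (u v : H1 L) : HasDerivAt (fun t : ℝ => (u.addSMul t v).gradSq)
    (2 * ∫ z, (u.dx z * star (v.dx z) + u.dy z * star (v.dy z)).re ∂(stripMeasure L)) 0 := by
  have h1 := hasDerivAt_integral_norm_add_smul_sq u.memLp_dx v.memLp_dx
  have h2 := hasDerivAt_integral_norm_add_smul_sq u.memLp_dy v.memLp_dy
  have i1 : Integrable (fun z => (u.dx z * star (v.dx z)).re) (stripMeasure L) :=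
    Complex.reCLM.integrable_comp (u.memLp_dx.integrable_mul v.memLp_dx.star)
  have i2 : Integrable (fun z => (u.dy z * star (v.dy z)).re) (stripMeasure L) :=
    Complex.reCLM.integrable_comp (u.memLp_dy.integrable_mul v.memLp_dy.star)
  simp only [Complex.add_re]
  rw [integral_add i1 i2, mul_add]
  refine (h1.add h2).congr_of_eventuallyEq (Eventually.of_forall fun t => ?_)
  exact H1.gradSq_eq_add _

theorem H1.hasDerivAt_traceSq (u v : H1 L) : HasDerivAt (fun t : ℝ => (u.addSMul t v).traceSq)
    (2 * ∫ y in Icc 0 L, (trace u y * star (trace v y)).re) 0 := by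
  have h1 := hasDerivAt_integral_norm_add_smul_sq u.memLp_trace v.memLp_trace
  refine h1.congr_of_eventuallyEq (Eventually.of_forall fun t => ?_)
  refine integral_congr_ae ?_
  filter_upwards [u.trace_addSMul v t] with y hy
  rw [hy]

/-- The Euler-Lagrange equation of a minimizer of the energy. -/
theorem isSolution_of_minimizer (hL : 0 < L) {γ p m : ℝ} (hp : 1 < p) (hp3 : p < 3) (hm : 0 < m)
    {u : H1 L} (hu : mass u = m) (hmin : ∀ v : H1 L, mass v = m → energy γ p u ≤ energy γ p v) :
    IsSolution γ p ((u.powInt (p + 1) - (u.gradSq + γ * u.traceSq)) / m) u := by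
  intro v
  have hM := u.hasDerivAt_mass v
  have hG := u.hasDerivAt_gradSq v
  have hT := u.hasDerivAt_traceSq v
  have hN := (u.hasDerivAt_powInt v hL (q := p + 1) (by linarith) (by linarith)).2
  rw [show p + 1 - 2 = p - 1 by ring] at hN
  have e0 : ∀ z, u.addSMul 0 v z = u z := fun z => by simp [H1.addSMul]
  have M0 : mass (u.addSMul 0 v) = m := by simp only [mass, e0]; exact hu
  have N0 : (u.addSMul 0 v).powInt (p + 1) = u.powInt (p + 1) := by simp only [H1.powInt, e0]
  have G0 : (u.addSMul 0 v).gradSq = u.gradSq := by simp [H1.gradSq, H1.addSMul]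
  have T0 : (u.addSMul 0 v).traceSq = u.traceSq := by simp [H1.traceSq, H1.addSMul]
  set a := ∫ z, (u z * star (v z)).re ∂(stripMeasure L)
  set b := ∫ z, (u.dx z * star (v.dx z) + u.dy z * star (v.dy z)).re ∂(stripMeasure L)
  set c := ∫ y in Icc 0 L, (trace u y * star (trace v y)).re
  set d := ∫ z, ‖u z‖ ^ (p - 1) * (u z * star (v z)).re ∂(stripMeasure L)
  have hR := (hasDerivAt_const (0 : ℝ) m).div hM (by rw [M0]; exact hm.ne')
  simp only [M0] at hR
  have hRp := hR.rpow_const (p := (p + 1) / 2) (Or.inr (by linarith))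
  have hJ := (hR.mul ((hG.const_mul (1 / 2)).add (hT.const_mul (γ / 2)))).sub
    ((hRp.mul hN).const_mul (1 / (p + 1)))
  -- The constraint is removed by rescaling u + tv to mass m. The energy of the rescaled function is
  -- then minimal at t = 0, and the derivative of the scaling factor produces the multiplier ω.
  have hloc : IsLocalMin ((fun t : ℝ => m / mass (u.addSMul t v) *
      (1 / 2 * (u.addSMul t v).gradSq + γ / 2 * (u.addSMul t v).traceSq)) -
      fun t => 1 / (p + 1) * ((m / mass (u.addSMul t v)) ^ ((p + 1) / 2) *
        (u.addSMul t v).powInt (p + 1))) 0 := by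
    have hpos : ∀ᶠ t in 𝓝 (0 : ℝ), 0 < mass (u.addSMul t v) :=
      hM.continuousAt.eventually_const_lt (by simp only [M0]; exact hm)
    filter_upwards [hpos] with t ht
    have hc : 0 ≤ m / mass (u.addSMul t v) := by positivity
    have h1 := hmin ((u.addSMul t v).scale (Real.sqrt (m / mass (u.addSMul t v)))) (by
      rw [mass_scale, Real.sq_sqrt hc]; field_simp)
    rw [energy_scale (Real.sqrt_nonneg _), Real.sq_sqrt hc, Real.sqrt_eq_rpow,
      ← Real.rpow_mul hc, show 1 / 2 * (p + 1) = (p + 1) / 2 by ring, energy_eq] at h1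
    simp only [Pi.sub_apply, M0, N0, G0, T0, div_self hm.ne', Real.one_rpow, one_mul]
    exact h1
  have h0 := hloc.hasDerivAt_eq_zero hJ
  simp only [M0, N0, G0, T0, div_self hm.ne', Real.one_rpow, one_mul, Pi.add_apply,
    Pi.div_apply, mul_one] at h0
  have hp1 : p + 1 ≠ 0 := by linarith
  rw [← h0]
  field_simp
  ring

end EulerLagrange

/-! ### Bound for the frequency and strict positivity -/

section Positivity

variable {L : ℝ}

open PrimitiveOn (normDeriv abs_normDeriv_le)

/-- The frequency of a nonnegative solution lies above the bottom of the spectrum. -/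
theorem lt_frequency (hL : 0 < L) {γ p ω : ℝ} (hγ : γ < 0) (hp : 1 < p) (hp3 : p < 3)
    (v : H1 L) (hv : 0 < mass v) (h : IsSolution γ p ω (v.modulus hL)) : γ ^ 2 / 4 < ω := by
  have hk : 0 < -γ / 2 := by linarith
  set u := v.modulus hL with hu
  set ψ := H1.expDecay hL hk with hψ
  have hstar : ∀ z, star (ψ z) = ψ z := fun z => Complex.conj_ofReal _
  have hstarx : ∀ z, star (ψ.dx z) = ψ.dx z := fun z => Complex.conj_ofReal _
  have hy : ∀ z, ψ.dy z = 0 := fun _ => rfl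
  have hre : ∀ z, (u z * ψ z).re = ‖v z‖ * Real.exp (-(-γ / 2) * |z.1|) := fun z => by
    have : u z * ψ z = ((‖v z‖ * Real.exp (-(-γ / 2) * |z.1|) : ℝ) : ℂ) := by
      rw [Complex.ofReal_mul]; rfl
    rw [this, Complex.ofReal_re]
  have i1 : Integrable (fun z => ψ.dx z * u.dx z) (stripMeasure L) :=
    ψ.memLp_dx.integrable_mul u.memLp_dx
  have i2 : Integrable (fun z => ψ z * u z) (stripMeasure L) :=
    ψ.memLp_toFun.integrable_mul u.memLp_toFun
  have : IsFiniteMeasure (sectionMeasure L) := by rw [sectionMeasure]; infer_instance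
  have i3 : Integrable (fun y => trace u y) (sectionMeasure L) :=
    u.memLp_trace.integrable (by norm_num)
  have key := congrArg Complex.re (u.integral_expDecay hL hk)
  rw [← hψ] at key
  have e1 : (∫ z, ψ.dx z * u.dx z ∂(stripMeasure L)).re =
      ∫ z, (u.dx z * star (ψ.dx z) + u.dy z * star (ψ.dy z)).re ∂(stripMeasure L) := by
    refine (Complex.reCLM.integral_comp_comm i1).symm.trans ?_
    congr 1; ext z
    rw [hstarx, hy, star_zero, mul_zero, add_zero, mul_comm]; rfl
  have e2 : (∫ z, ψ z * u z ∂(stripMeasure L)).re =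
      ∫ z, (u z * star (ψ z)).re ∂(stripMeasure L) := by
    refine (Complex.reCLM.integral_comp_comm i2).symm.trans ?_
    congr 1; ext z
    rw [hstar, mul_comm]; rfl
  have e3 : (∫ y, trace u y ∂(sectionMeasure L)).re =
      ∫ y in Icc 0 L, (trace u y * star (trace ψ y)).re := by
    refine (Complex.reCLM.integral_comp_comm i3).symm.trans ?_
    refine integral_congr_ae (ae_of_all _ fun y => ?_)
    simp only [hψ, H1.trace_expDecay, star_one, mul_one]; rfl
  have e4 : (2 * ((-γ / 2 : ℝ) : ℂ) * (∫ y, trace u y ∂(sectionMeasure L)) -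
      ((-γ / 2 : ℝ) : ℂ) ^ 2 * ∫ z, ψ z * u z ∂(stripMeasure L)).re =
      2 * (-γ / 2) * (∫ y, trace u y ∂(sectionMeasure L)).re -
        (-γ / 2) ^ 2 * (∫ z, ψ z * u z ∂(stripMeasure L)).re := by
    have a1 : (2 * ((-γ / 2 : ℝ) : ℂ)) = ((2 * (-γ / 2) : ℝ) : ℂ) := by push_cast; ring
    rw [a1, ← Complex.ofReal_pow, Complex.sub_re, Complex.re_ofReal_mul, Complex.re_ofReal_mul]
  rw [e4, e1, e2, e3] at key
  -- As 2k = -γ, the trace terms cancel and the equation reads (ω - γ²/4) ∫ uψ = ∫ uᵖψ.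
  have hsol := h ψ
  rw [key] at hsol
  have hP : 0 ≤ ∫ z, (u z * star (ψ z)).re ∂(stripMeasure L) :=
    integral_nonneg fun z => by
      simp only [hstar, hre]; positivity
  have hN : 0 < ∫ z, ‖u z‖ ^ (p - 1) * (u z * star (ψ z)).re ∂(stripMeasure L) := by
    have hi := (u.hasDerivAt_powInt ψ hL (q := p + 1) (by linarith) (by linarith)).1
    rw [show p + 1 - 2 = p - 1 by ring] at hi
    have h0 : 0 ≤ fun z => ‖u z‖ ^ (p - 1) * (u z * star (ψ z)).re := fun z => by
      simp only [hstar, hre]; positivity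
    refine lt_of_le_of_ne (integral_nonneg h0) fun hN => hv.ne' ?_
    have hz := (integral_eq_zero_iff_of_nonneg h0 hi).1 hN.symm
    refine integral_eq_zero_of_ae ?_
    filter_upwards [hz] with z hz
    simp only [hstar, hre, Pi.zero_apply, mul_eq_zero, (Real.exp_pos _).ne', or_false] at hz
    have hun : ‖u z‖ = ‖v z‖ := by rw [hu, v.modulus_apply, Complex.norm_real, norm_norm]
    rw [hun, Real.rpow_eq_zero (norm_nonneg _) (by linarith), or_self] at hz
    simp [hz]
  by_contra! hω
  nlinarith

/-- Pointwise Young inequality for the test function s/(u + ε): s is the weight, t its x-derivative,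
i = 1/(u + ε), and d, e are the partial derivatives of u. The cross term costs half of the square.
-/
theorem mul_add_mul_le_of_abs_le {s t i d e : ℝ} (ht : |t| ≤ s) :
    d * (s * (-(i ^ 2) * d) + t * i) + e * (s * (-(i ^ 2) * e)) ≤
      -(1 / 2) * (s * ((i * d) ^ 2 + (i * e) ^ 2)) + 1 / 2 * s := by
  have h0 : 0 ≤ s := (abs_nonneg t).trans ht
  have h1 : t * (i * d) ≤ s * |i * d| := by
    refine (le_abs_self _).trans ?_
    rw [abs_mul]
    gcongr
  have h2 : 0 ≤ s * (|i * d| - 1) ^ 2 := by positivity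
  have h3 : |i * d| ^ 2 = (i * d) ^ 2 := sq_abs _
  have h4 : 0 ≤ s * (i * e) ^ 2 := by positivity
  nlinarith

theorem integrable_exp_strip (L : ℝ) :
    Integrable (fun z : ℝ × ℝ => Real.exp (-1 * |z.1|)) (stripMeasure L) := by
  have : IsFiniteMeasure (sectionMeasure L) := by rw [sectionMeasure]; infer_instance
  rw [stripMeasure_eq_prod]
  exact (integrable_exp_neg_mul_abs one_pos).comp_fst (sectionMeasure L)

/-- The weighted logarithmic gradient estimate for nonnegative solutions. -/
theorem integral_exp_mul_grad_log_le (hL : 0 < L) {γ p ω : ℝ} (hγ : γ < 0)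
    (v : H1 L) (h : IsSolution γ p ω (v.modulus hL)) {ε : ℝ} (hε : 0 < ε) :
    ∫ z, Real.exp (-1 * |z.1|) * (‖(v.compNorm hL (isProfile_log hε) (by simp)).dx z‖ ^ 2 +
      ‖(v.compNorm hL (isProfile_log hε) (by simp)).dy z‖ ^ 2) ∂(stripMeasure L) ≤
      (1 + 2 * |ω|) * ∫ z, Real.exp (-1 * |z.1|) ∂(stripMeasure L) := by
  set W := v.compNorm hL (isProfile_log hε) (by simp) with hW
  -- Dividing by u + ε turns the gradient term into minus the square of ∇ log(u + ε). The weight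
  -- exp(-|x|) makes the quotient square integrable, and its derivative is no larger than itself.
  set w := v.expDecayDiv hL one_pos hε with hw
  set u := v.modulus hL with hu
  have hS := integrable_exp_strip L
  have hD : Integrable (fun z => Real.exp (-1 * |z.1|) * (‖W.dx z‖ ^ 2 + ‖W.dy z‖ ^ 2))
      (stripMeasure L) := by
    refine ((integrable_norm_sq W.memLp_dx).add (integrable_norm_sq W.memLp_dy)).mono'
      (hS.1.mul ((W.memLp_dx.1.norm.pow 2).add (W.memLp_dy.1.norm.pow 2))) (ae_of_all _ fun z => ?_)
    rw [Real.norm_of_nonneg (by positivity)]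
    refine mul_le_of_le_one_left (by positivity) (Real.exp_le_one_iff.2 ?_)
    have := abs_nonneg z.1; linarith
  have hsol := h w
  have hA : ∫ z, (u.dx z * star (w.dx z) + u.dy z * star (w.dy z)).re ∂(stripMeasure L) ≤
      -(1 / 2) * (∫ z, Real.exp (-1 * |z.1|) * (‖W.dx z‖ ^ 2 + ‖W.dy z‖ ^ 2) ∂(stripMeasure L)) +
        1 / 2 * ∫ z, Real.exp (-1 * |z.1|) ∂(stripMeasure L) := by
    rw [← integral_const_mul, ← integral_const_mul,
      ← integral_add (hD.const_mul _) (hS.const_mul _)]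
    have i1 : Integrable (fun z => u.dx z * star (w.dx z) + u.dy z * star (w.dy z))
        (stripMeasure L) := (u.memLp_dx.integrable_mul w.memLp_dx.star).add
          (u.memLp_dy.integrable_mul w.memLp_dy.star)
    refine integral_mono (Complex.reCLM.integrable_comp i1)
      ((hD.const_mul _).add (hS.const_mul _)) fun z => ?_
    have h1 : (u.dx z * star (w.dx z) + u.dy z * star (w.dy z)).re =
        normDeriv (v z) (v.dx z) * (Real.exp (-1 * |z.1|) *
          (-((‖v z‖ + ε)⁻¹ ^ 2) * normDeriv (v z) (v.dx z)) +
          (-1 * SignType.sign z.1 * Real.exp (-1 * |z.1|)) * (‖v z‖ + ε)⁻¹) +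
        normDeriv (v z) (v.dy z) * (Real.exp (-1 * |z.1|) *
          (-((‖v z‖ + ε)⁻¹ ^ 2) * normDeriv (v z) (v.dy z))) := by
      rw [hu, v.modulus_dx, v.modulus_dy]
      simp only [hw, H1.expDecayDiv, ← Complex.ofReal_mul, ← Complex.ofReal_add,
        Complex.star_def, Complex.conj_ofReal, Complex.ofReal_re, inv_pow]
    have h2 : ‖W.dx z‖ ^ 2 = ((‖v z‖ + ε)⁻¹ * normDeriv (v z) (v.dx z)) ^ 2 := by
      simp only [hW, H1.compNorm]
      rw [Complex.norm_real, Real.norm_eq_abs, sq_abs]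
    have h3 : ‖W.dy z‖ ^ 2 = ((‖v z‖ + ε)⁻¹ * normDeriv (v z) (v.dy z)) ^ 2 := by
      simp only [hW, H1.compNorm]
      rw [Complex.norm_real, Real.norm_eq_abs, sq_abs]
    simp only [h2, h3]
    refine h1.trans_le ?_
    refine mul_add_mul_le_of_abs_le ?_
    simpa using abs_sign_mul_exp_le one_pos z.1
  have hre : ∀ z, (u z * star (w z)).re =
      ‖v z‖ * (Real.exp (-1 * |z.1|) * (‖v z‖ + ε)⁻¹) := fun z => by
    rw [hu, v.modulus_apply]
    simp only [hw, H1.expDecayDiv, ← Complex.ofReal_mul,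
        Complex.star_def, Complex.conj_ofReal, Complex.ofReal_re]
  have hB0 : 0 ≤ ∫ z, (u z * star (w z)).re ∂(stripMeasure L) :=
    integral_nonneg fun z => by simp only [hre]; positivity
  have hB : ∫ z, (u z * star (w z)).re ∂(stripMeasure L) ≤
      ∫ z, Real.exp (-1 * |z.1|) ∂(stripMeasure L) := by
    refine integral_mono (Complex.reCLM.integrable_comp
      (u.memLp_toFun.integrable_mul w.memLp_toFun.star)) hS fun z => ?_
    refine (hre z).trans_le ?_
    have h1 : ‖v z‖ * (‖v z‖ + ε)⁻¹ ≤ 1 := by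
      rw [← div_eq_mul_inv, div_le_one (by positivity)]; linarith
    have h2 := Real.exp_pos (-1 * |z.1|)
    nlinarith
  have hT : 0 ≤ ∫ y in Icc 0 L, (trace u y * star (trace w y)).re := by
    refine integral_nonneg_of_ae ?_
    filter_upwards [v.trace_modulus hL, v.trace_expDecayDiv hL one_pos hε] with y h1 h2
    rw [hu, h1, hw, h2, Complex.star_def, Complex.conj_ofReal, ← Complex.ofReal_mul,
      Complex.ofReal_re]
    positivity
  have hN : 0 ≤ ∫ z, ‖u z‖ ^ (p - 1) * (u z * star (w z)).re ∂(stripMeasure L) :=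
    integral_nonneg fun z => by simp only [hre]; positivity
  have h5 : ω * (∫ z, (u z * star (w z)).re ∂(stripMeasure L)) ≤
      |ω| * ∫ z, Real.exp (-1 * |z.1|) ∂(stripMeasure L) :=
    mul_le_mul (le_abs_self _) hB hB0 (abs_nonneg _)
  -- The trace term, because γ < 0, and the nonlinear term both have the favourable sign and are
  -- dropped.
  have h6 := mul_nonpos_of_nonpos_of_nonneg hγ.le hT
  linarith

/-- On a bounded part of the strip, the modulus of a solution cannot both vanish and be bounded
below on sets of positive measure. -/
theorem measure_mul_measure_eq_zero (hL : 0 < L) {γ p ω : ℝ} (hγ : γ < 0)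
    (v : H1 L) (h : IsSolution γ p ω (v.modulus hL)) {R : ℝ} (hR : 0 < R) {Z A : Set (ℝ × ℝ)}
    (hZ : MeasurableSet Z) (hA : MeasurableSet A)
    (hvZ : ∀ᵐ z ∂(stripMeasure L), z ∈ Z → v z = 0) {δ : ℝ} (hδ : 0 < δ)
    (hvA : ∀ᵐ z ∂(stripMeasure L), z ∈ A → δ ≤ ‖v z‖) :
    ((stripMeasure L).restrict (window R) A) * ((stripMeasure L).restrict (window R) Z) = 0 := by
  rw [restrict_window_eq_restrict_box]
  set Q := box (-R) R 0 L with hQ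
  set ν := (stripMeasure L).restrict Q with hν
  set S := ∫ z, Real.exp (-1 * |z.1|) ∂(stripMeasure L) with hS
  set C := Real.exp R * ((1 + 2 * |ω|) * S) with hC
  set K := 2 * ((R - -R) * (L - 0)) * ((R - -R) ^ 2 * C + (L - 0) ^ 2 * C) with hK
  have key : ∀ ε > 0, ENNReal.ofReal ((Real.log (δ + ε) - Real.log ε) ^ 2) * (ν A * ν Z) ≤
      ENNReal.ofReal K := by
    intro ε hε
    set W := v.compNorm hL (isProfile_log hε) (by simp) with hW
    have hlog := integral_exp_mul_grad_log_le hL hγ v h hε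
    rw [← hW, ← hS] at hlog
    have hD : Integrable (fun z => Real.exp R * (Real.exp (-1 * |z.1|) *
        (‖W.dx z‖ ^ 2 + ‖W.dy z‖ ^ 2))) (stripMeasure L) := by
      refine Integrable.const_mul ?_ _
      refine ((integrable_norm_sq W.memLp_dx).add (integrable_norm_sq W.memLp_dy)).mono'
        ((integrable_exp_strip L).1.mul ((W.memLp_dx.1.norm.pow 2).add (W.memLp_dy.1.norm.pow 2)))
        (ae_of_all _ fun z => ?_)
      rw [Real.norm_of_nonneg (by positivity)]
      refine mul_le_of_le_one_left (by positivity) (Real.exp_le_one_iff.2 ?_)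
      have := abs_nonneg z.1; linarith
    have hle : ∀ {f : ℝ × ℝ → ℝ}, Integrable f (stripMeasure L) →
        (∀ z, f z ≤ ‖W.dx z‖ ^ 2 + ‖W.dy z‖ ^ 2) →
        ∫ z in Q, f z ∂(stripMeasure L) ≤ C := by
      intro f hf hfW
      calc ∫ z in Q, f z ∂(stripMeasure L) ≤ ∫ z in Q, Real.exp R * (Real.exp (-1 * |z.1|) *
            (‖W.dx z‖ ^ 2 + ‖W.dy z‖ ^ 2)) ∂(stripMeasure L) := by
            refine setIntegral_mono_on hf.integrableOn hD.integrableOn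
              (measurableSet_box _ _ _ _) fun z hz => (hfW z).trans ?_
            have h1 : |z.1| ≤ R := abs_le.2 ⟨hz.1.1.le, hz.1.2⟩
            rw [← mul_assoc, ← Real.exp_add]
            refine le_mul_of_one_le_left (by positivity) (Real.one_le_exp ?_)
            linarith
        _ ≤ ∫ z, Real.exp R * (Real.exp (-1 * |z.1|) *
            (‖W.dx z‖ ^ 2 + ‖W.dy z‖ ^ 2)) ∂(stripMeasure L) :=
            setIntegral_le_integral hD (ae_of_all _ fun z => by positivity)
        _ ≤ C := by
            rw [integral_const_mul, hC]
            exact mul_le_mul_of_nonneg_left hlog (Real.exp_pos _).le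
    have hdx := hle (integrable_norm_sq W.memLp_dx) fun z => le_add_of_nonneg_right (by positivity)
    have hdy := hle (integrable_norm_sq W.memLp_dy) fun z => le_add_of_nonneg_left (by positivity)
    have hpoin := W.lintegral_lintegral_enorm_sub_sq_le hL (by linarith : -R ≤ R) hL.le le_rfl le_rfl
    have hLR : 0 ≤ 2 * ((R - -R) * (L - 0)) := by
      have : 0 ≤ (R - -R) * (L - 0) := mul_nonneg (by linarith) (by linarith)
      linarith
    have hup := hpoin.trans (ENNReal.ofReal_le_ofReal (show _ ≤ K by
      rw [hK]
      gcongr))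
    refine le_trans ?_ hup
    have hνs : ν ≪ stripMeasure L := Measure.restrict_le_self.absolutelyContinuous
    -- For z in A and z' in Z the values of log(|v| + ε) differ by at least log(δ + ε) - log ε.
    have hlow : ∀ᵐ z ∂ν, z ∈ A → ENNReal.ofReal ((Real.log (δ + ε) - Real.log ε) ^ 2) * ν Z ≤
        ∫⁻ z', ‖W z - W z'‖ₑ ^ 2 ∂ν := by
      filter_upwards [hνs.ae_le hvA] with z hz hzA
      rw [← setLIntegral_const]
      refine le_trans ?_ (setLIntegral_le_lintegral Z _)
      refine setLIntegral_mono_ae' hZ ?_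
      filter_upwards [hνs.ae_le hvZ] with z' hz' hzZ
      have e1 : W z - W z' = ((Real.log (‖v z‖ + ε) - Real.log ε : ℝ) : ℂ) := by
        simp only [hW, H1.compNorm, hz' hzZ, norm_zero, zero_add, sub_self, Complex.ofReal_zero,
          sub_zero]
      have h1 : Real.log (δ + ε) ≤ Real.log (‖v z‖ + ε) :=
        Real.log_le_log (by positivity) (by linarith [hz hzA])
      have h2 : Real.log ε ≤ Real.log (δ + ε) := Real.log_le_log hε (by linarith)
      rw [e1, ← ofReal_norm, Complex.norm_real, Real.norm_eq_abs, ← ENNReal.ofReal_pow (abs_nonneg _),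
        sq_abs]
      refine ENNReal.ofReal_le_ofReal ?_
      gcongr
    calc ENNReal.ofReal ((Real.log (δ + ε) - Real.log ε) ^ 2) * (ν A * ν Z)
        = ∫⁻ z in A, ENNReal.ofReal ((Real.log (δ + ε) - Real.log ε) ^ 2) * ν Z ∂ν := by
          rw [setLIntegral_const]; ring
      _ ≤ ∫⁻ z in A, ∫⁻ z', ‖W z - W z'‖ₑ ^ 2 ∂ν ∂ν := setLIntegral_mono_ae' hA hlow
      _ ≤ _ := setLIntegral_le_lintegral A _
  by_contra hne
  have hpos : 0 < ν A * ν Z := pos_iff_ne_zero.2 hne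
  -- The lower bound diverges as ε → 0 while K stays fixed, so the product of the two measures must
  -- vanish.
  have hlim : Tendsto (fun ε : ℝ => (Real.log (δ + ε) - Real.log ε) ^ 2) (𝓝[>] 0) atTop := by
    have h1 : Tendsto (fun ε : ℝ => Real.log (δ + ε)) (𝓝[>] 0) (𝓝 (Real.log δ)) := by
      have : ContinuousAt (fun ε : ℝ => Real.log (δ + ε)) 0 :=
        ContinuousAt.log (by fun_prop) (by simp only [add_zero]; exact hδ.ne')
      have h := this.tendsto
      simp only [add_zero] at h
      exact h.mono_left nhdsWithin_le_nhds
    have h2 := h1.add_atTop (tendsto_neg_atBot_atTop.comp Real.tendsto_log_nhdsGT_zero)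
    exact (tendsto_pow_atTop two_ne_zero).comp h2
  have hlim2 : Tendsto (fun ε : ℝ => ENNReal.ofReal ((Real.log (δ + ε) - Real.log ε) ^ 2) *
      (ν A * ν Z)) (𝓝[>] 0) (𝓝 ⊤) := by
    have := ENNReal.Tendsto.mul_const (b := ν A * ν Z) (ENNReal.tendsto_ofReal_atTop.comp hlim)
      (Or.inl ENNReal.top_ne_zero)
    rwa [ENNReal.top_mul hpos.ne'] at this
  obtain ⟨ε, h1, h2⟩ := ((hlim2.eventually_const_lt (u := ENNReal.ofReal K)
    ENNReal.ofReal_lt_top).and self_mem_nhdsWithin).exists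
  exact absurd (key ε h2) (not_le.2 h1)

theorem ae_restrict_window_iff {P : ℝ × ℝ → Prop} {R₀ : ℝ} :
    (∀ᵐ z ∂(stripMeasure L), P z) ↔
      ∀ R, R₀ ≤ R → ∀ᵐ z ∂((stripMeasure L).restrict (window R)), P z := by
  refine ⟨fun h R _ => ae_restrict_of_ae h, fun h => ?_⟩
  have h1 : ∀ n : ℕ, ∀ᵐ z ∂(stripMeasure L), z ∈ window (R₀ + n) → P z := fun n =>
    (ae_restrict_iff' (measurableSet_window _)).1 (h _ (by simp))
  filter_upwards [ae_all_iff.2 h1] with z hz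
  obtain ⟨n, hn⟩ := exists_nat_gt (|z.1| - R₀)
  have : |z.1| < R₀ + n := by linarith
  exact hz n ⟨⟨(abs_lt.1 this).1, (abs_lt.1 this).2.le⟩, mem_univ _⟩

/-- The strong maximum principle for nonnegative solutions. -/
theorem ae_norm_pos (hL : 0 < L) {γ p ω : ℝ} (hγ : γ < 0) (v : H1 L) (hv : 0 < mass v)
    (h : IsSolution γ p ω (v.modulus hL)) : ∀ᵐ z ∂(stripMeasure L), 0 < ‖v z‖ := by
  set v' := v.memLp_toFun.1.mk with hv'
  have hvv : ∀ᵐ z ∂(stripMeasure L), v z = v' z := v.memLp_toFun.1.ae_eq_mk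
  have hm : Measurable v' := v.memLp_toFun.1.stronglyMeasurable_mk.measurable
  have hZ : MeasurableSet {z | v' z = 0} := hm (measurableSet_singleton 0)
  by_contra hnot
  have hnot' : ¬∀ᵐ z ∂(stripMeasure L), v' z ≠ 0 := fun h' => hnot (by
    filter_upwards [h', hvv] with z h1 h2
    rw [h2]; exact norm_pos_iff.2 h1)
  rw [ae_restrict_window_iff (R₀ := 1)] at hnot'
  push Not at hnot'
  obtain ⟨R₀, hR₀, hR₀'⟩ := hnot'
  have hZ0 : (stripMeasure L).restrict (window R₀) {z | v' z = 0} ≠ 0 := fun h0 =>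
    hR₀' (by
      rw [ae_iff]
      simpa using h0)
  -- The zero set has positive measure in the window R₀, hence in all larger ones. There every level
  -- set {|v| ≥ 1/(n+1)} must be null, so v vanishes almost everywhere, against its positive mass.
  have hzero : ∀ᵐ z ∂(stripMeasure L), ∀ n : ℕ, ‖v' z‖ < 1 / ((n : ℝ) + 1) := by
    refine ae_all_iff.2 fun n => ?_
    rw [ae_restrict_window_iff (R₀ := R₀)]
    intro R hR
    have hA : MeasurableSet {z | 1 / ((n : ℝ) + 1) ≤ ‖v' z‖} :=
      measurableSet_le measurable_const hm.norm
    have hprod := measure_mul_measure_eq_zero hL hγ v h (R := R) (by linarith) hZ hA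
      (hvv.mono fun z hz hzZ => by rw [hz]; exact hzZ) (δ := 1 / ((n : ℝ) + 1)) (by positivity)
      (hvv.mono fun z hz hzA => by rw [hz]; exact hzA)
    have hZR : (stripMeasure L).restrict (window R) {z | v' z = 0} ≠ 0 := fun h0 =>
      hZ0 (le_antisymm ((Measure.restrict_mono
        (prod_mono (Ioc_subset_Ioc (neg_le_neg hR) hR) le_rfl) le_rfl _).trans_eq h0) zero_le)
    have h0 := (mul_eq_zero.1 hprod).resolve_right hZR
    rw [ae_iff]
    simpa using h0
  refine hv.ne' (integral_eq_zero_of_ae ?_)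
  filter_upwards [hzero, hvv] with z h1 h2
  have h3 : ‖v' z‖ ≤ 0 := ge_of_tendsto' tendsto_one_div_add_atTop_nhds_zero_nat fun n => (h1 n).le
  rw [h2, le_antisymm h3 (norm_nonneg _)]
  simp

end Positivity

end DeltaStrip

/-! ### The ground state: modulus of the minimizer -/

theorem theorem2 (L γ p m : ℝ) (hL : 0 < L) (hγ : γ < 0) (hp : 1 < p) (hp3 : p < 3)
    (hm : 0 < m) :
    ∃ u : DeltaStrip.H1 L,
      DeltaStrip.IsRealPositive u ∧
      DeltaStrip.IsEnergyGroundState γ p m u ∧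
      ∃ ω : ℝ, γ ^ 2 / 4 < ω ∧ DeltaStrip.IsSolution γ p ω u := by
  obtain ⟨v, hv, hmin⟩ := DeltaStrip.exists_energy_minimizer hL hγ hp hp3 hm
  have hmass : DeltaStrip.mass (v.modulus hL) = m := by rw [DeltaStrip.mass_modulus, hv]
  have hmin' : ∀ w : DeltaStrip.H1 L, DeltaStrip.mass w = m →
      DeltaStrip.energy γ p (v.modulus hL) ≤ DeltaStrip.energy γ p w := fun w hw =>
    (DeltaStrip.energy_modulus_le v hL γ p).trans (hmin w hw)
  have hsol := DeltaStrip.isSolution_of_minimizer hL hp hp3 hm hmass hmin'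
  have hpos : 0 < DeltaStrip.mass v := by rw [hv]; exact hm
  refine ⟨v.modulus hL, ?_, ⟨hmass, ⟨_, hmass, rfl⟩, ?_⟩, _,
    DeltaStrip.lt_frequency hL hγ hp hp3 v hpos hsol, hsol⟩
  · filter_upwards [DeltaStrip.ae_norm_pos hL hγ v hpos hsol] with z hz
    rw [v.modulus_apply]
    exact ⟨Complex.ofReal_im _, by rw [Complex.ofReal_re]; exact hz⟩
  · rintro _ ⟨w, hw, rfl⟩
    exact hmin' w hw
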